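/- **Definitions.** An *occupied surface* $(\Sigma,V)$ is a compact oriented surface $\Sigma$ with boundary (possibly disconnected or empty) together with a finite set $V=V_+\sqcup V_-\subset\partial\Sigma$ of signed vertices, such that each component of $\Sigma$ has nonempty boundary, each component of $\partial\Sigma$ contains vertices, and vertices alternate in sign along each boundary component. A *square* is a disc with four vertices, a *vacuum* is a disc with two vertices. A *quadrangulation* $Q$ of $(\Sigma,V)$ is a decomposition of $\Sigma$ into finitely many squares by properly embedded arcs, with disjoint interiors, each joining vertices of opposite sign; vacuum components are left undecomposed (the null quadrangulation). A *tape graph* is a finite graph (loops, multiple edges and isolated vertices are allowed) together with, for each vertex $v$, a total ordering $h_1<\dots<h_d$ of the half-edges incident to $v$. It is thickened by replacing vertices with discs and edges with rectangles, glued to the discs in the given order; each half-edge $h$ then has two half-sides $h_-<h_+$ on the boundary of the thickening. The tape graph is *oriented* if, for each edge, with half-edges $h,h'$, the half-sides $h_-\cup h'_+$ form one side of the thickened edge and $h'_-\cup h_+$ form the other. The *barrier half-sides* at $v$ are $h_{1-}$ and $h_{d+}$ (there are none if $d=0$). A boundary component $C$ of the thickening *contains a breakpoint* if for some vertex $v$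 it contains the outer arc of the disc at $v$ (the boundary arc running from $h_{d+}$ round to $h_{1-}$, or the whole circle if $d=0$) together with all barrier half-sides at $v$. The *positive spine* $G_Q^+$ of $Q$ is the graph embedded in $\Sigma$ with vertex set $V_+$ and one edge for each square of $Q$, namely the diagonal joining the two positive vertices of the square. It is a tape graph: the half-edges at each vertex are ordered anticlockwise with respect to the orientation of $\Sigma$. **Proposition.** Let $G$ be an oriented tape graph. Then $G$ is (isomorphic, as a tape graph, to) the positive spine $G_Q^+$ of a quadrangulation $Q$ of some occupied surface $(\Sigma,V)$ if and only if every boundary component of the thickening of $G$ contains a breakpoint. -/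

import Mathlib

open Set Filter Topology

/-! ## Tape graphs and the boundary of their thickenings -/

/-- A tape graph with vertex set `V` and half-edge set `H`.  The graph may have loops, multiple
edges and isolated vertices: `root h` is the vertex at which the half-edge `h` is based, and the
edges are the pairs `{h, flip h}`.  `lt` is a strict total order on the half-edges at each vertex
(half-edges at different vertices are not comparable).

To thicken the graph, vertices become discs and edges become rectangles, attached to the discs in
the given order.  Each half-edge `h` then has two half-sides `(h, false) = h₋` and
`(h, true) = h₊`, with `h₋` before `h₊` at the vertex.  `mate` records how the rectangles
are attached: it sends a half-side of `h` to the half-side of `flip h` with which it forms a side of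
the thickened edge. -/
structure TapeGraph (V : Type*) (H : Type*) where
  root : H → V
  flip : H → H
  flip_flip : ∀ h, flip (flip h) = h
  flip_ne : ∀ h, flip h ≠ h
  lt : H → H → Prop
  root_eq_of_lt : ∀ a b, lt a b → root a = root b
  lt_irrefl : ∀ a, ¬ lt a a
  lt_trans : ∀ a b c, lt a b → lt b c → lt a c
  lt_total : ∀ a b, root a = root b → lt a b ∨ a = b ∨ lt b a
  mate : H × Bool → H × Bool
  mate_mate : ∀ x, mate (mate x) = x
  mate_fst : ∀ x, (mate x).1 = flip x.1

namespace TapeGraph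

variable {V H : Type*} (G : TapeGraph V H)

/-- `G` is oriented if, for every edge with half-edges `h` and `h' = flip h`, the half-sides `h₋`
and `h'₊` form one side of the edge, and `h₊` and `h'₋` form the other one. -/
def Oriented : Prop := ∀ (h : H) (s : Bool), G.mate (h, s) = (G.flip h, !s)

/-- `h` is the first half-edge at its vertex. -/
def IsFirst (h : H) : Prop := ∀ h', G.root h' = G.root h → ¬ G.lt h' h

/-- `h` is the last half-edge at its vertex. -/
def IsLast (h : H) : Prop := ∀ h', G.root h' = G.root h → ¬ G.lt h h'

/-- `h` and `h'` are consecutive half-edges at their common vertex, `h'` coming after `h`. -/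
def Consecutive (h h' : H) : Prop := G.lt h h' ∧ ∀ g, ¬ (G.lt h g ∧ G.lt g h')

/-- The pieces of the boundary of the thickening: the half-sides, and for each vertex `v` with
half-edges `h₁ < ⋯ < h_d` the outer arc of the disc at `v`, which runs from `h_d` round to `h₁`
(if `v` is isolated, this is the whole boundary circle of the disc at `v`).  The arcs of the disc
between consecutive half-edges are not listed as pieces; they appear in `BoundaryAdj`. -/
inductive BoundaryPiece (V H : Type*) where
  | halfSide (x : H × Bool) : BoundaryPiece V H
  | outerArc (v : V) : BoundaryPiece V H

/-- Adjacency of pieces along the boundary of the thickening. -/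
inductive BoundaryAdj : BoundaryPiece V H → BoundaryPiece V H → Prop
  /-- two half-sides that form a side of an edge -/
  | side (x : H × Bool) : BoundaryAdj (.halfSide x) (.halfSide (G.mate x))
  /-- `h₊` and `h'₋`, where `h` and `h'` are consecutive at a vertex, are joined by an arc of the
  disc at that vertex -/
  | inner (h h' : H) (hh : G.Consecutive h h') :
      BoundaryAdj (.halfSide (h, true)) (.halfSide (h', false))
  /-- the outer arc at a vertex ends at `h₋`, with `h` the first half-edge there -/
  | first (h : H) (hh : G.IsFirst h) : BoundaryAdj (.outerArc (G.root h)) (.halfSide (h, false))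
  /-- the outer arc at a vertex starts at `h₊`, with `h` the last half-edge there -/
  | last (h : H) (hh : G.IsLast h) : BoundaryAdj (.halfSide (h, true)) (.outerArc (G.root h))

/-- The boundary components of the thickening: the classes of the equivalence relation generated
by adjacency. -/
def BoundaryComponent : Type _ := Quot G.BoundaryAdj

variable {G} in
/-- The boundary component `C` contains the piece `p`. -/
def BoundaryComponent.Contains (C : G.BoundaryComponent) (p : BoundaryPiece V H) : Prop :=
  Quot.mk G.BoundaryAdj p = C

/-- The barrier half-sides at a vertex `v` with half-edges `h₁ < ⋯ < h_d` are `h₁₋` and `h_d₊`. -/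
def IsBarrierHalfSide (v : V) (x : H × Bool) : Prop :=
  G.root x.1 = v ∧ ((x.2 = false ∧ G.IsFirst x.1) ∨ (x.2 = true ∧ G.IsLast x.1))

variable {G} in
/-- The boundary component `C` contains a breakpoint: a vertex (that is, the outer arc of its disc)
together with its barrier half-sides. -/
def BoundaryComponent.HasBreakpoint (C : G.BoundaryComponent) : Prop :=
  ∃ v : V, C.Contains (.outerArc v) ∧ ∀ x, G.IsBarrierHalfSide v x → C.Contains (.halfSide x)

end TapeGraph

/-! ## Occupied surfaces -/

/-- The oriented Euclidean plane. -/
abbrev Plane : Type := EuclideanSpace ℝ (Fin 2)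

noncomputable section

/-- The unit vector at angle `t`. -/
def Plane.dir (t : ℝ) : Plane := !₂[Real.cos t, Real.sin t]

/-- For a map `f` that is continuous and injective near `z`: `f` preserves the orientation
at `z`, that is, the image under `f` of each small anticlockwise circle about `z` has winding
number `1` about `f z`. -/
def PreservesOrientationAt (f : Plane → Plane) (z : Plane) : Prop :=
  ∀ᶠ r in 𝓝[>] (0 : ℝ), ∃ θ : ℝ → ℝ, Continuous θ ∧ θ (2 * Real.pi) = θ 0 + 2 * Real.pi ∧
    ∀ t, ∃ ρ : ℝ, 0 < ρ ∧ f (z + r • Plane.dir t) = f z + ρ • Plane.dir (θ t)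

/-- The half-plane model (`0 ≤ x 0`) of surfaces with boundary. -/
abbrev halfPlaneModel : ModelWithCorners ℝ Plane (EuclideanHalfSpace 2) :=
  modelWithCornersEuclideanHalfSpace 2

/-- An occupied surface: a compact oriented (topological) surface `S` with boundary, possibly
empty or disconnected, with finite sets `pos` and `neg` of positive and negative vertices on the
boundary.  The orientation is given by the atlas, whose transition maps preserve orientation. -/
structure OccupiedSurface (S : Type*) [TopologicalSpace S] [ChartedSpace (EuclideanHalfSpace 2) S]
    where
  t2 : T2Space S
  compact : CompactSpace S
  oriented : ∀ e ∈ atlas (EuclideanHalfSpace 2) S, ∀ e' ∈ atlas (EuclideanHalfSpace 2) S,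
    ∀ z ∈ ((e.extend halfPlaneModel).symm.trans (e'.extend halfPlaneModel)).source ∩
        interior (range halfPlaneModel),
      PreservesOrientationAt (e'.extend halfPlaneModel ∘ (e.extend halfPlaneModel).symm) z
  pos : Set S
  neg : Set S
  pos_finite : pos.Finite
  neg_finite : neg.Finite
  disjoint : Disjoint pos neg
  vertices_subset : pos ∪ neg ⊆ halfPlaneModel.boundary S
  /-- each component of the surface has nonempty boundary -/
  boundary_nonempty : ∀ x : S, (connectedComponent x ∩ halfPlaneModel.boundary S).Nonempty
  /-- each component of the boundary contains vertices -/
  vertices_nonempty : ∀ x ∈ halfPlaneModel.boundary S,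
    (connectedComponentIn (halfPlaneModel.boundary S) x ∩ (pos ∪ neg)).Nonempty
  /-- vertices alternate in sign along the boundary: each of the open arcs into which the vertices
  cut the boundary has a positive and a negative end point -/
  alternating : ∀ x ∈ halfPlaneModel.boundary S \ (pos ∪ neg),
    (closure (connectedComponentIn (halfPlaneModel.boundary S \ (pos ∪ neg)) x) ∩ pos).Nonempty ∧
    (closure (connectedComponentIn (halfPlaneModel.boundary S \ (pos ∪ neg)) x) ∩ neg).Nonempty

/-! ## Quadrangulations and their positive spines -/

/-- The model square: the convex quadrilateral with corners `(1,0)`, `(0,1)`, `(-1,0)`, `(0,-1)`. -/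
def modelSquare : Set Plane := {z | |z 0| + |z 1| ≤ 1}

/-- The interior of the model square. -/
def openModelSquare : Set Plane := {z | |z 0| + |z 1| < 1}

/-- The corners of the model square, in anticlockwise order. -/
def squareCorner : Fin 4 → Plane := ![!₂[1, 0], !₂[0, 1], !₂[-1, 0], !₂[0, -1]]

/-- The open edge of the model square from corner `k` to corner `k + 1` (modulo `4`). -/
def squareEdge (k : Fin 4) : Set Plane := openSegment ℝ (squareCorner k) (squareCorner (k + 1))

namespace OccupiedSurface

variable {S : Type*} [TopologicalSpace S] [ChartedSpace (EuclideanHalfSpace 2) S]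

/-- The component of `x` is a vacuum: a disc with exactly two vertices, one of each sign. -/
def IsVacuumAt (X : OccupiedSurface S) (x : S) : Prop :=
  Nonempty (connectedComponent x ≃ₜ Metric.closedBall (0 : Plane) 1) ∧
    ∃ p ∈ X.pos, ∃ q ∈ X.neg, connectedComponent x ∩ (X.pos ∪ X.neg) = {p, q}

/-- A quadrangulation of an occupied surface: a decomposition into finitely many squares along
decomposing arcs, with the null quadrangulation (no squares) on vacuum components.  The squares are
given by orientation preserving characteristic maps from the model square, with corners `0` and `2`
positive and corners `1` and `3` negative.  Open squares are embedded and disjoint from one another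
and from all edges.  Each open edge of a square is embedded, either as an open boundary edge,
belonging to no other square edge, or as the interior of a decomposing arc, which is a properly
embedded arc between vertices of opposite sign and belongs to precisely one other square edge. -/
structure Quadrangulation (X : OccupiedSurface S) where
  /-- the number of squares -/
  n : ℕ
  map : Fin n → Plane → S
  continuousOn_map : ∀ i, ContinuousOn (map i) modelSquare
  orientation_map : ∀ i, ∀ z ∈ openModelSquare,
    PreservesOrientationAt (extChartAt halfPlaneModel (map i z) ∘ map i) z
  map_corner_zero : ∀ i, map i (squareCorner 0) ∈ X.pos
  map_corner_one : ∀ i, map i (squareCorner 1) ∈ X.neg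
  map_corner_two : ∀ i, map i (squareCorner 2) ∈ X.pos
  map_corner_three : ∀ i, map i (squareCorner 3) ∈ X.neg
  /-- the squares cover everything but the vacuum components -/
  covers : ∀ x : S, (∃ i, x ∈ map i '' modelSquare) ↔ ¬ X.IsVacuumAt x
  inj_open : ∀ i, ∀ z ∈ openModelSquare, ∀ j, ∀ w ∈ modelSquare,
    map i z = map j w → i = j ∧ z = w
  inj_edge : ∀ i k, InjOn (map i) (squareEdge k)
  /-- two open edges have the same image or disjoint images -/
  edge_eq_or_disjoint : ∀ i k j l,
    map i '' squareEdge k = map j '' squareEdge l ∨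
      Disjoint (map i '' squareEdge k) (map j '' squareEdge l)
  edge_boundary_or_internal : ∀ i k,
    (map i '' squareEdge k ⊆ halfPlaneModel.boundary S \ (X.pos ∪ X.neg) ∧
      ∀ j l, map j '' squareEdge l = map i '' squareEdge k → (j, l) = (i, k)) ∨
    (map i '' squareEdge k ⊆ halfPlaneModel.interior S ∧
      ∃! e : Fin n × Fin 4, e ≠ (i, k) ∧ map e.1 '' squareEdge e.2 = map i '' squareEdge k)

namespace Quadrangulation

variable {X : OccupiedSurface S} (Q : X.Quadrangulation)

/-- The half-edges of the positive spine.  The edges of the positive spine are the diagonals of the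
squares from corner `0` to corner `2`; the half-edge `(i, false)` is the half of the diagonal of the
square `i` at corner `0`, and `(i, true)` is the half at corner `2`. -/
abbrev HalfEdge : Type := Fin Q.n × Bool

/-- The corner of its square at which a half-edge of the positive spine is based. -/
def cornerOf (b : Bool) : Fin 4 := if b then 2 else 0

/-- The positive vertex at which a half-edge of the positive spine is based. -/
def spineRoot (h : Q.HalfEdge) : S := Q.map h.1 (squareCorner (cornerOf h.2))

/-- The half-edge `h'` comes immediately after `h` in anticlockwise order around their vertex.
Turning anticlockwise about corner `k` of a square one enters the square through its edge `k` and
leaves it through its edge `k - 1` (modulo `4`); so the edge through which one leaves the square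
of `h` has to be the one through which one enters the square of `h'`. -/
def SpineNext (h h' : Q.HalfEdge) : Prop :=
  Q.map h.1 '' squareEdge (cornerOf h.2 - 1) = Q.map h'.1 '' squareEdge (cornerOf h'.2)

/-- The anticlockwise order of the half-edges of the positive spine at each vertex. -/
def SpineLt : Q.HalfEdge → Q.HalfEdge → Prop := Relation.TransGen Q.SpineNext

/-- The diagonal cuts its square into two triangles, with negative corners `1` and `3`.  This is
the negative corner of the triangle that contains the given half-side of the given half-edge: the
half-side `h₋` of a half-edge at corner `k` is in the triangle of corner `k + 1`, and `h₊` in the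
triangle of corner `k - 1`. -/
def triangleOf (b s : Bool) : Fin 4 := if s then cornerOf b - 1 else cornerOf b + 1

/-- The tape graph `G` is (isomorphic to) the positive spine of the quadrangulation `Q`: its
vertices correspond to the positive vertices, its half-edges to the halves of the diagonals, and the
incidences, edges, orders and sides are those of the positive spine. -/
def IsPositiveSpine {V H : Type*} (G : TapeGraph V H) : Prop :=
  ∃ (α : V ≃ X.pos) (β : H ≃ Q.HalfEdge),
    (∀ h, (α (G.root h) : S) = Q.spineRoot (β h)) ∧
    (∀ h, β (G.flip h) = ((β h).1, !(β h).2)) ∧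
    (∀ h h', G.lt h h' ↔ Q.SpineLt (β h) (β h')) ∧
    (∀ x, triangleOf (β (G.mate x).1).2 (G.mate x).2 = triangleOf (β x.1).2 x.2)

end Quadrangulation

end OccupiedSurface

end

/-- `G` is the positive spine of a quadrangulation of some occupied surface. -/
def TapeGraph.IsSpine {V H : Type*} (G : TapeGraph V H) : Prop :=
  ∃ (S : Type) (_ : TopologicalSpace S) (_ : ChartedSpace (EuclideanHalfSpace 2) S)
    (X : OccupiedSurface S) (Q : X.Quadrangulation), Q.IsPositiveSpine G

/-! ## A criterion for a map of the plane to preserve orientation -/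

/-! An outer arc is adjacent to the barrier half-sides at its vertex, so a boundary component has a
breakpoint exactly when it contains an outer arc. A component without outer arcs alternates between
sides of edges and inner arcs at vertices. It is therefore a cycle of half-edges, each consecutive
to the flip of the following one. In a quadrangulation the diagonals cut the squares into triangles
with one negative corner each, and following such a component means turning around a negative vertex
from triangle to triangle. So the condition says that the squares at each negative vertex form a
linear fan and never a cycle.

Necessity: a cyclic fan would fill a full disc about a negative vertex, but this vertex lies on the
boundary of the surface. In a half-plane chart the disc, in polar coordinates, has its centre on the
boundary line. A Borsuk type argument (`exists_eq_of_polar_disc`) then makes two points coincide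
whose angles differ by half a period, whereas the fan only identifies points whose angles differ by
whole periods (`not_cyclic_fan`).

Sufficiency: take a square for each edge and glue along consecutive half-edges; an isolated vertex
gives a vacuum. The gluing relation between corners is a partial injection. It has no cycles at
positive corners because the orders are strict, and none at negative corners by hypothesis
(`not_transGen_oddNext`). Hence all corners at a vertex form a linear fan, which is what a
`SquareComplex` records. Its realization is a subset of a finite-dimensional real space described by
heights and angles at the vertices and by bump functions of the open squares. The star of a vertex
is a wedge, which opens to a half-plane. All charts are affine with positive determinant on quarters
of squares, and at a point of two different charts at most two quarters meet, so
`preservesOrientationAt_of_linear_pieces` gives the orientation.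

It remains to see that a component made of glued squares is not a vacuum. An integral cocycle
(`height`) takes the values 0 and 1 at the two positive corners of each square, and it defines a
circle-valued function on the component. On a disc this function lifts to the reals, so the two
corners are different vertices (`vert_ne_of_disc`), while a vacuum has only one positive vertex. -/

theorem exists_continuous_angle {g a : ℝ → ℂ} {α : ℂ} (hg : Continuous g) (ha : Continuous a)
    (hα : α ≠ 0) (hper : g (2 * Real.pi) = g 0) (haper : a (2 * Real.pi) = a 0)
    (h1 : ∀ t, a t / (α * Complex.exp (t * Complex.I)) ∈ Complex.slitPlane)
    (h2 : ∀ t, g t / a t ∈ Complex.slitPlane) :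
    ∃ θ : ℝ → ℝ, Continuous θ ∧ θ (2 * Real.pi) = θ 0 + 2 * Real.pi ∧
      ∀ t, ∃ ρ : ℝ, 0 < ρ ∧ g t = ρ * Complex.exp (θ t * Complex.I) := by
  have hE : Continuous fun t : ℝ => α * Complex.exp (t * Complex.I) := by fun_prop
  have hE0 : ∀ t : ℝ, α * Complex.exp (t * Complex.I) ≠ 0 := fun t =>
    mul_ne_zero hα (Complex.exp_ne_zero _)
  have ha0 : ∀ t, a t ≠ 0 := fun t h => by
    have := Complex.slitPlane_ne_zero (h2 t); simp [h] at this
  have hg0 : ∀ t, g t ≠ 0 := fun t h => by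
    have := Complex.slitPlane_ne_zero (h2 t); simp [h] at this
  -- The ratios avoid the cut of the argument, so the two comparison angles are continuous and
  -- periodic. Only the summand `t` contributes to the winding.
  refine ⟨fun t => t + α.arg + (a t / (α * Complex.exp (t * Complex.I))).arg + (g t / a t).arg,
    ?_, ?_, fun t => ⟨‖g t‖, norm_pos_iff.2 (hg0 t), ?_⟩⟩
  · refine ((continuous_id.add continuous_const).add ?_).add ?_
    · exact continuous_iff_continuousAt.2 fun t =>
        (Complex.continuousAt_arg (h1 t)).comp (f := fun t : ℝ => a t / (α * Complex.exp (t * Complex.I)))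
          (ha.div hE hE0).continuousAt
    · exact continuous_iff_continuousAt.2 fun t =>
        (Complex.continuousAt_arg (h2 t)).comp (f := fun t : ℝ => g t / a t) (hg.div ha ha0).continuousAt
  · have : Complex.exp (((2 * Real.pi : ℝ) : ℂ) * Complex.I) = Complex.exp (((0 : ℝ) : ℂ) * Complex.I) := by
      push_cast; simp [Complex.exp_two_pi_mul_I]
    simp only [hper, haper, this]; ring
  · have e1 := Complex.norm_mul_exp_arg_mul_I (g t / a t)
    have e2 := Complex.norm_mul_exp_arg_mul_I (a t / (α * Complex.exp (t * Complex.I)))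
    have e3 := Complex.norm_mul_exp_arg_mul_I α
    push_cast
    rw [add_mul, add_mul, add_mul, Complex.exp_add, Complex.exp_add, Complex.exp_add]
    have hn : (‖g t‖ : ℂ) = ‖g t / a t‖ * ‖a t / (α * Complex.exp (t * Complex.I))‖ * ‖α‖ := by
      have h0 : ‖a t‖ ≠ 0 := norm_ne_zero_iff.2 (ha0 t)
      have h1 : ‖α‖ ≠ 0 := norm_ne_zero_iff.2 hα
      rw [norm_div, norm_div, norm_mul, Complex.norm_exp_ofReal_mul_I]
      push_cast
      have h0' : (‖a t‖ : ℂ) ≠ 0 := by exact_mod_cast h0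
      have h1' : (‖α‖ : ℂ) ≠ 0 := by exact_mod_cast h1
      field_simp
    have : g t = (g t / a t) * (a t / (α * Complex.exp (t * Complex.I))) * α *
        Complex.exp (t * Complex.I) := by
      have := ha0 t; have := Complex.exp_ne_zero (t * Complex.I)
      field_simp
    calc g t = _ := this
      _ = (‖g t / a t‖ * Complex.exp ((g t / a t).arg * Complex.I)) *
          (‖a t / (α * Complex.exp (t * Complex.I))‖ *
            Complex.exp ((a t / (α * Complex.exp (t * Complex.I))).arg * Complex.I)) *
          (‖α‖ * Complex.exp (α.arg * Complex.I)) * Complex.exp (t * Complex.I) := by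
        rw [e1, e2, e3]
      _ = _ := by rw [hn]; ring

/-- A plane vector as a complex number. -/
noncomputable def Plane.toComplex (w : Plane) : ℂ := ⟨w 0, w 1⟩

theorem Plane.continuous_toComplex : Continuous Plane.toComplex := by
  have : Plane.toComplex = fun w : Plane => ((w 0 : ℝ) : ℂ) + ((w 1 : ℝ) : ℂ) * Complex.I := by
    ext w; simp [Plane.toComplex, Complex.ext_iff]
  rw [this]; fun_prop

@[simp] theorem Plane.dir_zero (t : ℝ) : Plane.dir t 0 = Real.cos t := rfl

@[simp] theorem Plane.dir_one (t : ℝ) : Plane.dir t 1 = Real.sin t := rfl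

theorem Plane.ext' {v w : Plane} (h0 : v 0 = w 0) (h1 : v 1 = w 1) : v = w := by
  ext i; fin_cases i <;> assumption

-- The image of a small circle is compared with `A` applied to the circle, and the latter with the
-- complex linear part of `A`. A comparison fails only where two vectors point in opposite
-- directions or vanish, which positive determinants and agreement along `u` exclude.
open Matrix in
theorem preservesOrientationAt_of_linear_pieces {f : Plane → Plane} {z : Plane}
    (A B : Matrix (Fin 2) (Fin 2) ℝ) (hA : 0 < A.det) (hB : 0 < B.det) (u : Fin 2 → ℝ) (hu : u ≠ 0)
    (hAB : A *ᵥ u = B *ᵥ u) (hc : ∀ᶠ y in 𝓝 z, ContinuousAt f y)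
    (hf : ∀ᶠ y in 𝓝 z, (∀ i, f y i - f z i = A i 0 * (y 0 - z 0) + A i 1 * (y 1 - z 1)) ∨
      ∀ i, f y i - f z i = B i 0 * (y 0 - z 0) + B i 1 * (y 1 - z 1)) :
    PreservesOrientationAt f z := by
  obtain ⟨ε, hε, hball⟩ := Metric.eventually_nhds_iff.1 (hc.and hf)
  have hu2 : 0 < u 0 ^ 2 + u 1 ^ 2 := by
    by_contra! hcon
    apply hu; ext i; fin_cases i <;> simp <;> nlinarith [sq_nonneg (u 0), sq_nonneg (u 1)]
  simp only [Matrix.det_fin_two] at hA hB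
  have hAB0 := congrFun hAB 0
  have hAB1 := congrFun hAB 1
  simp only [mulVec, dotProduct, Fin.sum_univ_two] at hAB0 hAB1
  generalize hp : A 0 0 = p at *
  generalize hq : A 0 1 = q at *
  generalize hr : A 1 0 = r at *
  generalize hs : A 1 1 = s at *
  generalize hp' : B 0 0 = p' at *
  generalize hq' : B 0 1 = q' at *
  generalize hr' : B 1 0 = r' at *
  generalize hs' : B 1 1 = s' at *
  refine Filter.mem_of_superset (Ioo_mem_nhdsGT hε) fun ρ hρ => ?_
  have hin : ∀ t, dist (z + ρ • Plane.dir t) z < ε := fun t => by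
    rw [dist_eq_norm, add_sub_cancel_left, norm_smul, Real.norm_of_nonneg hρ.1.le]
    have : ‖Plane.dir t‖ = 1 := by
      rw [EuclideanSpace.norm_eq]; simp [Plane.dir]
    rw [this, mul_one]; exact hρ.2
  have hdir : Continuous Plane.dir := by
    unfold Plane.dir
    apply (PiLp.continuous_toLp 2 _).comp
    refine continuous_pi fun i => ?_
    fin_cases i
    · exact Real.continuous_cos
    · exact Real.continuous_sin
  suffices key : ∃ θ : ℝ → ℝ, Continuous θ ∧ θ (2 * Real.pi) = θ 0 + 2 * Real.pi ∧
      ∀ t, ∃ k : ℝ, 0 < k ∧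
        (f (z + ρ • Plane.dir t) - f z).toComplex = k * Complex.exp (θ t * Complex.I) by
    obtain ⟨θ, hθ1, hθ2, hθ3⟩ := key
    refine ⟨θ, hθ1, hθ2, fun t => ?_⟩
    obtain ⟨k, hk, hk'⟩ := hθ3 t
    refine ⟨k, hk, ?_⟩
    have h0 := congrArg Complex.re hk'
    have h1 := congrArg Complex.im hk'
    simp [Plane.toComplex, Complex.exp_ofReal_mul_I_re, Complex.exp_ofReal_mul_I_im] at h0 h1
    apply Plane.ext' <;> simp <;> linarith
  -- `α` is the complex linear part of `A`. It is nonzero because `4 |α|² = (p - s)² + (q + r)² + 4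
  -- det A`.
  refine exists_continuous_angle (g := fun t => (f (z + ρ • Plane.dir t) - f z).toComplex)
    (a := fun t => ⟨p * Real.cos t + q * Real.sin t, r * Real.cos t + s * Real.sin t⟩)
    (α := ⟨(p + s) / 2, (r - q) / 2⟩) ?_ ?_ ?_ ?_ ?_ ?_ ?_
  · have hcont : Continuous fun t => z + ρ • Plane.dir t := (hdir.const_smul ρ).const_add z
    have hfc : Continuous fun t => f (z + ρ • Plane.dir t) := continuous_iff_continuousAt.2 fun t =>
      ContinuousAt.comp (f := fun t => z + ρ • Plane.dir t) (hball (hin t)).1 hcont.continuousAt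
    exact Plane.continuous_toComplex.comp (hfc.sub continuous_const)
  · have : (fun t : ℝ => (⟨p * Real.cos t + q * Real.sin t, r * Real.cos t + s * Real.sin t⟩ : ℂ)) =
        fun t => ((p * Real.cos t + q * Real.sin t : ℝ) : ℂ) +
          ((r * Real.cos t + s * Real.sin t : ℝ) : ℂ) * Complex.I := by
      ext t; simp [Complex.ext_iff, -Complex.ofReal_cos, -Complex.ofReal_sin]
    rw [this]; fun_prop
  · intro h
    have h0 := congrArg Complex.re h
    have h1 := congrArg Complex.im h
    simp at h0 h1
    nlinarith [sq_nonneg (p - s), sq_nonneg (r + q), sq_nonneg p, sq_nonneg r]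
  · simp [Plane.dir]
  · simp
  · intro t
    left
    have hcs := Real.cos_sq_add_sin_sq t
    rw [Complex.div_re, ← add_div]
    have hpos : 0 < Complex.normSq ((⟨(p + s) / 2, (r - q) / 2⟩ : ℂ) * Complex.exp (t * Complex.I)) := by
      rw [Complex.normSq_pos]
      refine mul_ne_zero (fun h => ?_) (Complex.exp_ne_zero _)
      have h0 := congrArg Complex.re h
      have h1 := congrArg Complex.im h
      simp at h0 h1
      nlinarith [sq_nonneg (p - s), sq_nonneg (r + q), sq_nonneg p, sq_nonneg r]
    apply div_pos _ hpos
    simp only [Complex.mul_re, Complex.mul_im, Complex.exp_ofReal_mul_I_re, Complex.exp_ofReal_mul_I_im]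
    set c := Real.cos t
    set d := Real.sin t
    -- For a unit vector `v` the scalar product of `A v` and `α v` is `(|A v|² + det A) / 2`, which
    -- is positive.
    have : (p * c + q * d) * ((p + s) / 2 * c - (r - q) / 2 * d) +
        (r * c + s * d) * ((p + s) / 2 * d + (r - q) / 2 * c) =
        ((p * c + q * d) ^ 2 + (r * c + s * d) ^ 2 + (p * s - q * r) * (c ^ 2 + d ^ 2)) / 2 := by ring
    rw [this, hcs]
    positivity
  · intro t
    have hcs := Real.cos_sq_add_sin_sq t
    set c := Real.cos t with hc
    set d := Real.sin t with hd
    have ha0 : (⟨p * c + q * d, r * c + s * d⟩ : ℂ) ≠ 0 := by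
      intro h
      have h0 := congrArg Complex.re h
      have h1 := congrArg Complex.im h
      simp at h0 h1
      have hc0 : (p * s - q * r) * c = 0 := by linear_combination s * h0 - q * h1
      have hd0 : (p * s - q * r) * d = 0 := by linear_combination p * h1 - r * h0
      have hc1 : c = 0 := by simpa [hA.ne'] using hc0
      have hd1 : d = 0 := by simpa [hA.ne'] using hd0
      rw [hc1, hd1] at hcs; norm_num at hcs
    -- Otherwise the image vector is `l` times `A v` with `l ≤ 0`. On the piece `A` this forces `A v
    -- = 0`. On the piece `B`, taking determinants with `A u = B u` forces `v` to be parallel to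
    -- `u`, and there `A` and `B` agree.
    by_contra hcon
    rw [Complex.mem_slitPlane_iff, not_or, not_lt, not_not] at hcon
    set R := (f (z + ρ • Plane.dir t) - f z).toComplex / (⟨p * c + q * d, r * c + s * d⟩ : ℂ) with hR
    have hR' : (f (z + ρ • Plane.dir t) - f z).toComplex =
        R * (⟨p * c + q * d, r * c + s * d⟩ : ℂ) := by rw [hR, div_mul_cancel₀ _ ha0]
    have e0 := congrArg Complex.re hR'
    have e1 := congrArg Complex.im hR'
    simp only [Complex.mul_re, Complex.mul_im, hcon.2] at e0 e1
    set l := R.re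
    have hρ0 := hρ.1
    simp only [Plane.toComplex, PiLp.sub_apply] at e0 e1
    rcases (hball (hin t)).2 with h | h <;>
      rw [h 0] at e0 <;> rw [h 1] at e1 <;>
      simp only [PiLp.add_apply, PiLp.smul_apply, smul_eq_mul, add_sub_cancel_left, Plane.dir_zero,
        Plane.dir_one, ← hc, ← hd, hp, hq, hr, hs, hp', hq', hr', hs', zero_mul, sub_zero,
        add_zero] at e0 e1
    · have h0 : (ρ - l) * (p * c + q * d) = 0 := by linear_combination e0
      have h1 : (ρ - l) * (r * c + s * d) = 0 := by linear_combination e1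
      have : ρ - l ≠ 0 := by linarith [hcon.1]
      apply ha0
      simp [this] at h0 h1
      simp [Complex.ext_iff, h0, h1]
    · -- `(B + lam A) v = 0` while `(B + lam A) u = (1 + lam) A u`
      have hl : l ≤ 0 := hcon.1
      have k0 : (ρ * p' - l * p) * c + (ρ * q' - l * q) * d = 0 := by linear_combination e0
      have k1 : (ρ * r' - l * r) * c + (ρ * s' - l * s) * d = 0 := by linear_combination e1
      set D := u 0 * d - u 1 * c with hD
      -- determinant comparison
      have j1 : ρ * (p' * s' - q' * r') * D = l * (p * s - q * r) * D := by
        have m0 : ρ * (p' * c + q' * d) = l * (p * c + q * d) := by linear_combination e0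
        have m1 : ρ * (r' * c + s' * d) = l * (r * c + s * d) := by linear_combination e1
        have : ρ * (p' * s' - q' * r') * D = (p' * u 0 + q' * u 1) * (ρ * (r' * c + s' * d)) -
            (r' * u 0 + s' * u 1) * (ρ * (p' * c + q' * d)) := by rw [hD]; ring
        rw [this, m0, m1, ← hAB0, ← hAB1, hD]; ring
      have hD0 : D = 0 := by
        have : (ρ * (p' * s' - q' * r') - l * (p * s - q * r)) * D = 0 := by linear_combination j1
        have hpos : 0 < ρ * (p' * s' - q' * r') - l * (p * s - q * r) := by
          have := mul_pos hρ0 hB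
          nlinarith
        simpa [hpos.ne'] using this
      -- `v` is a multiple of `u`
      have hv0 : c = (u 0 * c + u 1 * d) / (u 0 ^ 2 + u 1 ^ 2) * u 0 := by
        field_simp; linear_combination (- u 1) * hD0
      have hv1 : d = (u 0 * c + u 1 * d) / (u 0 ^ 2 + u 1 ^ 2) * u 1 := by
        field_simp; linear_combination (u 0) * hD0
      set x := (u 0 * c + u 1 * d) / (u 0 ^ 2 + u 1 ^ 2)
      have n0 : (ρ - l) * (p * c + q * d) = 0 := by
        rw [hv0, hv1] at k0 ⊢
        linear_combination k0 + ρ * x * hAB0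
      have n1 : (ρ - l) * (r * c + s * d) = 0 := by
        rw [hv0, hv1] at k1 ⊢
        linear_combination k1 + ρ * x * hAB1
      have : ρ - l ≠ 0 := by linarith [hcon.1]
      apply ha0
      simp [this] at n0 n1
      simp [Complex.ext_iff, n0, n1]

/-! ## Lifting arguments -/

/-- A continuous circle-valued function on a closed disc has a continuous logarithm. -/
theorem exists_circle_lift {f : Metric.closedBall (0 : Plane) 1 → Circle} (hf : Continuous f) :
    ∃ g : Metric.closedBall (0 : Plane) 1 → ℝ, Continuous g ∧ ∀ x, Circle.exp (g x) = f x := by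
  have hmem : ∀ p : unitInterval × Metric.closedBall (0 : Plane) 1,
      (p.1 : ℝ) • (p.2 : Plane) ∈ Metric.closedBall (0 : Plane) 1 := fun p => by
    have h2 := p.2.2
    rw [mem_closedBall_zero_iff] at h2 ⊢
    rw [norm_smul, Real.norm_of_nonneg p.1.2.1]
    exact mul_le_one₀ p.1.2.2 (norm_nonneg _) h2
  -- The radial contraction is a homotopy from a constant to `f`. Lifting it through the covering,
  -- starting from a constant, gives the logarithm at time one.
  let H : C(unitInterval × Metric.closedBall (0 : Plane) 1, Circle) :=
    ⟨fun p => f ⟨(p.1 : ℝ) • (p.2 : Plane), hmem p⟩, by fun_prop⟩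
  obtain ⟨e, he⟩ := Circle.exp_surjective (f ⟨0, by simp⟩)
  have H0 : ∀ a, H (0, a) = Circle.exp (ContinuousMap.const _ e a) := fun a => by
    simp [H, he]
  have hl := Circle.isCoveringMap_exp.liftHomotopy_lifts H (ContinuousMap.const _ e) H0
  refine ⟨fun x => Circle.isCoveringMap_exp.liftHomotopy H (ContinuousMap.const _ e) H0 (1, x),
    by fun_prop, fun x => ?_⟩
  have := congrFun hl (1, x)
  simpa [H] using this

/-- A disc in a half-plane, given in polar coordinates with angular period `T`, whose centre lies on
the boundary line, is not embedded. -/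
theorem exists_eq_of_polar_disc {Φ : unitInterval × ℝ → ℂ} (hc : Continuous Φ) {T : ℝ}
    (hper : ∀ t s, Φ (t, s + T) = Φ (t, s)) {c : ℂ} (hcen : ∀ s, Φ (0, s) = c)
    (hre : ∀ p, c.re ≤ (Φ p).re) : ∃ t s, Φ (1, s) = Φ (t, s + T / 2) := by
  by_contra! hinj
  have hne : ∀ p : unitInterval × ℝ, Φ (1, p.2) - Φ (p.1, p.2 + T / 2) ≠ 0 := fun p h =>
    hinj p.1 p.2 (sub_eq_zero.1 h)
  -- `H` deforms the difference of rim and centre into the difference of opposite rim points. The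
  -- first lies in the closed right half-plane without zero, so it has a logarithm of period `T`;
  -- the second changes sign under half a period. These properties are incompatible.
  let H : C(unitInterval × ℝ, {z : ℂ // z ≠ 0}) := ⟨fun p => ⟨_, hne p⟩, by fun_prop⟩
  have hG0 : ∀ s : ℝ, Φ (1, s) - c ≠ 0 := fun s => by
    simpa [hcen] using hne (0, s)
  have hslit : ∀ s : ℝ, Φ (1, s) - c ∈ Complex.slitPlane := fun s => by
    rw [Complex.mem_slitPlane_iff]
    by_contra! hcon
    have := hre (1, s)
    apply hG0 s
    rw [Complex.sub_re] at hcon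
    refine Complex.ext ?_ (by simpa using hcon.2)
    rw [Complex.sub_re, Complex.zero_re]; linarith [hcon.1]
  have cG : Continuous fun s : ℝ => Φ (1, s) - c := by fun_prop
  let f : C(ℝ, ℂ) := ⟨fun s => Complex.log (Φ (1, s) - c), cG.clog hslit⟩
  have H0 : ∀ a, H (0, a) = ⟨Complex.exp (f a), Complex.exp_ne_zero _⟩ := fun a => by
    apply Subtype.ext
    simp [H, f, Complex.exp_log (hG0 a), hcen]
  have cov := Complex.isCoveringMap_exp
  set Λ := cov.liftHomotopy H f H0 with hΛ
  have hl : ∀ p, Complex.exp (Λ p) = H p := fun p =>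
    congrArg Subtype.val (congrFun (cov.liftHomotopy_lifts H f H0) p)
  have hperiod : ∀ p : unitInterval × ℝ, Λ (p.1, p.2 + T) = Λ p := by
    let Λ' : C(unitInterval × ℝ, ℂ) := ⟨fun p => Λ (p.1, p.2 + T), by fun_prop⟩
    have : Λ' = cov.liftHomotopy H f H0 := by
      rw [cov.eq_liftHomotopy_iff']
      refine ⟨funext fun p => Subtype.ext ?_, fun a => ?_⟩
      · change Complex.exp (Λ (p.1, p.2 + T)) = _
        rw [hl]; simp only [H, ContinuousMap.coe_mk, hper, add_right_comm _ T]
      · change Λ (0, a + T) = f a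
        rw [hΛ, cov.liftHomotopy_zero]; simp only [f, ContinuousMap.coe_mk, hper]
    intro p
    exact congrArg (fun Γ : C(unitInterval × ℝ, ℂ) => Γ p) this
  have hodd : ∀ s : ℝ, (H (1, s + T / 2) : ℂ) = - H (1, s) := fun s => by
    have : s + T / 2 + T / 2 = s + T := by ring
    simp [H, this, hper]
  -- Both sides lift the same map, so a shift by half a period adds a constant to the logarithm. Two
  -- shifts add nothing, so the constant vanishes, although it has to produce the factor `-1`.
  have hshift : (fun s : ℝ => Λ (1, s + T / 2)) =
      fun s : ℝ => Λ (1, s) + (Λ (1, T / 2) - Λ (1, 0)) := by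
    refine cov.eq_of_comp_eq (by fun_prop) (by fun_prop) (funext fun s => Subtype.ext ?_) 0 (by simp)
    change Complex.exp _ = Complex.exp _
    have h0 := hodd 0
    rw [zero_add] at h0
    rw [Complex.exp_add, Complex.exp_sub, hl, hl, hl, hl, hodd, h0, neg_div, div_self (H (1, 0)).2,
      mul_neg_one]
  have e1 := congrFun hshift (T / 2)
  have e2 := hperiod (1, 0)
  have e3 : Λ (1, T / 2) = Λ (1, 0) := by
    have : T / 2 + T / 2 = 0 + T := by ring
    simp only [this] at e1
    rw [e2] at e1
    linear_combination (-1 / 2) * e1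
  have h0 := hodd 0
  rw [zero_add, ← hl, ← hl, e3] at h0
  exact Complex.exp_ne_zero (Λ (1, 0)) (by linear_combination (1 / 2) * h0)

/-! ## Combinatorics of tape graphs -/

namespace TapeGraph

variable {V H : Type*} {G : TapeGraph V H}

/-- The outer arc is adjacent to both barrier half-sides, so these lie on its component
automatically. -/
theorem BoundaryComponent.hasBreakpoint_iff (C : G.BoundaryComponent) :
    C.HasBreakpoint ↔ ∃ v, C.Contains (.outerArc v) := by
  refine ⟨fun ⟨v, hv, _⟩ => ⟨v, hv⟩, fun ⟨v, hv⟩ => ⟨v, hv, ?_⟩⟩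
  rintro ⟨h, s⟩ ⟨rfl, ⟨rfl, hf⟩ | ⟨rfl, hl⟩⟩
  · exact (Quot.sound (BoundaryAdj.first h hf)).symm.trans hv
  · exact (Quot.sound (BoundaryAdj.last h hl)).trans hv

theorem Consecutive.root_eq {h h' : H} (hh : G.Consecutive h h') : G.root h = G.root h' :=
  G.root_eq_of_lt _ _ hh.1

theorem Consecutive.right_unique {h a b : H} (ha : G.Consecutive h a) (hb : G.Consecutive h b) :
    a = b := by
  rcases G.lt_total a b (ha.root_eq.symm.trans hb.root_eq) with h1 | h1 | h1
  · exact (hb.2 a ⟨ha.1, h1⟩).elim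
  · exact h1
  · exact (ha.2 b ⟨hb.1, h1⟩).elim

theorem Consecutive.left_unique {h a b : H} (ha : G.Consecutive a h) (hb : G.Consecutive b h) :
    a = b := by
  rcases G.lt_total a b (ha.root_eq.trans hb.root_eq.symm) with h1 | h1 | h1
  · exact (ha.2 b ⟨h1, hb.1⟩).elim
  · exact h1
  · exact (hb.2 a ⟨h1, ha.1⟩).elim

variable [Finite H]

theorem exists_consecutive_right {a b : H} (hab : G.lt a b) :
    ∃ c, G.Consecutive a c ∧ (c = b ∨ G.lt c b) := by
  have hwf : WellFounded G.lt := by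
    have : IsTrans H G.lt := ⟨G.lt_trans⟩
    have : Std.Irrefl G.lt := ⟨G.lt_irrefl⟩
    exact Finite.wellFounded_of_trans_of_irrefl _
  obtain ⟨c, hc, hmin⟩ := hwf.has_min {c | G.lt a c} ⟨b, hab⟩
  refine ⟨c, ⟨hc, fun g hg => hmin g hg.1 hg.2⟩, ?_⟩
  rcases G.lt_total c b ((G.root_eq_of_lt _ _ hc).symm.trans (G.root_eq_of_lt _ _ hab)) with h | h | h
  · exact .inr h
  · exact .inl h
  · exact (hmin b hab h).elim

/-- In a finite order one climbs by immediate successors. The order of the spine is defined as such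
a transitive closure, so the two orders can be compared step by step. -/
theorem lt_iff_transGen_consecutive {a b : H} : G.lt a b ↔ Relation.TransGen G.Consecutive a b := by
  constructor
  · intro hab
    have hwf : WellFounded (fun x y => G.lt y x) := by
      have : IsTrans H (fun x y => G.lt y x) := ⟨fun x y z h h' => G.lt_trans _ _ _ h' h⟩
      have : Std.Irrefl (fun x y => G.lt y x) := ⟨G.lt_irrefl⟩
      exact Finite.wellFounded_of_trans_of_irrefl _
    induction a using hwf.induction with
    | _ a ih =>
      obtain ⟨c, hc, rfl | hcb⟩ := exists_consecutive_right hab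
      · exact .single hc
      · exact .head hc (ih c hc.1 hcb)
  · intro h
    induction h with
    | single h => exact h.1
    | tail _ h ih => exact G.lt_trans _ _ _ ih h.1

theorem exists_consecutive_of_not_isLast {h : H} (hh : ¬ G.IsLast h) : ∃ h', G.Consecutive h h' := by
  simp only [IsLast, not_forall, not_not] at hh
  obtain ⟨h', _, hlt⟩ := hh
  obtain ⟨c, hc, _⟩ := exists_consecutive_right hlt
  exact ⟨c, hc⟩

/-- A boundary component without outer arcs is a cycle of sides of edges. -/
theorem exists_cycle_of_not_contains_outerArc (hG : G.Oriented) {C : G.BoundaryComponent}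
    (hC : ∀ v, ¬ C.Contains (.outerArc v)) :
    ∃ (m : ℕ) (g : ℤ → H), 0 < m ∧ (∀ j j', g j = g j' ↔ (m : ℤ) ∣ j - j') ∧
      ∀ j, G.Consecutive (g j) (G.flip (g (j + 1))) := by
  -- The half-edges whose plus side lies on `C`. Such a half-edge is not the last one at its vertex,
  -- hence has a successor `h'`, and the side of the edge starting at `h'₋` leads to the plus side
  -- of `flip h'`.
  let P : Type _ := {h : H // C.Contains (.halfSide (h, true))}
  have hside : ∀ h s, C.Contains (.halfSide (h, s)) → C.Contains (.halfSide (G.flip h, !s)) := by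
    intro h s hh
    have := Quot.sound (BoundaryAdj.side (G := G) (h, s))
    rw [hG] at this
    exact this.symm.trans hh
  have hstep : ∀ p : P, ∃ h', G.Consecutive p.1 h' ∧ C.Contains (.halfSide (G.flip h', true)) := by
    rintro ⟨h, hh⟩
    by_cases hl : G.IsLast h
    · exact (hC _ ((Quot.sound (BoundaryAdj.last h hl)).symm.trans hh)).elim
    · obtain ⟨h', hh'⟩ := exists_consecutive_of_not_isLast hl
      exact ⟨h', hh', hside _ _ ((Quot.sound (BoundaryAdj.inner h h' hh')).symm.trans hh)⟩
  choose nxt hn1 hn2 using hstep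
  let N : P → P := fun p => ⟨G.flip (nxt p), hn2 p⟩
  -- An injective self-map of a finite set is a permutation, and the cycle is one of its orbits,
  -- indexed by the integers.
  have hN : Function.Injective N := by
    intro p p' hpp
    have h1 : nxt p = nxt p' := by
      have := congrArg (fun x : P => G.flip x.1) hpp
      simpa [N, G.flip_flip] using this
    exact Subtype.ext ((hn1 p).left_unique (h1 ▸ hn1 p'))
  have : Finite P := Subtype.finite
  let σ : Equiv.Perm P := Equiv.ofBijective N (Finite.injective_iff_bijective.1 hN)
  obtain ⟨p⟩ : Nonempty P := by
    obtain ⟨q, rfl⟩ := Quot.exists_rep C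
    cases q with
    | outerArc v => exact (hC v rfl).elim
    | halfSide x =>
      obtain ⟨h, s⟩ := x
      cases s with
      | true => exact ⟨⟨h, rfl⟩⟩
      | false => exact ⟨⟨G.flip h, hside h false rfl⟩⟩
  have hm : 0 < Function.minimalPeriod (σ • ·) p := by
    apply Function.minimalPeriod_pos_of_mem_periodicPts
    exact (Finite.injective_iff_surjective.2 σ.surjective).mem_periodicPts p
  refine ⟨_, fun j => ((σ ^ j) p).1, hm, fun j j' => ?_, fun j => ?_⟩
  · rw [← MulAction.zpow_smul_eq_iff_minimalPeriod_dvd, Equiv.Perm.smul_def, zpow_sub, Subtype.val_inj,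
      Equiv.Perm.mul_apply]
    rw [← Equiv.Perm.mul_apply, (Commute.zpow_zpow_self σ j j').inv_right.eq, Equiv.Perm.mul_apply, Equiv.Perm.inv_eq_iff_eq]
  · have : (σ ^ (j + 1)) p = N ((σ ^ j) p) := by
      rw [add_comm, zpow_add, zpow_one]; rfl
    simp only [this, N, G.flip_flip]
    exact hn1 _

end TapeGraph

/-- The closed arcs are the closures of the open ones, so they have the same image and `g = f ∘ τ`
for a continuous injection `τ` of the interval. The start of `g` is not on the open arc, and `f 1 ≠
g 0` excludes the reversed direction. -/
theorem exists_reparametrization {S : Type*} [TopologicalSpace S] [T2Space S]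
    {f g : unitInterval → S} (hf : Continuous f) (hg : Continuous g) (hfi : Function.Injective f)
    (hgi : Function.Injective g) (h10 : f 1 ≠ g 0)
    (hfg : f '' Ioo 0 1 = g '' Ioo 0 1) :
    f 0 = g 0 ∧ ∃ τ : unitInterval → unitInterval,
      Continuous τ ∧ StrictMono τ ∧ τ 0 = 0 ∧ ∀ r, f (τ r) = g r := by
  have hcl : closure (Ioo (0 : unitInterval) 1) = univ := by
    rw [closure_Ioo zero_ne_one]; ext x; simpa using unitInterval.le_one'
  have hrange : range f = range g := by
    rw [← image_univ, ← image_univ, ← hcl, ← hf.isClosedMap.closure_image_eq_of_continuous hf,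
      ← hg.isClosedMap.closure_image_eq_of_continuous hg, hfg]
  have hex : ∀ r, ∃ t, f t = g r := fun r => by
    have : g r ∈ range f := hrange ▸ mem_range_self r
    exact this
  choose τ hτ using hex
  have hemb : IsEmbedding f := (hf.isClosedEmbedding hfi).isEmbedding
  have hτc : Continuous τ := by
    rw [hemb.continuous_iff]
    exact hg.congr fun r => (hτ r).symm
  have hτi : Function.Injective τ := fun a b hab => hgi (by rw [← hτ, ← hτ, hab])
  have hτ0 : τ 0 = 0 := by
    by_contra hne
    have h1 : τ 0 ≠ 1 := fun h => h10 (by rw [← h, hτ])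
    have : g 0 ∈ g '' Ioo 0 1 := by
      rw [← hfg]
      exact ⟨τ 0, ⟨unitInterval.pos_iff_ne_zero.2 hne, unitInterval.lt_one_iff_ne_one.2 h1⟩, hτ 0⟩
    obtain ⟨x, hx, hxe⟩ := this
    exact hx.1.ne' (hgi hxe)
  refine ⟨by rw [← hτ 0, hτ0], τ, hτc, ?_, hτ0, hτ⟩
  rcases hτc.strictMono_of_inj hτi with h | h
  · exact h
  · have := h (show (0 : unitInterval) < 1 from zero_lt_one)
    rw [hτ0] at this
    exact (not_lt_bot this).elim

/-! ## Sectors of the model square -/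

/-- The point of the model square with coordinates `a`, `b` along the edges `k` and `k - 1` that
start at the corner `k`. -/
noncomputable def sectorPoint (k : Fin 4) (a b : ℝ) : Plane :=
  squareCorner k + a • (squareCorner (k + 1) - squareCorner k) +
    b • (squareCorner (k - 1) - squareCorner k)

theorem sectorPoint_apply (k : Fin 4) (a b : ℝ) :
    sectorPoint k a b = (![!₂[1 - a - b, a - b], !₂[b - a, 1 - a - b], !₂[a + b - 1, b - a],
      !₂[a - b, a + b - 1]] : Fin 4 → Plane) k := by
  fin_cases k <;> apply Plane.ext' <;> simp [sectorPoint, squareCorner] <;> ring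

@[simp] theorem sectorPoint_zero (k : Fin 4) : sectorPoint k 0 0 = squareCorner k := by
  simp [sectorPoint]

theorem continuous_sectorPoint (k : Fin 4) : Continuous fun p : ℝ × ℝ => sectorPoint k p.1 p.2 := by
  unfold sectorPoint; fun_prop

theorem sectorPoint_mem_modelSquare {k : Fin 4} {a b : ℝ} (ha : 0 ≤ a) (hb : 0 ≤ b)
    (hab : a + b ≤ 1) : sectorPoint k a b ∈ modelSquare := by
  rw [sectorPoint_apply, modelSquare]
  fin_cases k <;> simp <;>
    rcases abs_cases (1 - a - b) with h | h <;> rcases abs_cases (a - b) with h' | h' <;>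
    rcases abs_cases (a + b - 1) with g | g <;> rcases abs_cases (b - a) with g' | g' <;> linarith

theorem sectorPoint_mem_openModelSquare {k : Fin 4} {a b : ℝ} (ha : 0 < a) (hb : 0 < b)
    (hab : a + b < 1) : sectorPoint k a b ∈ openModelSquare := by
  rw [sectorPoint_apply, openModelSquare]
  fin_cases k <;> simp <;>
    rcases abs_cases (1 - a - b) with h | h <;> rcases abs_cases (a - b) with h' | h' <;>
    rcases abs_cases (a + b - 1) with g | g <;> rcases abs_cases (b - a) with g' | g' <;> linarith

theorem squareEdge_eq (k : Fin 4) : squareEdge k = (fun a => sectorPoint k a 0) '' Ioo 0 1 := by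
  rw [squareEdge, openSegment_eq_image']
  simp [sectorPoint]

theorem squareEdge_sub_one_eq (k : Fin 4) :
    squareEdge (k - 1) = (fun b => sectorPoint k 0 b) '' Ioo 0 1 := by
  rw [squareEdge, sub_add_cancel, openSegment_symm, openSegment_eq_image']
  simp [sectorPoint]

theorem squareEdge_subset_modelSquare (k : Fin 4) : squareEdge k ⊆ modelSquare := by
  rw [squareEdge_eq]
  rintro _ ⟨a, ha, rfl⟩
  exact sectorPoint_mem_modelSquare ha.1.le le_rfl (by linarith [ha.2])

theorem squareCorner_mem_modelSquare (k : Fin 4) : squareCorner k ∈ modelSquare := by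
  rw [← sectorPoint_zero]; exact sectorPoint_mem_modelSquare le_rfl le_rfl (by norm_num)

theorem openModelSquare_subset : openModelSquare ⊆ modelSquare := fun z hz => by
  simp only [openModelSquare, modelSquare, mem_ofPred_eq] at *; exact hz.le

theorem squareCorner_notMem_openModelSquare (k : Fin 4) : squareCorner k ∉ openModelSquare := by
  rw [← sectorPoint_zero, sectorPoint_apply, openModelSquare]
  fin_cases k <;> simp

theorem squareEdge_notMem_openModelSquare {k : Fin 4} {z : Plane} (hz : z ∈ squareEdge k) :
    z ∉ openModelSquare := by
  rw [squareEdge_eq] at hz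
  obtain ⟨a, ⟨h0, h1⟩, rfl⟩ := hz
  simp only [sectorPoint_apply, openModelSquare]
  fin_cases k <;> simp <;>
    rcases abs_cases (1 - a) with h | h <;> rcases abs_cases (a - 1) with g | g <;>
    rcases abs_cases a with h' | h' <;> linarith

/-- The signs of the corners: corners `1` and `3` are negative. -/
def IsOddCorner (k : Fin 4) : Prop := k = 1 ∨ k = 3

/-- The condition `a + b < 1` keeps the point strictly on its side of the diagonal between the
corners 0 and 2, so the triangles at the corners 1 and 3 do not meet. -/
theorem IsOddCorner.sectorPoint_inj {k k' : Fin 4} (hk : IsOddCorner k) (hk' : IsOddCorner k')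
    {a b a' b' : ℝ} (hab : a + b < 1) (hab' : a' + b' < 1)
    (h : sectorPoint k a b = sectorPoint k' a' b') : k = k' ∧ a = a' ∧ b = b' := by
  have h0 := congrArg (fun z : Plane => z 0) h
  have h1 := congrArg (fun z : Plane => z 1) h
  rcases hk with rfl | rfl <;> rcases hk' with rfl | rfl <;> simp [sectorPoint_apply] at h0 h1 ⊢
  · constructor <;> linarith
  · linarith
  · linarith
  · constructor <;> linarith

/-! ### Edges of a quadrangulation at a negative vertex -/

namespace OccupiedSurface.Quadrangulation

variable {S : Type*} [TopologicalSpace S] [ChartedSpace (EuclideanHalfSpace 2) S]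
  {X : OccupiedSurface S} (Q : X.Quadrangulation)

theorem map_corner_mem_vertices (i : Fin Q.n) (k : Fin 4) :
    Q.map i (squareCorner k) ∈ X.pos ∪ X.neg := by
  fin_cases k
  exacts [.inl (Q.map_corner_zero i), .inr (Q.map_corner_one i), .inl (Q.map_corner_two i),
    .inr (Q.map_corner_three i)]

theorem map_corner_mem_neg {i : Fin Q.n} {k : Fin 4} (hk : IsOddCorner k) :
    Q.map i (squareCorner k) ∈ X.neg := by
  rcases hk with rfl | rfl
  exacts [Q.map_corner_one i, Q.map_corner_three i]

theorem map_corner_add_one_mem_pos {i : Fin Q.n} {k : Fin 4} (hk : IsOddCorner k) :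
    Q.map i (squareCorner (k + 1)) ∈ X.pos := by
  rcases hk with rfl | rfl
  exacts [Q.map_corner_two i, Q.map_corner_zero i]

theorem map_corner_sub_one_mem_pos {i : Fin Q.n} {k : Fin 4} (hk : IsOddCorner k) :
    Q.map i (squareCorner (k - 1)) ∈ X.pos := by
  rcases hk with rfl | rfl
  exacts [Q.map_corner_zero i, Q.map_corner_two i]

theorem map_edge_notMem_vertices {i : Fin Q.n} {k : Fin 4} {z : Plane} (hz : z ∈ squareEdge k) :
    Q.map i z ∉ X.pos ∪ X.neg := by
  intro hv
  rcases Q.edge_boundary_or_internal i k with ⟨h, _⟩ | ⟨h, _⟩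
  · exact (h (mem_image_of_mem _ hz)).2 hv
  · exact disjoint_left.1 (halfPlaneModel.disjoint_interior_boundary (M := S))
      (h (mem_image_of_mem _ hz)) (X.vertices_subset hv)

theorem map_open_ne_corner {i j : Fin Q.n} {k : Fin 4} {z : Plane} (hz : z ∈ openModelSquare) :
    Q.map i z ≠ Q.map j (squareCorner k) := fun h =>
  squareCorner_notMem_openModelSquare k
    ((Q.inj_open i z hz j _ (squareCorner_mem_modelSquare k) h).2 ▸ hz)

theorem map_open_ne_edge {i j : Fin Q.n} {k : Fin 4} {z w : Plane} (hz : z ∈ openModelSquare)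
    (hw : w ∈ squareEdge k) : Q.map i z ≠ Q.map j w := fun h =>
  squareEdge_notMem_openModelSquare hw
    ((Q.inj_open i z hz j _ (squareEdge_subset_modelSquare k hw) h).2 ▸ hz)

/-- An edge has at most one partner. -/
theorem partner_unique {e e₁ e₂ : Fin Q.n × Fin 4} (h1 : e₁ ≠ e) (h2 : e₂ ≠ e)
    (h1' : Q.map e₁.1 '' squareEdge e₁.2 = Q.map e.1 '' squareEdge e.2)
    (h2' : Q.map e₂.1 '' squareEdge e₂.2 = Q.map e.1 '' squareEdge e.2) : e₁ = e₂ := by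
  rcases Q.edge_boundary_or_internal e.1 e.2 with ⟨_, h⟩ | ⟨_, h⟩
  · exact (h1 (h e₁.1 e₁.2 h1')).elim
  · exact h.unique ⟨h1, h1'⟩ ⟨h2, h2'⟩

/-- The two parametrizations of an edge at which two corners at a negative vertex meet. -/
theorem exists_edge_reparametrization {i i' : Fin Q.n} {k k' : Fin 4} (hk : IsOddCorner k)
    (hk' : IsOddCorner k') (h : Q.map i '' squareEdge k = Q.map i' '' squareEdge (k' - 1)) :
    Q.map i (squareCorner k) = Q.map i' (squareCorner k') ∧
      ∃ τ : unitInterval → unitInterval, Continuous τ ∧ StrictMono τ ∧ τ 0 = 0 ∧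
        ∀ r, Q.map i (sectorPoint k (τ r) 0) = Q.map i' (sectorPoint k' 0 r) := by
  have := X.t2
  have hdisj : ∀ {x y}, x ∈ X.neg → y ∈ X.pos → x ≠ y := fun hx hy hxy =>
    disjoint_left.1 X.disjoint hy (hxy ▸ hx)
  -- A closed edge is an embedded arc: its ends have opposite signs and hence differ, and the open
  -- edge is embedded and contains no vertices.
  have key : ∀ (j : Fin Q.n) (w : unitInterval → Plane) (l : Fin 4), w 0 ∉ squareEdge l →
      w 1 ∉ squareEdge l → Q.map j (w 0) ∈ X.neg → Q.map j (w 1) ∈ X.pos →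
      (∀ r, 0 < r → r < 1 → w r ∈ squareEdge l) → Function.Injective w →
      Function.Injective fun r => Q.map j (w r) := by
    intro j w l h0 h1 hn hp hw hwi
    have hcases : ∀ r : unitInterval, r = 0 ∨ r = 1 ∨ w r ∈ squareEdge l := fun r => by
      by_cases hr0 : r = 0
      · exact .inl hr0
      by_cases hr1 : r = 1
      · exact .inr (.inl hr1)
      exact .inr (.inr (hw r (unitInterval.pos_iff_ne_zero.2 hr0)
        (unitInterval.lt_one_iff_ne_one.2 hr1)))
    intro a b hab
    simp only at hab
    rcases hcases a with rfl | rfl | ha <;> rcases hcases b with rfl | rfl | hb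
    · rfl
    · exact (hdisj hn hp hab).elim
    · exact (Q.map_edge_notMem_vertices hb (by rw [← hab]; exact .inr hn)).elim
    · exact (hdisj hn hp hab.symm).elim
    · rfl
    · exact (Q.map_edge_notMem_vertices hb (by rw [← hab]; exact .inl hp)).elim
    · exact (Q.map_edge_notMem_vertices ha (by rw [hab]; exact .inr hn)).elim
    · exact (Q.map_edge_notMem_vertices ha (by rw [hab]; exact .inl hp)).elim
    · exact hwi (Q.inj_edge j l ha hb hab)
  have hc1 : sectorPoint k 1 0 = squareCorner (k + 1) := by simp [sectorPoint]
  have hc1' : sectorPoint k' 0 1 = squareCorner (k' - 1) := by simp [sectorPoint]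
  have hcorner : ∀ (j : Fin Q.n) (l l' : Fin 4), squareCorner l ∉ squareEdge l' := fun j l l' hl =>
    Q.map_edge_notMem_vertices (i := j) hl (Q.map_corner_mem_vertices j l)
  have hinj1 : Function.Injective fun r : unitInterval => sectorPoint k r 0 := by
    intro a b hab
    have h0 := congrArg (fun z : Plane => z 0) hab
    rcases hk with rfl | rfl <;> simp [sectorPoint_apply] at h0 <;> exact Subtype.ext (by linarith)
  have hinj2 : Function.Injective fun r : unitInterval => sectorPoint k' 0 r := by
    intro a b hab
    have h0 := congrArg (fun z : Plane => z 0) hab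
    rcases hk' with rfl | rfl <;> simp [sectorPoint_apply] at h0 <;> exact Subtype.ext (by linarith)
  have himg : ∀ (w : ℝ → S), (fun r : unitInterval => w r) '' Ioo 0 1 = w '' Ioo 0 1 := by
    intro w
    ext z
    constructor
    · rintro ⟨r, ⟨h0, h1⟩, rfl⟩; exact ⟨r, ⟨h0, h1⟩, rfl⟩
    · rintro ⟨r, ⟨h0, h1⟩, rfl⟩; exact ⟨⟨r, h0.le, h1.le⟩, ⟨h0, h1⟩, rfl⟩
  have hs1 := (continuous_sectorPoint k).comp (Continuous.prodMk continuous_subtype_val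
    (continuous_const (y := (0 : ℝ)) (X := unitInterval)))
  have hs2 := (continuous_sectorPoint k').comp (Continuous.prodMk
    (continuous_const (y := (0 : ℝ)) (X := unitInterval)) continuous_subtype_val)
  obtain ⟨h0, τ, h1, h2, h3, h4⟩ := exists_reparametrization
    (f := fun r : unitInterval => Q.map i (sectorPoint k r 0))
    (g := fun r : unitInterval => Q.map i' (sectorPoint k' 0 r))
    ((Q.continuousOn_map i).comp_continuous hs1 fun r =>
      sectorPoint_mem_modelSquare r.2.1 le_rfl (by simpa using r.2.2))
    ((Q.continuousOn_map i').comp_continuous hs2 fun r =>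
      sectorPoint_mem_modelSquare le_rfl r.2.1 (by simpa using r.2.2))
    (key i (fun r => sectorPoint k r 0) k (by simpa using hcorner i k k)
      (by simpa [hc1] using hcorner i (k + 1) k)
      (by simpa using Q.map_corner_mem_neg hk) (by simpa [hc1] using Q.map_corner_add_one_mem_pos hk)
      (fun r h0 h1 => by rw [squareEdge_eq]; exact ⟨r, ⟨h0, h1⟩, rfl⟩) hinj1)
    (key i' (fun r => sectorPoint k' 0 r) (k' - 1) (by simpa using hcorner i k' (k' - 1))
      (by simpa [hc1'] using hcorner i (k' - 1) (k' - 1))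
      (by simpa using Q.map_corner_mem_neg hk')
      (by simpa [hc1'] using Q.map_corner_sub_one_mem_pos hk')
      (fun r h0 h1 => by rw [squareEdge_sub_one_eq]; exact ⟨r, ⟨h0, h1⟩, rfl⟩) hinj2)
    -- The far end of the first edge is positive and the corner of the second is negative. The signs
    -- thus match corner with corner.
    (by simpa [hc1] using (hdisj (Q.map_corner_mem_neg hk') (Q.map_corner_add_one_mem_pos hk)).symm)
    (by
      rw [himg fun r => Q.map i (sectorPoint k r 0), himg fun r => Q.map i' (sectorPoint k' 0 r)]
      rw [squareEdge_eq, squareEdge_sub_one_eq, image_image, image_image] at h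
      exact h)
  exact ⟨by simpa using h0, τ, h1, h2, h3, h4⟩

end OccupiedSurface.Quadrangulation

/-! ### No cyclic fan at a negative vertex -/

namespace OccupiedSurface.Quadrangulation

variable {S : Type*} [TopologicalSpace S] [ChartedSpace (EuclideanHalfSpace 2) S]
  {X : OccupiedSurface S} (Q : X.Quadrangulation)

/-- The strips are the sectors of the fan, with the angle as second coordinate; local finiteness
lets a map be glued from its restrictions to them. -/
theorem locallyFinite_strips {Y : Type*} [TopologicalSpace Y] :
    LocallyFinite fun j : ℤ => {p : Y × ℝ | (j : ℝ) ≤ p.2 ∧ p.2 ≤ j + 1} := by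
  intro p
  refine ⟨Prod.snd ⁻¹' Ioo (p.2 - 1) (p.2 + 1), (isOpen_Ioo.preimage continuous_snd).mem_nhds
    (by simp), (finite_Icc (⌊p.2 - 2⌋) ⌈p.2 + 1⌉).subset ?_⟩
  rintro j ⟨q, ⟨h1, h2⟩, h3, h4⟩
  constructor
  · rw [← @Int.cast_le ℝ]; linarith [Int.floor_le (p.2 - 2)]
  · rw [← @Int.cast_le ℝ]; linarith [Int.le_ceil (p.2 + 1)]

/-- The squares at a negative vertex do not close up to a full disc about it. -/
theorem not_cyclic_fan {m : ℕ} (hm : 0 < m) (c : ℤ → Fin Q.n × Fin 4)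
    (hodd : ∀ j, IsOddCorner (c j).2) (hper : ∀ j j', c j = c j' ↔ (m : ℤ) ∣ j - j')
    (hglue : ∀ j, Q.map (c j).1 '' squareEdge (c j).2 =
      Q.map (c (j + 1)).1 '' squareEdge ((c (j + 1)).2 - 1)) : False := by
  have hT2 := X.t2
  -- The reparametrization is chosen for a pair of corners and not for an index `j`, so that the
  -- periodicity of `c` carries over to the polar map.
  have hrep : ∀ e e' : Fin Q.n × Fin 4, ∃ τ : unitInterval → unitInterval, IsOddCorner e.2 →
      IsOddCorner e'.2 → Q.map e.1 '' squareEdge e.2 = Q.map e'.1 '' squareEdge (e'.2 - 1) →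
      Q.map e.1 (squareCorner e.2) = Q.map e'.1 (squareCorner e'.2) ∧
      Continuous τ ∧ StrictMono τ ∧ τ 0 = 0 ∧
        ∀ r, Q.map e.1 (sectorPoint e.2 (τ r) 0) = Q.map e'.1 (sectorPoint e'.2 0 r) := by
    intro e e'
    by_cases h : IsOddCorner e.2 ∧ IsOddCorner e'.2 ∧
      Q.map e.1 '' squareEdge e.2 = Q.map e'.1 '' squareEdge (e'.2 - 1)
    · obtain ⟨h0, τ, hτ⟩ := Q.exists_edge_reparametrization h.1 h.2.1 h.2.2
      exact ⟨τ, fun _ _ _ => ⟨h0, hτ⟩⟩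
    · exact ⟨id, fun h1 h2 h3 => (h ⟨h1, h2, h3⟩).elim⟩
  choose τ hτ using hrep
  have hτ' := fun j => hτ (c j) (c (j + 1)) (hodd _) (hodd _) (hglue j)
  -- the common corner
  set x₀ := Q.map (c 0).1 (squareCorner (c 0).2) with hx₀
  have hcen : ∀ j, Q.map (c j).1 (squareCorner (c j).2) = x₀ := by
    intro j
    induction j using Int.induction_on with
    | zero => rfl
    | succ j ih => rw [← (hτ' j).1, ih]
    | pred j ih =>
      have := (hτ' (-j - 1)).1
      rw [sub_add_cancel] at this
      rw [this, ih]
  -- Halving the radius keeps `A + B < 1`, so the sectors stay off the diagonals.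
  let half : unitInterval → unitInterval := fun r =>
    ⟨r / 2, by linarith [r.2.1], by linarith [r.2.2]⟩
  have hhalf : Continuous half := by
    refine Continuous.subtype_mk ?_ _
    fun_prop
  have hhalf0 : half 0 = 0 := Subtype.ext (by simp [half])
  -- For angles from `j` to `j + 1` the point moves linearly from the edge before the corner to the
  -- edge after it. Inserting `τ` on the second edge makes it end where the next sector starts.
  let A : ℤ → unitInterval × ℝ → ℝ := fun j p => (p.2 - j) * (τ (c j) (c (j + 1)) (half p.1) : ℝ)
  let B : ℤ → unitInterval × ℝ → ℝ := fun j p => (1 - (p.2 - j)) * (half p.1 : ℝ)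
  let Ψ : ℤ → unitInterval × ℝ → S := fun j p =>
    Q.map (c j).1 (sectorPoint (c j).2 (A j p) (B j p))
  let K : ℤ → Set (unitInterval × ℝ) := fun j => {p | (j : ℝ) ≤ p.2 ∧ p.2 ≤ j + 1}
  have hK : ∀ {j : ℤ} {p : unitInterval × ℝ}, p ∈ K j ↔ (j : ℝ) ≤ p.2 ∧ p.2 ≤ j + 1 := Iff.rfl
  have hAB : ∀ j, ∀ p ∈ K j, 0 ≤ A j p ∧ 0 ≤ B j p ∧ A j p + B j p < 1 := by
    intro j p hp
    rw [hK] at hp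
    have h1 : (half p.1 : ℝ) ≤ 1 / 2 := by
      change (p.1 : ℝ) / 2 ≤ 1 / 2; linarith [p.1.2.2]
    have h2 : (τ (c j) (c (j + 1)) (half p.1) : ℝ) < 1 := by
      have : half p.1 < 1 := by
        rw [← Subtype.coe_lt_coe]; change (half p.1 : ℝ) < 1; linarith
      exact lt_of_lt_of_le ((hτ' j).2.2.1 this) (τ (c j) (c (j + 1)) 1).2.2
    have h3 : (0 : ℝ) ≤ τ (c j) (c (j + 1)) (half p.1) := (τ (c j) (c (j + 1)) (half p.1)).2.1
    have h4 : (0 : ℝ) ≤ half p.1 := (half p.1).2.1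
    refine ⟨mul_nonneg (by linarith) h3, mul_nonneg (by linarith) h4, ?_⟩
    simp only [A, B]
    rcases eq_or_lt_of_le hp.1 with h | h
    · rw [← h]; linarith
    · nlinarith
  have hΨ : ∀ j, ContinuousOn (Ψ j) (K j) := by
    intro j
    refine (Q.continuousOn_map (c j).1).comp (Continuous.continuousOn ?_) fun p hp =>
      sectorPoint_mem_modelSquare (hAB j p hp).1 (hAB j p hp).2.1 (hAB j p hp).2.2.le
    have hτc : Continuous (τ (c j) (c (j + 1))) := (hτ' j).2.1
    refine (continuous_sectorPoint _).comp (Continuous.prodMk ?_ ?_)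
    · exact (continuous_snd.sub continuous_const).mul
        (continuous_subtype_val.comp (hτc.comp (hhalf.comp continuous_fst)))
    · exact (continuous_const.sub (continuous_snd.sub continuous_const)).mul
        (continuous_subtype_val.comp (hhalf.comp continuous_fst))
  have hmatch : ∀ j r, Ψ j (r, (j : ℝ) + 1) = Ψ (j + 1) (r, (j : ℝ) + 1) := by
    intro j r
    have := (hτ' j).2.2.2.2 (half r)
    simpa [Ψ, A, B] using this
  let Φ₀ : unitInterval × ℝ → S := fun p => Ψ ⌊p.2⌋ p
  have hΦ₀ : ∀ j, ∀ p ∈ K j, Φ₀ p = Ψ j p := by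
    rintro j ⟨r, s⟩ ⟨h1, h2⟩
    simp only at h1 h2
    rcases eq_or_lt_of_le h2 with rfl | h2
    · have : ⌊(j : ℝ) + 1⌋ = j + 1 := by simp
      simp only [Φ₀, this, hmatch]
    · have : ⌊s⌋ = j := Int.floor_eq_iff.2 ⟨h1, h2⟩
      simp only [Φ₀, this]
  have hΦc : Continuous Φ₀ := by
    refine locallyFinite_strips.continuous (f := K) (iUnion_eq_univ_iff.2 fun p =>
      ⟨⌊p.2⌋, Int.floor_le _, (Int.lt_floor_add_one _).le⟩) (fun j => ?_) fun j =>
        (hΨ j).congr (hΦ₀ j)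
    exact (isClosed_le continuous_const continuous_snd).inter
      (isClosed_le continuous_snd continuous_const)
  have hΦper : ∀ r s, Φ₀ (r, s + (m : ℝ)) = Φ₀ (r, s) := by
    intro r s
    have h1 : ⌊s + (m : ℝ)⌋ = ⌊s⌋ + m := by
      rw [← Int.cast_natCast, Int.floor_add_intCast]
    have h2 : c (⌊s⌋ + m) = c ⌊s⌋ := (hper _ _).2 (by simp)
    have h3 : c (⌊s⌋ + m + 1) = c (⌊s⌋ + 1) := (hper _ _).2 (by ring_nf; simp)
    simp only [Φ₀, Ψ, A, B, h1, h2, h3]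
    push_cast
    simp only [add_sub_add_right_eq_sub]
  have hΦ0 : ∀ s, Φ₀ (0, s) = x₀ := by
    intro s
    have h0 := (hτ' ⌊s⌋).2.2.2.1
    simp [Φ₀, Ψ, A, B, hhalf0, h0, hcen]
  have hfloor : ∀ p : unitInterval × ℝ, p ∈ K ⌊p.2⌋ := fun p =>
    ⟨Int.floor_le _, (Int.lt_floor_add_one _).le⟩
  -- injectivity
  have hApos : ∀ j, ∀ p ∈ K j, 0 < p.1 → (j : ℝ) < p.2 → 0 < A j p := by
    intro j p _ hp1 hp2
    refine mul_pos (by linarith) ?_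
    have : (0 : unitInterval) < half p.1 := by
      rw [← Subtype.coe_lt_coe] at hp1 ⊢; exact half_pos hp1
    have := (hτ' j).2.2.1 this
    rw [(hτ' j).2.2.2.1] at this
    exact this
  have hBpos : ∀ j : ℤ, ∀ p : unitInterval × ℝ, p.2 < j + 1 → 0 < p.1 → 0 < B j p := by
    intro j p hp hp1
    refine mul_pos (by linarith) ?_
    rw [← Subtype.coe_lt_coe] at hp1
    exact half_pos hp1
  have hedge : ∀ p : unitInterval × ℝ, p.2 = ⌊p.2⌋ → 0 < p.1 →
      sectorPoint (c ⌊p.2⌋).2 (A ⌊p.2⌋ p) (B ⌊p.2⌋ p) ∈ squareEdge ((c ⌊p.2⌋).2 - 1) := by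
    intro p hp hp1
    rw [squareEdge_sub_one_eq]
    have h1 : A ⌊p.2⌋ p = 0 := by simp only [A, ← hp, sub_self, zero_mul]
    refine ⟨B ⌊p.2⌋ p, ⟨hBpos _ p (Int.lt_floor_add_one _) hp1, ?_⟩, by rw [h1]⟩
    linarith [(hAB _ p (hfloor p)).2.2]
  have hopen : ∀ p : unitInterval × ℝ, (⌊p.2⌋ : ℝ) < p.2 → 0 < p.1 →
      sectorPoint (c ⌊p.2⌋).2 (A ⌊p.2⌋ p) (B ⌊p.2⌋ p) ∈ openModelSquare := fun p hp hp1 =>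
    sectorPoint_mem_openModelSquare (hApos _ p (hfloor p) hp1 hp)
      (hBpos _ p (Int.lt_floor_add_one _) hp1) (hAB _ p (hfloor p)).2.2
  -- Full injectivity of the polar map is not needed. It suffices that coinciding points with `p'.1
  -- ≤ p.1` and `p.1 > 0` have angles that differ by a multiple of `m`.
  have hinj : ∀ p p' : unitInterval × ℝ, 0 < p.1 → p'.1 ≤ p.1 → Φ₀ p = Φ₀ p' →
      ∃ d : ℤ, p'.2 - p.2 = d * m := by
    intro p p' hp1 hle heq
    have hcases : ∀ p : unitInterval × ℝ, p.2 = ⌊p.2⌋ ∨ (⌊p.2⌋ : ℝ) < p.2 := fun p =>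
      (eq_or_lt_of_le (Int.floor_le p.2)).imp Eq.symm id
    rcases eq_or_lt_of_le (show 0 ≤ p'.1 from p'.1.2.1) with hp0 | hp1'
    · exfalso
      obtain ⟨r', s'⟩ := p'
      simp only at hp0
      rw [← hp0, hΦ0] at heq
      rcases hcases p with h | h
      · refine Q.map_edge_notMem_vertices (i := (c ⌊p.2⌋).1) (hedge p h hp1) ?_
        change Φ₀ p ∈ _
        rw [heq]
        exact Q.map_corner_mem_vertices (c 0).1 (c 0).2
      · exact Q.map_open_ne_corner (hopen p h hp1) heq
    · have hdvd : c ⌊p.2⌋ = c ⌊p'.2⌋ → p'.2 - ⌊p'.2⌋ = p.2 - ⌊p.2⌋ →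
          ∃ d : ℤ, p'.2 - p.2 = d * m := by
        intro h1 h2
        obtain ⟨d, hd⟩ := (hper _ _).1 h1.symm
        refine ⟨d, ?_⟩
        have : ((⌊p'.2⌋ - ⌊p.2⌋ : ℤ) : ℝ) = m * d := by rw [hd]; push_cast; ring
        push_cast at this
        linarith
      rcases hcases p with h | h <;> rcases hcases p' with h' | h'
      · -- two edges
        by_cases hcc : c ⌊p.2⌋ = c ⌊p'.2⌋
        · exact hdvd hcc (by rw [← h, ← h', sub_self, sub_self])
        exfalso
        -- The preceding corner in the fan already supplies a partner of this edge. A partner is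
        -- unique, and the partner supplied by the fan has an odd edge number while both edges here
        -- have even ones. So a second edge with the same image cannot exist.
        have himg : Q.map (c ⌊p'.2⌋).1 '' squareEdge ((c ⌊p'.2⌋).2 - 1) =
            Q.map (c ⌊p.2⌋).1 '' squareEdge ((c ⌊p.2⌋).2 - 1) := by
          refine (Q.edge_eq_or_disjoint _ _ _ _).resolve_right fun hd => ?_
          exact disjoint_left.1 hd (mem_image_of_mem _ (hedge p' h' hp1'))
            (by change Φ₀ p' ∈ _; rw [← heq]; exact mem_image_of_mem _ (hedge p h hp1))
        have hg := hglue (⌊p.2⌋ - 1)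
        rw [sub_add_cancel] at hg
        have hparity : ∀ {k k' : Fin 4}, IsOddCorner k → IsOddCorner k' → k ≠ k' - 1 := by
          rintro k k' (rfl | rfl) (rfl | rfl) <;> decide
        have := Q.partner_unique (e := ((c ⌊p.2⌋).1, (c ⌊p.2⌋).2 - 1))
          (e₁ := ((c ⌊p'.2⌋).1, (c ⌊p'.2⌋).2 - 1)) (e₂ := c (⌊p.2⌋ - 1))
          (fun h0 => hcc ?_) (fun h0 => hparity (hodd _) (hodd _) (congrArg Prod.snd h0)) himg hg
        · exact hparity (hodd _) (hodd _) (congrArg Prod.snd this).symm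
        · have e1 := congrArg Prod.fst h0
          have e2 := congrArg Prod.snd h0
          exact Prod.ext e1.symm (sub_left_injective e2).symm
      · exact (Q.map_open_ne_edge (hopen p' h' hp1') (hedge p h hp1) heq.symm).elim
      · exact (Q.map_open_ne_edge (hopen p h hp1) (hedge p' h' hp1') heq).elim
      · obtain ⟨h1, h2⟩ := Q.inj_open _ _ (hopen p h hp1) _ _
          (openModelSquare_subset (hopen p' h' hp1')) heq
        obtain ⟨h3, h4, h5⟩ := (hodd _).sectorPoint_inj (hodd _) (hAB _ p (hfloor p)).2.2
          (hAB _ p' (hfloor p')).2.2 h2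
        have hcc : c ⌊p.2⌋ = c ⌊p'.2⌋ := Prod.ext h1 h3
        refine hdvd hcc ?_
        have hcc' : c (⌊p.2⌋ + 1) = c (⌊p'.2⌋ + 1) := by
          rw [hper] at hcc ⊢
          simpa using hcc
        simp only [A, B, hcc, hcc'] at h4 h5
        set u := p.2 - ⌊p.2⌋
        set u' := p'.2 - ⌊p'.2⌋
        have hu : 0 < u := by simp only [u]; linarith
        have hu1 : u < 1 := by simp only [u]; linarith [Int.lt_floor_add_one p.2]
        have hu' : 0 < u' := by simp only [u']; linarith
        have hu1' : u' < 1 := by simp only [u']; linarith [Int.lt_floor_add_one p'.2]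
        have hhle : half p'.1 ≤ half p.1 := by
          rw [← Subtype.coe_le_coe] at hle ⊢
          exact div_le_div_of_nonneg_right hle zero_le_two
        have hτle := (hτ' ⌊p'.2⌋).2.2.1.monotone hhle
        have hhpos : (0 : unitInterval) < half p'.1 := by
          rw [← Subtype.coe_lt_coe] at hp1' ⊢; exact half_pos hp1'
        have hτpos := (hτ' ⌊p'.2⌋).2.2.1 hhpos
        rw [(hτ' ⌊p'.2⌋).2.2.2.1] at hτpos
        rw [← Subtype.coe_lt_coe] at hhpos hτpos
        rw [← Subtype.coe_le_coe] at hhle hτle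
        simp only [Set.Icc.coe_zero] at hhpos hτpos
        -- With radii `x' ≤ x` the equations are `u * τ x = u' * τ x'` and `(1 - u) * x = (1 - u') *
        -- x'`. The first gives `u ≤ u'` by monotonicity of `τ`, the second gives `u' ≤ u`.
        apply le_antisymm
        · by_contra! hlt
          nlinarith
        · by_contra! hlt
          nlinarith
  -- a small disc lies in a chart
  have hU : IsOpen (Φ₀ ⁻¹' (chartAt (EuclideanHalfSpace 2) x₀).source) :=
    (chartAt (EuclideanHalfSpace 2) x₀).open_source.preimage hΦc
  obtain ⟨U, W, hUo, hWo, hU0, hW0, hUW⟩ := generalized_tube_lemma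
    (isCompact_singleton (x := (0 : unitInterval))) (isCompact_Icc (a := (0 : ℝ)) (b := m)) hU (by
      rintro ⟨r, s⟩ ⟨hr, _⟩
      rw [mem_singleton_iff] at hr
      simp only at hr
      rw [mem_preimage, hr, hΦ0]
      exact mem_chart_source _ x₀)
  obtain ⟨δ, hδ, hball⟩ := Metric.isOpen_iff.1 hUo 0 (hU0 rfl)
  let ε : unitInterval := ⟨min (δ / 2) 1, by positivity, min_le_right _ _⟩
  have hε : 0 < ε := by
    rw [← Subtype.coe_lt_coe]; change (0 : ℝ) < min (δ / 2) 1; positivity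
  have hεU : ∀ t : unitInterval, ε * t ∈ U := by
    intro t
    apply hball
    rw [Metric.mem_ball, Subtype.dist_eq]
    have h1 : ((ε * t : unitInterval) : ℝ) = min (δ / 2) 1 * t := rfl
    have h2 : min (δ / 2) 1 * (t : ℝ) ≤ δ / 2 * 1 :=
      mul_le_mul (min_le_left _ _) t.2.2 t.2.1 (by positivity)
    have h3 : 0 ≤ min (δ / 2) 1 * (t : ℝ) := mul_nonneg (by positivity) t.2.1
    rw [h1, Set.Icc.coe_zero, dist_zero_right, Real.norm_of_nonneg h3]
    linarith
  have hT : (0 : ℝ) < m := by exact_mod_cast hm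
  have hsrc : ∀ p : unitInterval × ℝ, Φ₀ (ε * p.1, p.2) ∈ (extChartAt halfPlaneModel x₀).source := by
    intro p
    obtain ⟨s, hs, hs'⟩ := Function.Periodic.exists_mem_Ico₀
      (f := fun s => Φ₀ (ε * p.1, s)) (hΦper (ε * p.1)) hT p.2
    rw [hs', extChartAt_source]
    exact hUW ⟨hεU p.1, hW0 ⟨hs.1, hs.2.le⟩⟩
  let Φ : unitInterval × ℝ → ℂ := fun p =>
    (extChartAt halfPlaneModel x₀ (Φ₀ (ε * p.1, p.2))).toComplex
  have hmap : Continuous fun p : unitInterval × ℝ => Φ₀ (ε * p.1, p.2) := by fun_prop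
  -- A vertex is a boundary point, so the centre of the disc is on the boundary line of the
  -- half-plane.
  have hx₀b : (extChartAt halfPlaneModel x₀ x₀) 0 = 0 := by
    have h1 : x₀ ∈ halfPlaneModel.boundary S :=
      X.vertices_subset (Q.map_corner_mem_vertices _ _)
    have h2 : extChartAt halfPlaneModel x₀ x₀ ∈ frontier (range halfPlaneModel) := h1
    rw [frontier_range_modelWithCornersEuclideanHalfSpace] at h2
    exact h2.symm
  obtain ⟨t, s, hts⟩ := exists_eq_of_polar_disc (Φ := Φ) (T := m)
    (c := (extChartAt halfPlaneModel x₀ x₀).toComplex)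
    (Plane.continuous_toComplex.comp ((continuousOn_extChartAt x₀).comp_continuous hmap hsrc))
    (fun t s => by simp only [Φ, hΦper]) (fun s => by simp only [Φ, mul_zero, hΦ0])
    (fun p => by
      change (extChartAt halfPlaneModel x₀ x₀) 0 ≤ _
      rw [hx₀b]
      exact (chartAt (EuclideanHalfSpace 2) x₀ (Φ₀ (ε * p.1, p.2))).2)
  have hΦeq : Φ₀ (ε * 1, s) = Φ₀ (ε * t, s + m / 2) := by
    refine (extChartAt halfPlaneModel x₀).injOn (hsrc (1, s)) (hsrc (t, s + m / 2)) ?_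
    exact Plane.ext' (congrArg Complex.re hts) (congrArg Complex.im hts)
  -- Half a period would be a multiple `d` of the period, that is, `2 * d = 1` in the integers.
  obtain ⟨d, hd⟩ := hinj (ε * 1, s) (ε * t, s + m / 2) (by simpa using hε)
    (by change ε * t ≤ ε * 1; rw [mul_one]; exact unitInterval.mul_le_left) hΦeq
  change s + m / 2 - s = d * m at hd
  have h2 : (2 * d - 1 : ℝ) * m = 0 := by linarith
  have h3 : (2 * d - 1 : ℝ) = 0 := (mul_eq_zero.1 h2).resolve_right hT.ne'
  have h4 : 2 * d - 1 = 0 := by exact_mod_cast h3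
  omega

end OccupiedSurface.Quadrangulation

/-! ### Necessity of the breakpoints -/

theorem TapeGraph.IsSpine.hasBreakpoint {V H : Type*} [Finite H] {G : TapeGraph V H}
    (hG : G.Oriented) (hS : G.IsSpine) (C : G.BoundaryComponent) : C.HasBreakpoint := by
  obtain ⟨S, _, _, X, Q, α, β, hroot, hflip, hlt, -⟩ := hS
  by_contra hC
  rw [BoundaryComponent.hasBreakpoint_iff, not_exists] at hC
  obtain ⟨m, g, hm, hper, hcons⟩ := exists_cycle_of_not_contains_outerArc hG hC
  -- The first step of a chain from `a` to `b` in the transitive closure already reaches `b`, since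
  -- nothing lies strictly between consecutive half-edges.
  have hnext : ∀ {a b}, G.Consecutive a b → Q.SpineNext (β a) (β b) := by
    intro a b hab
    have h := (hlt a b).1 hab.1
    obtain ⟨x, hx, hxb⟩ := Relation.TransGen.head'_iff.1 h
    obtain ⟨x, rfl⟩ := β.surjective x
    rcases Relation.reflTransGen_iff_eq_or_transGen.1 hxb with h1 | h1
    · rw [h1]; exact hx
    · exact (hab.2 x ⟨(hlt _ _).2 (.single hx), (hlt _ _).2 h1⟩).elim
  -- The corner assigned to a half-edge is the negative corner of the triangle that contains its
  -- plus side. Leaving the square of `g j` one enters that of `flip (g (j + 1))`, which is the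
  -- square of `g (j + 1)`.
  refine Q.not_cyclic_fan hm (fun j => ((β (g j)).1,
    OccupiedSurface.Quadrangulation.cornerOf (β (g j)).2 - 1)) (fun j => ?_) (fun j j' => ?_)
    fun j => ?_
  · cases (β (g j)).2
    · exact .inr rfl
    · exact .inl rfl
  · rw [← hper, ← β.injective.eq_iff (a := g j), Prod.ext_iff, Prod.ext_iff]
    simp only [sub_left_inj]
    refine and_congr_right fun _ => ⟨fun h => ?_, fun h => by rw [h]⟩
    cases h1 : (β (g j)).2 <;> cases h2 : (β (g j')).2 <;>
      simp [h1, h2, OccupiedSurface.Quadrangulation.cornerOf] at h ⊢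
  · have := hnext (hcons j)
    rw [hflip] at this
    refine Eq.trans this ?_
    simp only
    congr 2
    cases (β (g (j + 1))).2 <;> rfl

/-! ## Complexes of squares

Squares are glued along edges so that the corners at each vertex form a linear fan. -/

/-- A finite set `I` of squares with corners identified to vertices in `N`.  The corners at the
vertex `v` are listed in anticlockwise order as `corner v 0, …, corner v (size v - 1)`, and each
corner is glued to the next one along an edge. -/
structure SquareComplex where
  I : Type
  N : Type
  finite_I : Finite I
  finite_N : Finite N
  vert : I → Fin 4 → N
  idx : I → Fin 4 → ℕ
  size : N → ℕ
  corner : N → ℕ → I × Fin 4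
  size_pos : ∀ v, 0 < size v
  idx_lt : ∀ i k, idx i k < size (vert i k)
  corner_vert_idx : ∀ i k, corner (vert i k) (idx i k) = (i, k)
  vert_corner : ∀ v j, j < size v → vert (corner v j).1 (corner v j).2 = v
  idx_corner : ∀ v j, j < size v → idx (corner v j).1 (corner v j).2 = j
  -- Only adjacent corners have to be different vertices; opposite corners may coincide.
  vert_add_one_ne : ∀ i k, vert i (k + 1) ≠ vert i k
  -- The edge between two successive corners, seen from its other end, again lies between two
  -- successive corners, with the squares in the reverse order.
  glue : ∀ i k i' k', vert i k = vert i' k' → idx i' k' = idx i k + 1 →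
    vert i' (k' + 1) = vert i (k - 1) ∧ idx i (k - 1) = idx i' (k' + 1) + 1

namespace SquareComplex

/-- The height of a point of the model square towards the corner `k`. -/
def ht (k : Fin 4) (p : ℝ × ℝ) : ℝ := ![p.1, p.2, -p.1, -p.2] k

/-- The point with heights `t` and `l` towards the corners `k` and `k + 1`. -/
def pt (k : Fin 4) (t l : ℝ) : ℝ × ℝ := ![(t, l), (-l, t), (-t, -l), (l, -t)] k

/-- The model square. -/
def sq : Set (ℝ × ℝ) := {p | |p.1| + |p.2| ≤ 1}

theorem ht_add_two (k : Fin 4) (p : ℝ × ℝ) : ht (k + 2) p = - ht k p := by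
  fin_cases k <;> simp [ht]

theorem ht_add_one_add_one (k : Fin 4) (p : ℝ × ℝ) : ht (k + 1 + 1) p = - ht k p := by
  rw [add_assoc]; exact ht_add_two k p

theorem ht_sub_one (k : Fin 4) (p : ℝ × ℝ) : ht (k - 1) p = - ht (k + 1) p := by
  fin_cases k <;> simp [ht]

@[simp] theorem ht_pt (k : Fin 4) (t l : ℝ) : ht k (pt k t l) = t := by
  fin_cases k <;> simp [ht, pt]

@[simp] theorem ht_add_one_pt (k : Fin 4) (t l : ℝ) : ht (k + 1) (pt k t l) = l := by
  fin_cases k <;> simp [ht, pt]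

@[simp] theorem ht_sub_one_pt (k : Fin 4) (t l : ℝ) : ht (k - 1) (pt k t l) = -l := by
  rw [ht_sub_one, ht_add_one_pt]

theorem pt_ht (k : Fin 4) (p : ℝ × ℝ) : pt k (ht k p) (ht (k + 1) p) = p := by
  fin_cases k <;> simp [ht, pt]

theorem ext_ht {k : Fin 4} {p p' : ℝ × ℝ} (h : ht k p = ht k p')
    (h' : ht (k + 1) p = ht (k + 1) p') : p = p' := by
  rw [← pt_ht k p, h, h', pt_ht]

theorem pt_add_one (k : Fin 4) (t l : ℝ) : pt (k + 1) t l = pt k (-l) t := by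
  fin_cases k <;> simp [pt]

theorem pt_sub_one (k : Fin 4) (t l : ℝ) : pt (k - 1) t l = pt k l (-t) := by
  fin_cases k <;> simp [pt]

theorem abs_ht (k : Fin 4) (p : ℝ × ℝ) : |ht k p| + |ht (k + 1) p| = |p.1| + |p.2| := by
  fin_cases k <;> simp [ht, add_comm]

theorem mem_sq_iff (k : Fin 4) {p : ℝ × ℝ} : p ∈ sq ↔ |ht k p| + |ht (k + 1) p| ≤ 1 := by
  rw [abs_ht]; rfl

theorem pt_mem_sq {k : Fin 4} {t l : ℝ} (h : |t| + |l| ≤ 1) : pt k t l ∈ sq := by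
  rw [mem_sq_iff k]; simpa using h

theorem continuous_ht (k : Fin 4) : Continuous (ht k) := by
  unfold ht; fin_cases k <;> simp <;> fun_prop

theorem continuous_pt (k : Fin 4) : Continuous fun x : ℝ × ℝ => pt k x.1 x.2 := by
  unfold pt; fin_cases k <;> simp <;> constructor <;> fun_prop

theorem exists_quadrant (p : ℝ × ℝ) : ∃ k, 0 ≤ ht k p ∧ 0 ≤ ht (k + 1) p := by
  rcases le_total 0 p.1 with h | h <;> rcases le_total 0 p.2 with h' | h'
  · exact ⟨0, by simpa [ht] using ⟨h, h'⟩⟩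
  · exact ⟨3, by simpa [ht] using ⟨h', h⟩⟩
  · exact ⟨1, by simpa [ht] using ⟨h', h⟩⟩
  · exact ⟨2, by simpa [ht] using ⟨h, h'⟩⟩

theorem exists_ht_pos {p : ℝ × ℝ} (hp : p ≠ 0) : ∃ k, 0 < ht k p := by
  obtain ⟨k, h0, h1⟩ := exists_quadrant p
  rcases h0.lt_or_eq with h | h
  · exact ⟨k, h⟩
  rcases h1.lt_or_eq with h' | h'
  · exact ⟨_, h'⟩
  exact (hp (ext_ht (k := k) (by rw [← h]; fin_cases k <;> simp [ht])
    (by rw [← h']; fin_cases k <;> simp [ht]))).elim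

theorem eq_of_ht_pos_of_ht_pos {k k' : Fin 4} {p : ℝ × ℝ} (h : 0 < ht k p) (h' : 0 < ht k' p) :
    k' = k ∨ k' = k + 1 ∨ k' = k - 1 := by
  have h2 : k' ≠ k + 2 := by
    rintro rfl; rw [ht_add_two] at h'; linarith
  revert h2; clear h h'; revert k k'; decide

variable (K : SquareComplex)

theorem vert_sub_one_ne (i : K.I) (k : Fin 4) : K.vert i (k - 1) ≠ K.vert i k := by
  have := K.vert_add_one_ne i (k - 1)
  rw [sub_add_cancel] at this
  exact this.symm

theorem corner_inj {i i' : K.I} {k k' : Fin 4} (hv : K.vert i k = K.vert i' k')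
    (hj : K.idx i k = K.idx i' k') : i = i' ∧ k = k' := by
  have := K.corner_vert_idx i k
  rw [hv, hj, K.corner_vert_idx] at this
  exact ⟨(congrArg Prod.fst this).symm, (congrArg Prod.snd this).symm⟩

/-- Corners of positive height are equal or adjacent, and adjacent corners are different vertices.
So a point sees a vertex through at most one corner, even if opposite corners are identified, and a
`starSum` has at most one nonzero term. -/
theorem eq_of_vert_eq {i : K.I} {k k' : Fin 4} {p : ℝ × ℝ} (hv : K.vert i k = K.vert i k')
    (h : 0 < ht k p) (h' : 0 < ht k' p) : k' = k := by
  rcases eq_of_ht_pos_of_ht_pos h h' with h | rfl | rfl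
  · exact h
  · exact (K.vert_add_one_ne i k hv.symm).elim
  · exact (K.vert_sub_one_ne i k hv.symm).elim

/-- The corner `k'` of `i'` comes immediately after the corner `k` of `i` in the fan at their
common vertex. -/
def Next (i : K.I) (k : Fin 4) (i' : K.I) (k' : Fin 4) : Prop :=
  K.vert i k = K.vert i' k' ∧ K.idx i' k' = K.idx i k + 1

variable {K} in
theorem Next.glue {i i' : K.I} {k k' : Fin 4} (h : K.Next i k i' k') :
    K.Next i' (k' + 1) i (k - 1) := K.glue i k i' k' h.1 h.2

open Classical in
/-- The indicator of a vertex. -/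
noncomputable def delta (w v : K.N) : ℝ := if w = v then 1 else 0

theorem delta_of_ne {w v : K.N} (h : w ≠ v) : K.delta w v = 0 := if_neg h

@[simp] theorem delta_self (v : K.N) : K.delta v v = 1 := if_pos rfl

/-- A sum over the corners of the square `i` at the vertex `v`, weighted by heights. -/
noncomputable def starSum (v : K.N) (i : K.I) (p : ℝ × ℝ) (f : Fin 4 → ℝ) : ℝ :=
  ∑ k, K.delta (K.vert i k) v * (max (ht k p) 0 * f k)

theorem starSum_of_pos {v : K.N} {i : K.I} {k : Fin 4} {p : ℝ × ℝ} (hv : K.vert i k = v)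
    (h : 0 < ht k p) (f : Fin 4 → ℝ) : K.starSum v i p f = ht k p * f k := by
  rw [starSum, Finset.sum_eq_single k, hv, delta_self, one_mul, max_eq_left h.le]
  · intro k' _ hk'
    by_cases hv' : K.vert i k' = v
    · rw [max_eq_right, zero_mul, mul_zero]
      by_contra! h'
      exact hk' (K.eq_of_vert_eq (hv.trans hv'.symm) h h')
    · rw [K.delta_of_ne hv', zero_mul]
  · simp

theorem starSum_of_nonpos {v : K.N} {i : K.I} {p : ℝ × ℝ}
    (h : ∀ k, K.vert i k = v → ht k p ≤ 0) (f : Fin 4 → ℝ) : K.starSum v i p f = 0 := by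
  refine Finset.sum_eq_zero fun k _ => ?_
  by_cases hv : K.vert i k = v
  · rw [max_eq_right (h k hv), zero_mul, mul_zero]
  · rw [K.delta_of_ne hv, zero_mul]

theorem starSum_of_quadrant {v : K.N} {i : K.I} {k : Fin 4} {p : ℝ × ℝ} (h : 0 ≤ ht k p)
    (h' : 0 ≤ ht (k + 1) p) (f : Fin 4 → ℝ) : K.starSum v i p f =
      K.delta (K.vert i k) v * (ht k p * f k) +
        K.delta (K.vert i (k + 1)) v * (ht (k + 1) p * f (k + 1)) := by
  rw [starSum, ← Equiv.sum_comp (Equiv.addLeft k), Fin.sum_univ_four]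
  simp only [Equiv.coe_addLeft, add_zero]
  have h2 : max (ht (k + 2) p) 0 = 0 := max_eq_right (by rw [ht_add_two]; linarith)
  have h3 : max (ht (k + 3) p) 0 = 0 := by
    have : k + 3 = k + 1 + 2 := by rw [add_assoc]; rfl
    exact max_eq_right (by rw [this, ht_add_two]; linarith)
  rw [h2, h3, max_eq_left h, max_eq_left h']
  simp

/-- The angular coordinate at the corner `k` of the square `i`, scaled by the distance from the
corner; it increases from `idx * (1 - ht)` to `(idx + 1) * (1 - ht)` across the corner. -/
noncomputable def ang (i : K.I) (p : ℝ × ℝ) (k : Fin 4) : ℝ :=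
  K.idx i k * (1 - ht k p) + (1 - ht k p - ht (k + 1) p) / 2

/-- The space in which a square complex is realized. -/
abbrev Ambient : Type := (K.N → ℝ × ℝ) × (K.I → ℝ × ℝ × ℝ)

/-- The bump function of the open model square. -/
def bump (p : ℝ × ℝ) : ℝ := 1 - |p.1| - |p.2|

open Classical in
/-- The characteristic map of the square `i`, with values in the ambient space. -/
noncomputable def q (i : K.I) (p : ℝ × ℝ) : K.Ambient :=
  -- The angle at a vertex makes sense only on its star; multiplied by the height it extends by
  -- zero. The bump entries separate the points of the open squares.
  (fun v => (K.starSum v i p 1, K.starSum v i p (K.ang i p)),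
    Pi.single i (bump p, bump p * p.1, bump p * p.2))

theorem bump_nonneg {p : ℝ × ℝ} : 0 ≤ bump p ↔ p ∈ sq := by
  change _ ↔ |p.1| + |p.2| ≤ 1
  rw [bump]; constructor <;> intro h <;> linarith

theorem bump_eq (k : Fin 4) (p : ℝ × ℝ) : bump p = 1 - (|ht k p| + |ht (k + 1) p|) := by
  rw [abs_ht, bump]; ring

theorem bump_edge {k : Fin 4} {s : ℝ} (h0 : 0 ≤ s) (h1 : s ≤ 1) : bump (pt k (1 - s) s) = 0 := by
  rw [bump_eq k, ht_pt, ht_add_one_pt, abs_of_nonneg h0, abs_of_nonneg (by linarith)]; ring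

theorem bump_edge' {k : Fin 4} {s : ℝ} (h0 : 0 ≤ s) (h1 : s ≤ 1) :
    bump (pt k (1 - s) (-s)) = 0 := by
  rw [bump_eq k, ht_pt, ht_add_one_pt, abs_neg, abs_of_nonneg h0, abs_of_nonneg (by linarith)]; ring

/-- The two squares see both ends of the common edge from equal heights. The end angle of one sector
is the initial angle of the following one, because the indices differ by one; at the other end of
the edge the squares exchange roles. -/
theorem q_eq_of_next {i i' : K.I} {k k' : Fin 4} (h : K.Next i k i' k') {s : ℝ} (h0 : 0 ≤ s)
    (h1 : s ≤ 1) : K.q i (pt k (1 - s) (-s)) = K.q i' (pt k' (1 - s) s) := by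
  have hs : ∀ v (f g : Fin 4 → ℝ), f k = g k' → f (k - 1) = g (k' + 1) →
      K.starSum v i (pt k (1 - s) (-s)) f = K.starSum v i' (pt k' (1 - s) s) g := by
    intro v f g hfg hfg'
    rw [K.starSum_of_quadrant (k := k - 1) (by simpa using h0) (by simpa using h1),
      K.starSum_of_quadrant (k := k') (by simpa using h1) (by simpa using h0)]
    simp only [sub_add_cancel, ht_sub_one_pt, ht_pt, ht_add_one_pt, neg_neg, hfg, hfg', h.1,
      h.glue.1]
    rw [add_comm]
  refine Prod.ext (funext fun v => Prod.ext (hs v _ _ rfl rfl) (hs v _ _ ?_ ?_)) ?_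
  · simp only [ang, ht_pt, ht_add_one_pt, h.2]; push_cast; ring
  · simp only [ang, sub_add_cancel, ht_sub_one_pt, ht_add_one_pt, ht_pt, ht_add_one_add_one,
      h.glue.2]
    push_cast; ring
  · have e : ((0 : ℝ), (0 : ℝ), (0 : ℝ)) = 0 := rfl
    simp [q, bump_edge h0 h1, bump_edge' h0 h1, e]

/-- At height one the factor `1 - ht` removes the angle, whatever the index of the corner. -/
theorem q_corner_eq {i i' : K.I} {k k' : Fin 4} (h : K.vert i k = K.vert i' k') :
    K.q i (pt k 1 0) = K.q i' (pt k' 1 0) := by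
  have hs : ∀ v (f g : Fin 4 → ℝ), f k = g k' →
      K.starSum v i (pt k 1 0) f = K.starSum v i' (pt k' 1 0) g := by
    intro v f g hfg
    rw [K.starSum_of_quadrant (k := k) (by simp) (by simp),
      K.starSum_of_quadrant (k := k') (by simp) (by simp)]
    simp [hfg, h]
  refine Prod.ext (funext fun v => Prod.ext (hs v _ _ rfl) (hs v _ _ ?_)) ?_
  · simp [ang]
  · have e : ((0 : ℝ), (0 : ℝ), (0 : ℝ)) = 0 := rfl
    have e1 := bump_edge (k := k) le_rfl zero_le_one
    have e2 := bump_edge (k := k') le_rfl zero_le_one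
    rw [sub_zero] at e1 e2
    simp [q, e1, e2, e]

/-- The ways in which two points of the squares can be identified. -/
def Glued (i : K.I) (p : ℝ × ℝ) (i' : K.I) (p' : ℝ × ℝ) : Prop :=
  (i = i' ∧ p = p') ∨ (∃ k k', K.vert i k = K.vert i' k' ∧ p = pt k 1 0 ∧ p' = pt k' 1 0) ∨
    -- One direction suffices: the same edge read from its other end gives the identification with
    -- the squares exchanged.
    ∃ k k' s, K.Next i k i' k' ∧ 0 < s ∧ s < 1 ∧ p = pt k (1 - s) (-s) ∧ p' = pt k' (1 - s) s

theorem ang_mem {i : K.I} {k : Fin 4} {p : ℝ × ℝ} (hp : p ∈ sq) (h : 0 ≤ ht k p) :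
    K.idx i k * (1 - ht k p) ≤ K.ang i p k ∧ K.ang i p k ≤ (K.idx i k + 1) * (1 - ht k p) := by
  rw [mem_sq_iff k, abs_of_nonneg h] at hp
  rw [ang]
  constructor <;> linarith [le_abs_self (ht (k + 1) p), neg_abs_le (ht (k + 1) p)]

/-- At height `t` the angles at the corner of index `j` fill the interval from `j * (1 - t)` to `(j
+ 1) * (1 - t)`. For `t < 1` equal angles therefore mean the same corner, or successive corners and
their common edge; for `t = 1` both points are corners. -/
theorem glued_of_star_eq {i i' : K.I} {k k' : Fin 4} {p p' : ℝ × ℝ} (hp : p ∈ sq) (hp' : p' ∈ sq)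
    (hv : K.vert i k = K.vert i' k') (h0 : 0 < ht k p) (ht' : ht k p = ht k' p')
    (ha : K.ang i p k = K.ang i' p' k') : K.Glued i p i' p' := by
  have h1 := K.ang_mem (i := i) hp h0.le
  have h1' := K.ang_mem (i := i') hp' (ht' ▸ h0.le)
  have hN : ht k p ≤ 1 := by
    rw [mem_sq_iff k] at hp
    linarith [le_abs_self (ht k p), abs_nonneg (ht (k + 1) p)]
  have key : ∀ {i i' : K.I} {k k' : Fin 4} {p p' : ℝ × ℝ}, K.ang i p k = K.ang i' p' k' →
      0 < ht k p → ht k p < 1 → ht k p = ht k' p' → K.idx i' k' = K.idx i k + 1 →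
      K.ang i p k ≤ (K.idx i k + 1) * (1 - ht k p) →
      K.idx i' k' * (1 - ht k' p') ≤ K.ang i' p' k' →
      p = pt k (1 - (1 - ht k p)) (-(1 - ht k p)) ∧ p' = pt k' (1 - (1 - ht k p)) (1 - ht k p) := by
    intro i i' k k' p p' ha h0 h1 ht' hj h2 h3
    rw [hj] at h3
    push_cast at h3
    have e1 : K.ang i p k = (K.idx i k + 1) * (1 - ht k p) := by
      rw [← ha, ← ht'] at h3; linarith
    have e2 : K.ang i' p' k' = (K.idx i k + 1) * (1 - ht k p) := by rw [← ha, e1]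
    rw [ang] at e1 e2
    rw [hj, ← ht'] at e2
    push_cast at e2
    constructor
    · apply ext_ht (k := k)
      · simp
      · simp; linarith
    · apply ext_ht (k := k')
      · simp [ht']
      · simp; linarith
  rcases hN.lt_or_eq with hlt | heq
  · have hpos : 0 < 1 - ht k p := by linarith
    rcases lt_trichotomy (K.idx i k) (K.idx i' k') with hj | hj | hj
    · right; right
      have hj' : K.idx i' k' = K.idx i k + 1 := by
        by_contra hne
        have : (K.idx i k : ℝ) + 2 ≤ K.idx i' k' := by
          have : K.idx i k + 2 ≤ K.idx i' k' := by omega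
          exact_mod_cast this
        rw [← ht', ← ha] at h1'
        nlinarith
      obtain ⟨e1, e2⟩ := key ha h0 hlt ht' hj' h1.2 h1'.1
      exact ⟨k, k', 1 - ht k p, ⟨hv, hj'⟩, hpos, by linarith, e1, e2⟩
    · left
      obtain ⟨rfl, rfl⟩ := K.corner_inj hv hj
      refine ⟨rfl, ext_ht ht' ?_⟩
      rw [ang, ang, ht'] at ha
      linarith
    · right; right
      have hj' : K.idx i k = K.idx i' k' + 1 := by
        by_contra hne
        have : (K.idx i' k' : ℝ) + 2 ≤ K.idx i k := by
          have : K.idx i' k' + 2 ≤ K.idx i k := by omega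
          exact_mod_cast this
        rw [← ht', ← ha] at h1'
        nlinarith
      obtain ⟨e1, e2⟩ := key ha.symm (ht' ▸ h0) (ht' ▸ hlt) ht'.symm hj' h1'.2 h1.1
      have hn : K.Next i' k' i k := ⟨hv.symm, hj'⟩
      -- Here the square `i` comes after `i'`, so the edge is read from its other end, where the
      -- parameter is the height at the first end.
      refine ⟨k + 1, k' - 1, ht k p, hn.glue, h0, hlt, ?_, ?_⟩
      · rw [pt_add_one]; rw [← ht'] at e2; refine e2.trans ?_; congr 1; ring
      · rw [pt_sub_one]; rw [← ht'] at e1; refine e1.trans ?_; congr 1; ring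
  · right; left
    refine ⟨k, k', hv, ?_, ?_⟩
    · rw [mem_sq_iff k, heq] at hp
      have : ht (k + 1) p = 0 := by
        rw [← abs_nonpos_iff]; simp at hp; simp [hp]
      rw [← pt_ht k p, heq, this]
    · rw [mem_sq_iff k', ← ht', heq] at hp'
      have : ht (k' + 1) p' = 0 := by
        rw [← abs_nonpos_iff]; simp at hp'; simp [hp']
      rw [← pt_ht k' p', ← ht', heq, this]

theorem tau_pos_iff {v : K.N} {i : K.I} {p : ℝ × ℝ} :
    0 < K.starSum v i p 1 ↔ ∃ k, K.vert i k = v ∧ 0 < ht k p := by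
  constructor
  · intro h
    by_contra! hcon
    rw [K.starSum_of_nonpos hcon] at h
    exact lt_irrefl _ h
  · rintro ⟨k, hv, hk⟩
    rw [K.starSum_of_pos hv hk]
    simpa using hk

theorem bump_mul_inj {p p' : ℝ × ℝ} (h : 0 < bump p)
    (he : (bump p, bump p * p.1, bump p * p.2) = (bump p', bump p' * p'.1, bump p' * p'.2)) :
    p = p' := by
  simp only [Prod.mk.injEq] at he
  obtain ⟨e0, e1, e2⟩ := he
  rw [← e0] at e1 e2
  exact Prod.ext (mul_left_cancel₀ h.ne' e1) (mul_left_cancel₀ h.ne' e2)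

/-- In an open square the bump entries determine the square and the point. On an edge some height is
positive, and the entry of that vertex decides. -/
theorem glued_of_q_eq {i i' : K.I} {p p' : ℝ × ℝ} (hp : p ∈ sq) (hp' : p' ∈ sq)
    (h : K.q i p = K.q i' p') : K.Glued i p i' p' := by
  classical
  have h2 : ∀ j, (K.q i p).2 j = (K.q i' p').2 j := fun j => by rw [h]
  rcases (bump_nonneg.2 hp).lt_or_eq with hb | hb
  · left
    have hi : i = i' := by
      by_contra hne
      have := congrArg Prod.fst (h2 i)
      simp [q, hne] at this
      exact hb.ne' this
    subst hi
    refine ⟨rfl, bump_mul_inj hb ?_⟩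
    simpa [q] using h2 i
  · have hp0 : p ≠ 0 := by
      rintro rfl
      simp [bump] at hb
    obtain ⟨k, hk⟩ := exists_ht_pos hp0
    have h1 : ∀ v, (K.q i p).1 v = (K.q i' p').1 v := fun v => by rw [h]
    have e1 := congrArg Prod.fst (h1 (K.vert i k))
    have e2 := congrArg Prod.snd (h1 (K.vert i k))
    simp only [q] at e1 e2
    obtain ⟨k', hv, hk'⟩ := K.tau_pos_iff.1 (e1 ▸ K.tau_pos_iff.2 ⟨k, rfl, hk⟩)
    rw [K.starSum_of_pos rfl hk, K.starSum_of_pos hv hk'] at e1 e2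
    simp only [Pi.one_apply, mul_one] at e1
    rw [← e1] at e2
    exact K.glued_of_star_eq hp hp' hv.symm hk e1 (mul_left_cancel₀ hk.ne' e2)

theorem q_eq_of_glued {i i' : K.I} {p p' : ℝ × ℝ} (h : K.Glued i p i' p') :
    K.q i p = K.q i' p' := by
  rcases h with ⟨rfl, rfl⟩ | ⟨k, k', hv, rfl, rfl⟩ | ⟨k, k', s, hn, h0, h1, rfl, rfl⟩
  · rfl
  · exact K.q_corner_eq hv
  · exact K.q_eq_of_next hn h0.le h1.le

theorem continuous_starSum (v : K.N) (i : K.I) {f : ℝ × ℝ → Fin 4 → ℝ}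
    (hf : ∀ k, Continuous fun p => f p k) : Continuous fun p => K.starSum v i p (f p) := by
  exact continuous_finsetSum _ fun k _ =>
    continuous_const.mul (((continuous_ht k).max continuous_const).mul (hf k))

theorem continuous_ang (i : K.I) (k : Fin 4) : Continuous fun p => K.ang i p k := by
  have h1 := continuous_ht k
  have h2 := continuous_ht (k + 1)
  unfold ang; fun_prop

theorem continuous_bump : Continuous bump := by unfold bump; fun_prop

theorem continuous_q (i : K.I) : Continuous (K.q i) := by
  classical
  refine Continuous.prodMk (continuous_pi fun v => ?_) (continuous_pi fun j => ?_)
  · exact (K.continuous_starSum v i (f := fun _ => 1) fun k => continuous_const).prodMk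
      (K.continuous_starSum v i fun k => K.continuous_ang i k)
  · have hb := continuous_bump
    by_cases hj : j = i
    · subst hj; simp only [Pi.single_eq_same]; fun_prop
    · simp only [Pi.single_eq_of_ne hj]; exact continuous_const

end SquareComplex

theorem continuousOn_of_finite_closed_cover {X Y ι : Type*} [TopologicalSpace X]
    [TopologicalSpace Y] [Finite ι] {g : X → Y} {T : Set X} (F : ι → Set X)
    (hT : T ⊆ ⋃ j, F j) (hF : ∀ j, IsClosed (F j)) (hg : ∀ j, ContinuousOn g (T ∩ F j)) :
    ContinuousOn g T := by
  rw [continuousOn_iff_continuous_domRestrict]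
  refine (locallyFinite_of_finite fun j => (Subtype.val ⁻¹' F j : Set T)).continuous
    (eq_univ_of_forall fun x => ?_) (fun j => (hF j).preimage continuous_subtype_val) fun j => ?_
  · obtain ⟨j, hj⟩ := mem_iUnion.1 (hT x.2)
    exact mem_iUnion.2 ⟨j, hj⟩
  · exact (hg j).comp continuous_subtype_val.continuousOn fun x hx => ⟨x.2, hx⟩

/-- The point of the half-plane with the given coordinates. -/
noncomputable def halfPoint (s d : ℝ) : EuclideanHalfSpace 2 := ⟨!₂[max s 0, d], by simp⟩

theorem halfPoint_zero (s d : ℝ) : (halfPoint s d).1 0 = max s 0 := rfl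

theorem halfPoint_one (s d : ℝ) : (halfPoint s d).1 1 = d := rfl

theorem continuous_halfPoint : Continuous fun x : ℝ × ℝ => halfPoint x.1 x.2 := by
  refine Continuous.subtype_mk ?_ _
  apply (PiLp.continuous_toLp 2 _).comp
  refine continuous_pi fun i => ?_
  fin_cases i
  · exact continuous_fst.max continuous_const
  · exact continuous_snd

theorem continuous_halfSpace_apply (i : Fin 2) : Continuous fun y : EuclideanHalfSpace 2 => y.1 i :=
  (PiLp.continuous_apply 2 _ i).comp continuous_subtype_val

theorem halfPoint_eq {y : EuclideanHalfSpace 2} {s d : ℝ} (hs : s = y.1 0) (hd : d = y.1 1) :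
    halfPoint s d = y := by
  refine EuclideanHalfSpace.ext _ _ (Plane.ext' ?_ ?_)
  · rw [halfPoint_zero, hs]; exact max_eq_left y.2
  · rw [halfPoint_one, hd]

/-! ### The realization of a square complex -/

namespace SquareComplex

variable (K : SquareComplex)

/-- The realization of a square complex. -/
abbrev Space : Type := {x : K.Ambient // ∃ i, ∃ p ∈ sq, K.q i p = x}

theorem zero_mem_sq : (0 : ℝ × ℝ) ∈ sq := by rw [← bump_nonneg]; simp [bump]

theorem isCompact_sq : IsCompact sq := by
  refine Metric.isCompact_of_isClosed_isBounded ?_ ?_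
  · exact isClosed_le (by fun_prop) continuous_const
  · refine (Metric.isBounded_closedBall (x := (0 : ℝ × ℝ)) (r := 1)).subset fun p hp => ?_
    rw [mem_closedBall_zero_iff, Prod.norm_def, sup_le_iff]
    change |p.1| + |p.2| ≤ 1 at hp
    exact ⟨by rw [Real.norm_eq_abs]; linarith [abs_nonneg p.2],
      by rw [Real.norm_eq_abs]; linarith [abs_nonneg p.1]⟩

open Classical in
/-- The characteristic map of the square `i`. -/
noncomputable def map (i : K.I) (p : ℝ × ℝ) : K.Space :=
  if h : p ∈ sq then ⟨K.q i p, i, p, h, rfl⟩ else ⟨K.q i 0, i, 0, zero_mem_sq, rfl⟩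

theorem map_val {i : K.I} {p : ℝ × ℝ} (hp : p ∈ sq) : (K.map i p).1 = K.q i p := by
  rw [map, dif_pos hp]

theorem exists_map_eq (x : K.Space) : ∃ i, ∃ p ∈ sq, K.map i p = x := by
  obtain ⟨i, p, hp, h⟩ := x.2
  exact ⟨i, p, hp, Subtype.ext ((K.map_val hp).trans h)⟩

theorem map_eq_iff {i i' : K.I} {p p' : ℝ × ℝ} (hp : p ∈ sq) (hp' : p' ∈ sq) :
    K.map i p = K.map i' p' ↔ K.Glued i p i' p' := by
  rw [Subtype.ext_iff, K.map_val hp, K.map_val hp']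
  exact ⟨K.glued_of_q_eq hp hp', K.q_eq_of_glued⟩

theorem continuousOn_map (i : K.I) : ContinuousOn (K.map i) sq := by
  have : IsInducing (Subtype.val : K.Space → K.Ambient) := IsInducing.subtypeVal
  rw [this.continuousOn_iff]
  exact (K.continuous_q i).continuousOn.congr fun p hp => K.map_val hp

instance : CompactSpace K.Space := by
  have := K.finite_I
  refine ⟨?_⟩
  have : (univ : Set K.Space) = ⋃ i, K.map i '' sq := by
    refine (eq_univ_of_forall fun x => ?_).symm
    obtain ⟨i, p, hp, h⟩ := K.exists_map_eq x
    exact mem_iUnion.2 ⟨i, p, hp, h⟩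
  rw [this]
  exact isCompact_iUnion fun i => isCompact_sq.image_of_continuousOn (K.continuousOn_map i)

/-! ### The star of a vertex -/

/-- The height of a point towards the vertex `v`. -/
def tau (v : K.N) (x : K.Space) : ℝ := (x.1.1 v).1

/-- The product of height and angular coordinate at the vertex `v`. -/
def eta (v : K.N) (x : K.Space) : ℝ := (x.1.1 v).2

theorem continuous_tau (v : K.N) : Continuous (K.tau v) :=
  continuous_fst.comp ((continuous_apply v).comp (continuous_fst.comp continuous_subtype_val))

theorem continuous_eta (v : K.N) : Continuous (K.eta v) :=
  continuous_snd.comp ((continuous_apply v).comp (continuous_fst.comp continuous_subtype_val))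

variable {K} in
theorem tau_map {v : K.N} {i : K.I} {k : Fin 4} {p : ℝ × ℝ} (hp : p ∈ sq) (hv : K.vert i k = v)
    (h : 0 < ht k p) : K.tau v (K.map i p) = ht k p := by
  rw [tau, K.map_val hp]
  simp only [q]
  rw [K.starSum_of_pos hv h, Pi.one_apply, mul_one]

variable {K} in
theorem eta_map {v : K.N} {i : K.I} {k : Fin 4} {p : ℝ × ℝ} (hp : p ∈ sq) (hv : K.vert i k = v)
    (h : 0 < ht k p) : K.eta v (K.map i p) = ht k p * K.ang i p k := by
  rw [eta, K.map_val hp]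
  simp only [q]
  rw [K.starSum_of_pos hv h]

variable {K} in
theorem tau_map_pos_iff {v : K.N} {i : K.I} {p : ℝ × ℝ} (hp : p ∈ sq) :
    0 < K.tau v (K.map i p) ↔ ∃ k, K.vert i k = v ∧ 0 < ht k p := by
  rw [tau, K.map_val hp]; exact K.tau_pos_iff

theorem exists_of_tau_pos {v : K.N} {x : K.Space} (hx : 0 < K.tau v x) :
    ∃ i k, ∃ p ∈ sq, K.map i p = x ∧ K.vert i k = v ∧ 0 < ht k p := by
  obtain ⟨i, p, hp, rfl⟩ := K.exists_map_eq x
  obtain ⟨k, hv, hk⟩ := (tau_map_pos_iff hp).1 hx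
  exact ⟨i, k, p, hp, rfl, hv, hk⟩

theorem ht_le_one {k : Fin 4} {p : ℝ × ℝ} (hp : p ∈ sq) : ht k p ≤ 1 := by
  rw [mem_sq_iff k] at hp
  linarith [le_abs_self (ht k p), abs_nonneg (ht (k + 1) p)]

/-- The point in the `j`-th sector at `v` with distance `r` and angular coordinate `a`. -/
noncomputable def sector (v : K.N) (j : ℕ) (r a : ℝ) : K.Space :=
  K.map (K.corner v j).1 (pt (K.corner v j).2 (1 - r) ((2 * j + 1) * r - 2 * a))

theorem sector_mem_sq {k : Fin 4} {j : ℕ} {r a : ℝ} (h1 : r ≤ 1) (h2 : j * r ≤ a)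
    (h3 : a ≤ (j + 1) * r) : pt k (1 - r) ((2 * j + 1) * r - 2 * a) ∈ sq := by
  apply pt_mem_sq
  rw [abs_of_nonneg (by linarith)]
  have : |(2 * j + 1) * r - 2 * a| ≤ r := abs_le.2 ⟨by linarith, by linarith⟩
  linarith

/-- The angular intervals of two sectors meet only in a common ray, along which the squares are
glued, or at radius zero, which is the vertex. So the inverse chart may be computed in any
admissible sector, and its continuity checked sector by sector. -/
theorem sector_eq_sector {v : K.N} {j j' : ℕ} {r a : ℝ} (hj : j < K.size v) (hj' : j' < K.size v)
    (h0 : 0 ≤ r) (h1 : r ≤ 1) (h2 : j * r ≤ a) (h3 : a ≤ (j + 1) * r) (h2' : j' * r ≤ a)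
    (h3' : a ≤ (j' + 1) * r) : K.sector v j r a = K.sector v j' r a := by
  wlog hle : j ≤ j' generalizing j j'
  · exact (this hj' hj h2' h3' h2 h3 (le_of_not_ge hle)).symm
  unfold sector
  rw [K.map_eq_iff (sector_mem_sq h1 h2 h3) (sector_mem_sq h1 h2' h3')]
  rcases hle.eq_or_lt with rfl | hlt
  · exact .inl ⟨rfl, rfl⟩
  rcases h0.eq_or_lt with rfl | hpos
  · have ha : a = 0 := by linarith
    right; left
    refine ⟨_, _, ?_, by rw [ha, sub_zero, mul_zero, mul_zero, sub_zero],
      by rw [ha, sub_zero, mul_zero, mul_zero, sub_zero]⟩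
    rw [K.vert_corner v j hj, K.vert_corner v j' hj']
  · have hj2 : j' = j + 1 := by
      by_contra hne
      have : (j : ℝ) + 2 ≤ j' := by
        have : j + 2 ≤ j' := by omega
        exact_mod_cast this
      nlinarith
    subst hj2
    push_cast at h2' h3'
    have ha : a = (j + 1) * r := by linarith
    have hnext : K.Next (K.corner v j).1 (K.corner v j).2 (K.corner v (j + 1)).1
        (K.corner v (j + 1)).2 :=
      ⟨by rw [K.vert_corner v j hj, K.vert_corner v _ hj'],
        by rw [K.idx_corner v j hj, K.idx_corner v _ hj']⟩
    rw [← K.map_eq_iff (sector_mem_sq h1 h2 h3) (sector_mem_sq h1 (by push_cast; exact h2') (by push_cast; exact h3'))]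
    have e1 : (2 * (j : ℝ) + 1) * r - 2 * a = -r := by rw [ha]; ring
    have e2 : (2 * ((j + 1 : ℕ) : ℝ) + 1) * r - 2 * a = r := by rw [ha]; push_cast; ring
    rw [e1, e2]
    apply Subtype.ext
    rw [K.map_val, K.map_val, K.q_eq_of_next hnext h0 h1]
    · exact pt_mem_sq (by rw [abs_of_nonneg (by linarith), abs_of_nonneg h0]; linarith)
    · exact pt_mem_sq (by rw [abs_of_nonneg (by linarith), abs_neg, abs_of_nonneg h0]; linarith)

theorem sector_of_map {i : K.I} {k : Fin 4} {p : ℝ × ℝ} :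
    K.sector (K.vert i k) (K.idx i k) (1 - ht k p) (K.ang i p k) = K.map i p := by
  unfold sector
  rw [K.corner_vert_idx]
  congr 1
  apply ext_ht (k := k)
  · simp
  · simp [ang]; ring

section
variable {v : K.N} {j : ℕ} {r a : ℝ} (hj : j < K.size v) (h1 : r < 1) (h2 : j * r ≤ a)
  (h3 : a ≤ (j + 1) * r)
include hj h1 h2 h3

theorem tau_sector : K.tau v (K.sector v j r a) = 1 - r := by
  rw [sector, tau_map (sector_mem_sq h1.le h2 h3) (K.vert_corner v j hj) (by simpa using h1), ht_pt]

theorem eta_sector : K.eta v (K.sector v j r a) = (1 - r) * a := by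
  rw [sector, eta_map (sector_mem_sq h1.le h2 h3) (K.vert_corner v j hj) (by simpa using h1), ht_pt,
    ang, K.idx_corner v j hj, ht_pt, ht_add_one_pt]
  ring

end

/-- The sector that contains the point with polar coordinates `r` and `a`. -/
noncomputable def sectorIdx (v : K.N) (r a : ℝ) : ℕ := min ⌊a / r⌋₊ (K.size v - 1)

theorem sectorIdx_lt (v : K.N) (r a : ℝ) : K.sectorIdx v r a < K.size v :=
  lt_of_le_of_lt (min_le_right _ _) (Nat.sub_lt (K.size_pos v) one_pos)

theorem sectorIdx_spec {v : K.N} {r a : ℝ} (h0 : 0 ≤ r) (ha : 0 ≤ a) (ha' : a ≤ K.size v * r) :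
    K.sectorIdx v r a * r ≤ a ∧ a ≤ (K.sectorIdx v r a + 1) * r := by
  rcases h0.eq_or_lt with rfl | hpos
  · simp at ha' ⊢; exact ⟨ha, ha'⟩
  have hf := Nat.floor_le (div_nonneg ha h0)
  have hf' := Nat.lt_floor_add_one (a / r)
  constructor
  · have : (K.sectorIdx v r a : ℝ) ≤ a / r := le_trans (by exact_mod_cast min_le_left _ _) hf
    rwa [le_div_iff₀ hpos] at this
  · rw [← div_le_iff₀ hpos]
    -- On the last ray `a = size * r` the floor is one too large; the truncation at `size - 1`
    -- assigns this ray to the last sector.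
    rcases min_choice ⌊a / r⌋₊ (K.size v - 1) with h | h
    · rw [sectorIdx, h]; exact hf'.le
    · rw [sectorIdx, h, div_le_iff₀ hpos]
      have : ((K.size v - 1 : ℕ) : ℝ) + 1 = K.size v := by
        have := K.size_pos v
        exact_mod_cast Nat.sub_add_cancel this
      rw [this]; exact ha'

/-- A fan of `m` sectors is the wedge `0 ≤ a ≤ m * r`, and `(r, a) ↦ (min (m * r - a) a, 2 * a - m *
r)` opens it to the half-plane, the two outer rays becoming the boundary line. The identities
recover `m * r` and `a` from the image. -/
theorem fold_unfold (m r a : ℝ) :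
    2 * min (m * r - a) a + |2 * a - m * r| = m * r ∧
      min (m * r - a) a + max (2 * a - m * r) 0 = a := by
  rcases le_total (m * r - a) a with h | h
  · rw [min_eq_left h, abs_of_nonneg (by linarith), max_eq_left (by linarith)]
    constructor <;> ring
  · rw [min_eq_right h, abs_of_nonpos (by linarith), max_eq_right (by linarith)]
    constructor <;> ring

theorem unfold_fold {s d : ℝ} (h0 : 0 ≤ s) : s + max d 0 ≤ 2 * s + |d| ∧
    min (2 * s + |d| - (s + max d 0)) (s + max d 0) = s ∧
    2 * (s + max d 0) - (2 * s + |d|) = d := by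
  rcases le_total 0 d with h | h
  · rw [max_eq_left h, abs_of_nonneg h]
    refine ⟨by linarith, ?_, by ring⟩
    rw [min_eq_left (by linarith)]; ring
  · rw [max_eq_right h, abs_of_nonpos h]
    refine ⟨by linarith, ?_, by ring⟩
    rw [min_eq_right (by linarith)]; ring

theorem size_cast_pos (v : K.N) : (0 : ℝ) < K.size v := by exact_mod_cast K.size_pos v

/-- The coordinate of the star chart that vanishes on the boundary. -/
noncomputable def starFst (v : K.N) (x : K.Space) : ℝ :=
  min (K.size v * (1 - K.tau v x) - K.eta v x / K.tau v x) (K.eta v x / K.tau v x)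

/-- The second coordinate of the star chart. -/
noncomputable def starSnd (v : K.N) (x : K.Space) : ℝ :=
  2 * (K.eta v x / K.tau v x) - K.size v * (1 - K.tau v x)

theorem polar_mem {v : K.N} {x : K.Space} (hx : 0 < K.tau v x) :
    0 ≤ 1 - K.tau v x ∧ 0 ≤ K.eta v x / K.tau v x ∧
      K.eta v x / K.tau v x ≤ K.size v * (1 - K.tau v x) := by
  obtain ⟨i, k, p, hp, rfl, rfl, hk⟩ := K.exists_of_tau_pos hx
  rw [tau_map hp rfl hk, eta_map hp rfl hk, mul_div_cancel_left₀ _ hk.ne']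
  have h1 := K.ang_mem (i := i) hp hk.le
  have h2 : 0 ≤ 1 - ht k p := sub_nonneg.2 (ht_le_one hp)
  refine ⟨h2, le_trans (by positivity) h1.1, h1.2.trans ?_⟩
  apply mul_le_mul_of_nonneg_right _ h2
  exact_mod_cast K.idx_lt i k

theorem starFst_nonneg {v : K.N} {x : K.Space} (hx : 0 < K.tau v x) : 0 ≤ K.starFst v x := by
  obtain ⟨_, h1, h2⟩ := K.polar_mem hx
  exact le_min (by linarith) h1

/-- The distance from the vertex, in the target of the star chart. -/
noncomputable def unfoldRad (v : K.N) (y : EuclideanHalfSpace 2) : ℝ :=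
  (2 * y.1 0 + |y.1 1|) / K.size v

/-- The angular coordinate, in the target of the star chart. -/
noncomputable def unfoldAng (y : EuclideanHalfSpace 2) : ℝ := y.1 0 + max (y.1 1) 0

theorem continuous_unfoldRad (v : K.N) : Continuous (K.unfoldRad v) :=
  ((continuous_const.mul (continuous_halfSpace_apply 0)).add
    (continuous_halfSpace_apply 1).abs).div_const _

theorem continuous_unfoldAng : Continuous unfoldAng :=
  (continuous_halfSpace_apply 0).add ((continuous_halfSpace_apply 1).max continuous_const)

theorem size_mul_unfoldRad (v : K.N) (y : EuclideanHalfSpace 2) :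
    K.size v * K.unfoldRad v y = 2 * y.1 0 + |y.1 1| := by
  have := (K.size_cast_pos v).ne'
  rw [unfoldRad]; field_simp

theorem unfoldRad_nonneg (v : K.N) (y : EuclideanHalfSpace 2) : 0 ≤ K.unfoldRad v y :=
  div_nonneg (add_nonneg (mul_nonneg zero_le_two y.2) (abs_nonneg _)) (K.size_cast_pos v).le

theorem unfoldAng_nonneg (y : EuclideanHalfSpace 2) : 0 ≤ unfoldAng y :=
  add_nonneg y.2 (le_max_right _ _)

theorem unfoldAng_le (v : K.N) (y : EuclideanHalfSpace 2) :
    unfoldAng y ≤ K.size v * K.unfoldRad v y := by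
  rw [size_mul_unfoldRad]; exact (unfold_fold y.2).1

/-- The inverse of the star chart. -/
noncomputable def starInv (v : K.N) (y : EuclideanHalfSpace 2) : K.Space :=
  K.sector v (K.sectorIdx v (K.unfoldRad v y) (unfoldAng y)) (K.unfoldRad v y) (unfoldAng y)

theorem starInv_spec (v : K.N) (y : EuclideanHalfSpace 2) :
    K.sectorIdx v (K.unfoldRad v y) (unfoldAng y) * K.unfoldRad v y ≤ unfoldAng y ∧
      unfoldAng y ≤ (K.sectorIdx v (K.unfoldRad v y) (unfoldAng y) + 1) * K.unfoldRad v y :=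
  K.sectorIdx_spec (K.unfoldRad_nonneg v y) (unfoldAng_nonneg y) (K.unfoldAng_le v y)

theorem starInv_eq {v : K.N} {y : EuclideanHalfSpace 2} {j : ℕ} (hj : j < K.size v)
    (hr : K.unfoldRad v y ≤ 1) (h1 : j * K.unfoldRad v y ≤ unfoldAng y)
    (h2 : unfoldAng y ≤ (j + 1) * K.unfoldRad v y) :
    K.starInv v y = K.sector v j (K.unfoldRad v y) (unfoldAng y) :=
  K.sector_eq_sector (K.sectorIdx_lt _ _ _) hj (K.unfoldRad_nonneg v y) hr
    (K.starInv_spec v y).1 (K.starInv_spec v y).2 h1 h2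

theorem continuousOn_starInv (v : K.N) :
    ContinuousOn (K.starInv v) {y | K.unfoldRad v y < 1} := by
  have hr := K.continuous_unfoldRad v
  have ha := continuous_unfoldAng
  refine continuousOn_of_finite_closed_cover (ι := Fin (K.size v))
    (fun j => {y | (j : ℝ) * K.unfoldRad v y ≤ unfoldAng y} ∩
      {y | unfoldAng y ≤ (j + 1) * K.unfoldRad v y}) (fun y _ => ?_) (fun j => ?_) fun j => ?_
  · exact mem_iUnion.2 ⟨⟨_, K.sectorIdx_lt _ _ _⟩, K.starInv_spec v y⟩
  · exact (isClosed_le (by fun_prop) (by fun_prop)).inter (isClosed_le (by fun_prop) (by fun_prop))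
  · refine ContinuousOn.congr (f := fun y => K.sector v j (K.unfoldRad v y) (unfoldAng y)) ?_
      fun y hy => K.starInv_eq j.2 hy.1.le hy.2.1 hy.2.2
    refine (K.continuousOn_map _).comp (Continuous.continuousOn ?_) fun y hy =>
      sector_mem_sq hy.1.le hy.2.1 hy.2.2
    exact (continuous_pt _).comp (Continuous.prodMk (by fun_prop) (by fun_prop))

/-- The chart on the open star of a vertex. -/
noncomputable def starChart (v : K.N) : OpenPartialHomeomorph K.Space (EuclideanHalfSpace 2) where
  toFun x := halfPoint (K.starFst v x) (K.starSnd v x)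
  invFun := K.starInv v
  source := {x | 0 < K.tau v x}
  target := {y | K.unfoldRad v y < 1}
  map_source' x hx := by
    obtain ⟨h0, h1, h2⟩ := K.polar_mem hx
    change K.unfoldRad v _ < 1
    rw [unfoldRad, halfPoint_zero, halfPoint_one, max_eq_left (K.starFst_nonneg hx), starFst, starSnd,
      (fold_unfold _ _ _).1, mul_div_cancel_left₀ _ (K.size_cast_pos v).ne']
    have : 0 < K.tau v x := hx
    linarith
  map_target' y hy := by
    change 0 < K.tau v _
    rw [starInv, K.tau_sector (K.sectorIdx_lt _ _ _) hy (K.starInv_spec v y).1 (K.starInv_spec v y).2]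
    have : K.unfoldRad v y < 1 := hy
    linarith
  left_inv' x hx := by
    obtain ⟨h0, h1, h2⟩ := K.polar_mem hx
    have hr : K.unfoldRad v (halfPoint (K.starFst v x) (K.starSnd v x)) = 1 - K.tau v x := by
      rw [unfoldRad, halfPoint_zero, halfPoint_one, max_eq_left (K.starFst_nonneg hx), starFst,
        starSnd, (fold_unfold _ _ _).1, mul_div_cancel_left₀ _ (K.size_cast_pos v).ne']
    have ha : unfoldAng (halfPoint (K.starFst v x) (K.starSnd v x)) = K.eta v x / K.tau v x := by
      rw [unfoldAng, halfPoint_zero, halfPoint_one, max_eq_left (K.starFst_nonneg hx), starFst,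
        starSnd, (fold_unfold _ _ _).2]
    obtain ⟨i, k, p, hp, rfl, rfl, hk⟩ := K.exists_of_tau_pos hx
    rw [tau_map hp rfl hk] at hr h0
    rw [tau_map hp rfl hk, eta_map hp rfl hk, mul_div_cancel_left₀ _ hk.ne'] at ha
    have hm := K.ang_mem (i := i) hp hk.le
    rw [K.starInv_eq (K.idx_lt i k), hr, ha, sector_of_map]
    · rw [hr]; linarith
    · rw [hr, ha]; exact hm.1
    · rw [hr, ha]; exact hm.2
  right_inv' y hy := by
    have hy' : 0 < 1 - K.unfoldRad v y := sub_pos.2 hy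
    have e1 : K.tau v (K.starInv v y) = 1 - K.unfoldRad v y :=
      K.tau_sector (K.sectorIdx_lt _ _ _) hy (K.starInv_spec v y).1 (K.starInv_spec v y).2
    have e2 : K.eta v (K.starInv v y) = (1 - K.unfoldRad v y) * unfoldAng y :=
      K.eta_sector (K.sectorIdx_lt _ _ _) hy (K.starInv_spec v y).1 (K.starInv_spec v y).2
    obtain ⟨_, f1, f2⟩ := unfold_fold (d := y.1 1) y.2
    apply halfPoint_eq
    · rw [starFst, e1, e2, mul_div_cancel_left₀ _ hy'.ne', sub_sub_cancel, size_mul_unfoldRad]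
      exact f1
    · rw [starSnd, e1, e2, mul_div_cancel_left₀ _ hy'.ne', sub_sub_cancel, size_mul_unfoldRad]
      exact f2
  open_source := isOpen_lt continuous_const (K.continuous_tau v)
  open_target := isOpen_lt (K.continuous_unfoldRad v) continuous_const
  continuousOn_toFun := by
    have h1 := (K.continuous_tau v).continuousOn (s := {x | 0 < K.tau v x})
    have h2 := (K.continuous_eta v).continuousOn (s := {x | 0 < K.tau v x})
    have h3 : ContinuousOn (fun x => K.eta v x / K.tau v x) {x | 0 < K.tau v x} :=
      h2.div h1 fun x hx => ne_of_gt hx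
    have h4 : ContinuousOn (fun x => (K.size v : ℝ) * (1 - K.tau v x)) {x | 0 < K.tau v x} :=
      continuousOn_const.mul (continuousOn_const.sub h1)
    exact continuous_halfPoint.comp_continuousOn
      ((ContinuousOn.inf (h4.sub h3) h3).prodMk ((continuousOn_const.mul h3).sub h4))
  continuousOn_invFun := K.continuousOn_starInv v

/-! ### The open squares -/

/-- The bump function of the open square `i`. -/
def bumpAt (i : K.I) (x : K.Space) : ℝ := (x.1.2 i).1

theorem continuous_bumpAt (i : K.I) : Continuous (K.bumpAt i) :=
  continuous_fst.comp ((continuous_apply i).comp (continuous_snd.comp continuous_subtype_val))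

theorem cell_map {i : K.I} {p : ℝ × ℝ} (hp : p ∈ sq) :
    (K.map i p).1.2 i = (bump p, bump p * p.1, bump p * p.2) := by
  rw [K.map_val hp]; simp [q]

theorem bumpAt_map {i : K.I} {p : ℝ × ℝ} (hp : p ∈ sq) : K.bumpAt i (K.map i p) = bump p := by
  rw [bumpAt, cell_map _ hp]

theorem bumpAt_pos_iff {i : K.I} {x : K.Space} :
    0 < K.bumpAt i x ↔ ∃ p, 0 < bump p ∧ K.map i p = x := by
  classical
  constructor
  · intro hx
    obtain ⟨i', p, hp, rfl⟩ := K.exists_map_eq x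
    obtain rfl : i = i' := by
      by_contra hne
      rw [bumpAt, K.map_val hp] at hx
      simp [q, hne] at hx
    exact ⟨p, by rwa [bumpAt_map _ hp] at hx, rfl⟩
  · rintro ⟨p, hp, rfl⟩
    rwa [bumpAt_map _ (bump_nonneg.1 hp.le)]

/-- The chart on an open square. -/
noncomputable def cellChart (i : K.I) : OpenPartialHomeomorph K.Space (EuclideanHalfSpace 2) where
  -- Division by the bump recovers the point of the square, and the shift by 2 moves the square into
  -- the interior of the half-plane.
  toFun x := halfPoint ((x.1.2 i).2.1 / (x.1.2 i).1 + 2) ((x.1.2 i).2.2 / (x.1.2 i).1)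
  invFun y := K.map i (y.1 0 - 2, y.1 1)
  source := {x | 0 < K.bumpAt i x}
  target := {y | 0 < bump (y.1 0 - 2, y.1 1)}
  map_source' x hx := by
    obtain ⟨p, hp, rfl⟩ := K.bumpAt_pos_iff.1 hx
    change 0 < bump _
    rw [K.cell_map (bump_nonneg.1 hp.le)]
    simp only [mul_div_cancel_left₀ _ hp.ne', halfPoint_zero, halfPoint_one]
    have : -1 ≤ p.1 := by
      rw [bump] at hp
      linarith [neg_abs_le p.1, abs_nonneg p.2]
    rw [max_eq_left (by linarith), add_sub_cancel_right]
    exact hp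
  map_target' y hy := K.bumpAt_pos_iff.2 ⟨_, hy, rfl⟩
  left_inv' x hx := by
    obtain ⟨p, hp, rfl⟩ := K.bumpAt_pos_iff.1 hx
    rw [K.cell_map (bump_nonneg.1 hp.le)]
    simp only [mul_div_cancel_left₀ _ hp.ne', halfPoint_zero, halfPoint_one]
    have : -1 ≤ p.1 := by
      rw [bump] at hp
      linarith [neg_abs_le p.1, abs_nonneg p.2]
    rw [max_eq_left (by linarith), add_sub_cancel_right]
  right_inv' y hy := by
    have hy' : 0 < bump (y.1 0 - 2, y.1 1) := hy
    rw [K.cell_map (bump_nonneg.1 hy'.le)]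
    simp only [mul_div_cancel_left₀ _ hy'.ne', sub_add_cancel]
    exact halfPoint_eq rfl rfl
  open_source := isOpen_lt continuous_const (K.continuous_bumpAt i)
  open_target := isOpen_lt continuous_const (continuous_bump.comp
    (((continuous_halfSpace_apply 0).sub continuous_const).prodMk (continuous_halfSpace_apply 1)))
  continuousOn_toFun := by
    have h : Continuous fun x : K.Space => x.1.2 i :=
      (continuous_apply i).comp (continuous_snd.comp continuous_subtype_val)
    have h1 : ContinuousOn (fun x : K.Space => (x.1.2 i).1) {x | 0 < K.bumpAt i x} :=
      (continuous_fst.comp h).continuousOn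
    have h2 : ContinuousOn (fun x : K.Space => (x.1.2 i).2.1) {x | 0 < K.bumpAt i x} :=
      (continuous_fst.comp (continuous_snd.comp h)).continuousOn
    have h3 : ContinuousOn (fun x : K.Space => (x.1.2 i).2.2) {x | 0 < K.bumpAt i x} :=
      (continuous_snd.comp (continuous_snd.comp h)).continuousOn
    have h0 : ∀ x ∈ {x | 0 < K.bumpAt i x}, (x.1.2 i).1 ≠ 0 := fun x hx => ne_of_gt hx
    exact continuous_halfPoint.comp_continuousOn
      (((h2.div h1 h0).add continuousOn_const).prodMk (h3.div h1 h0))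
  continuousOn_invFun := by
    refine (K.continuousOn_map i).comp (Continuous.continuousOn ?_) fun y hy =>
      bump_nonneg.1 (le_of_lt hy)
    exact ((continuous_halfSpace_apply 0).sub continuous_const).prodMk (continuous_halfSpace_apply 1)

/-! ### The atlas -/

/-- The charts of the atlas. -/
noncomputable def chart : K.N ⊕ K.I → OpenPartialHomeomorph K.Space (EuclideanHalfSpace 2) :=
  Sum.elim K.starChart K.cellChart

theorem exists_mem_chart_source (x : K.Space) : (∃ i, 0 < K.bumpAt i x) ∨ ∃ v, 0 < K.tau v x := by
  obtain ⟨i, p, hp, rfl⟩ := K.exists_map_eq x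
  by_cases h0 : p = 0
  · left
    refine ⟨i, ?_⟩
    rw [bumpAt_map _ hp, h0]; simp [bump]
  · right
    obtain ⟨k, hk⟩ := exists_ht_pos h0
    exact ⟨_, (tau_map_pos_iff hp).2 ⟨k, rfl, hk⟩⟩

open Classical in
/-- The index of the preferred chart at a point. -/
noncomputable def chartIdx (x : K.Space) : K.N ⊕ K.I :=
  -- Open squares take precedence, so star charts are the preferred ones only at points of edges and
  -- at vertices.
  if h : ∃ i, 0 < K.bumpAt i x then .inr h.choose
  else .inl ((K.exists_mem_chart_source x).resolve_left h).choose

theorem chartIdx_spec (x : K.Space) : (∃ i, 0 < K.bumpAt i x ∧ K.chartIdx x = .inr i) ∨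
    (∀ i, ¬ 0 < K.bumpAt i x) ∧ ∃ v, 0 < K.tau v x ∧ K.chartIdx x = .inl v := by
  rw [chartIdx]
  split_ifs with h
  · exact .inl ⟨_, h.choose_spec, rfl⟩
  · exact .inr ⟨not_exists.1 h, _, ((K.exists_mem_chart_source x).resolve_left h).choose_spec, rfl⟩

theorem mem_chart_chartIdx_source (x : K.Space) : x ∈ (K.chart (K.chartIdx x)).source := by
  rcases K.chartIdx_spec x with ⟨i, hi, h⟩ | ⟨_, v, hv, h⟩
  · rw [h]; exact hi
  · rw [h]; exact hv

noncomputable instance : ChartedSpace (EuclideanHalfSpace 2) K.Space where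
  atlas := range K.chart
  chartAt x := K.chart (K.chartIdx x)
  mem_chart_source := K.mem_chart_chartIdx_source
  chart_mem_atlas _ := mem_range_self _

end SquareComplex

/-! ### The charts on quarters of squares -/

namespace SquareComplex

theorem pt_inj_of_pos {k k' : Fin 4} {a b a' b' : ℝ} (ha : 0 < a) (hb : 0 < b) (ha' : 0 ≤ a')
    (hb' : 0 ≤ b') (h : pt k' a' b' = pt k a b) : k' = k ∧ a' = a ∧ b' = b := by
  fin_cases k <;> fin_cases k' <;> simp [pt] at h ⊢ <;> grind

theorem pt_eq_pt_zero {k k' : Fin 4} {a a' b' : ℝ} (ha : 0 < a) (ha' : 0 ≤ a')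
    (hb' : 0 ≤ b') (h : pt k' a' b' = pt k a 0) :
    (k' = k ∧ a' = a ∧ b' = 0) ∨ (k' = k - 1 ∧ a' = 0 ∧ b' = a) := by
  fin_cases k <;> fin_cases k' <;> simp [pt] at h ⊢ <;> grind

variable (K : SquareComplex)

/-- The standard triangle. -/
def tri : Set (Fin 2 → ℝ) := {w | 0 ≤ w 0 ∧ 0 ≤ w 1 ∧ w 0 + w 1 ≤ 1}

/-- The characteristic map of the quarter of the square `i` spanned by the centre and the corners
`k` and `k + 1`. -/
noncomputable def quarter (i : K.I) (k : Fin 4) (w : Fin 2 → ℝ) : K.Space :=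
  K.map i (pt k (w 0) (w 1))

theorem pt_tri_mem_sq {k : Fin 4} {w : Fin 2 → ℝ} (hw : w ∈ tri) : pt k (w 0) (w 1) ∈ sq := by
  apply pt_mem_sq
  rw [abs_of_nonneg hw.1, abs_of_nonneg hw.2.1]; exact hw.2.2

theorem exists_quarter_eq (x : K.Space) : ∃ i k, ∃ w ∈ tri, K.quarter i k w = x := by
  obtain ⟨i, p, hp, rfl⟩ := K.exists_map_eq x
  obtain ⟨k, h0, h1⟩ := exists_quadrant p
  rw [mem_sq_iff k, abs_of_nonneg h0, abs_of_nonneg h1] at hp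
  refine ⟨i, k, ![ht k p, ht (k + 1) p], ⟨h0, h1, hp⟩, ?_⟩
  simp [quarter, pt_ht]

theorem continuousOn_quarter (i : K.I) (k : Fin 4) : ContinuousOn (K.quarter i k) tri := by
  refine (K.continuousOn_map i).comp (Continuous.continuousOn ?_) fun w hw => pt_tri_mem_sq hw
  exact (continuous_pt k).comp (f := fun w : Fin 2 → ℝ => (w 0, w 1)) ((continuous_apply 0).prodMk (continuous_apply 1))

theorem isCompact_tri : IsCompact tri := by
  refine Metric.isCompact_of_isClosed_isBounded ?_ ?_
  · exact (isClosed_le continuous_const (continuous_apply 0)).inter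
      ((isClosed_le continuous_const (continuous_apply 1)).inter
        (isClosed_le ((continuous_apply 0).add (continuous_apply 1)) continuous_const))
  · refine (Metric.isBounded_closedBall (x := (0 : Fin 2 → ℝ)) (r := 1)).subset fun w hw => ?_
    rw [mem_closedBall_zero_iff, pi_norm_le_iff_of_nonneg zero_le_one]
    obtain ⟨h0, h1, h2⟩ := hw
    intro r
    fin_cases r
    · change |w 0| ≤ 1; rw [abs_of_nonneg h0]; linarith
    · change |w 1| ≤ 1; rw [abs_of_nonneg h1]; linarith

theorem isClosed_image_quarter (i : K.I) (k : Fin 4) : IsClosed (K.quarter i k '' tri) :=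
  (isCompact_tri.image_of_continuousOn (K.continuousOn_quarter i k)).isClosed

/-- Near a point, the space is covered by the quarters that contain this point. -/
theorem eventually_mem_quarter (x : K.Space) :
    ∀ᶠ y in 𝓝 x, ∃ i k, x ∈ K.quarter i k '' tri ∧ y ∈ K.quarter i k '' tri := by
  have := K.finite_I
  have hc : IsClosed (⋃ e : {e : K.I × Fin 4 // x ∉ K.quarter e.1 e.2 '' tri},
      K.quarter e.1.1 e.1.2 '' tri) :=
    isClosed_iUnion_of_finite fun e => K.isClosed_image_quarter _ _
  have hx : x ∉ (⋃ e : {e : K.I × Fin 4 // x ∉ K.quarter e.1 e.2 '' tri},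
      K.quarter e.1.1 e.1.2 '' tri) := by
    rw [mem_iUnion]; rintro ⟨e, he⟩; exact e.2 he
  filter_upwards [hc.isOpen_compl.mem_nhds hx] with y hy
  obtain ⟨i, k, w, hw, rfl⟩ := K.exists_quarter_eq y
  refine ⟨i, k, ?_, w, hw, rfl⟩
  by_contra hcon
  exact hy (mem_iUnion.2 ⟨⟨(i, k), hcon⟩, w, hw, rfl⟩)

theorem chart_star {v : K.N} {i : K.I} {k : Fin 4} {p : ℝ × ℝ} (hp : p ∈ sq)
    (hv : K.vert i k = v) (h : 0 < ht k p) :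
    K.starFst v (K.map i p) = min (K.size v * (1 - ht k p) - K.ang i p k) (K.ang i p k) ∧
      K.starSnd v (K.map i p) = 2 * K.ang i p k - K.size v * (1 - ht k p) := by
  rw [starFst, starSnd, tau_map hp hv h, eta_map hp hv h, mul_div_cancel_left₀ _ h.ne']
  exact ⟨rfl, rfl⟩

theorem starChart_zero {v : K.N} {x : K.Space} (hx : 0 < K.tau v x) :
    (K.starChart v x).1 0 = K.starFst v x := max_eq_left (K.starFst_nonneg hx)

theorem cellChart_map {i : K.I} {p : ℝ × ℝ} (hp : 0 < bump p) :
    (K.cellChart i (K.map i p)).1 0 = p.1 + 2 ∧ (K.cellChart i (K.map i p)).1 1 = p.2 := by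
  have hp' := bump_nonneg.1 hp.le
  have e := K.cell_map (i := i) hp'
  change max (((K.map i p).1.2 i).2.1 / ((K.map i p).1.2 i).1 + 2) 0 = _ ∧
    ((K.map i p).1.2 i).2.2 / ((K.map i p).1.2 i).1 = _
  rw [e]
  simp only [mul_div_cancel_left₀ _ hp.ne', and_true]
  apply max_eq_left
  rw [bump] at hp
  linarith [neg_abs_le p.1, abs_nonneg p.2]

theorem ang_quarter (i : K.I) (k : Fin 4) (a b : ℝ) :
    K.ang i (pt k a b) k = K.idx i k * (1 - a) + (1 - a - b) / 2 := by
  rw [ang, ht_pt, ht_add_one_pt]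

theorem ang_quarter' (i : K.I) (k : Fin 4) (a b : ℝ) :
    K.ang i (pt k a b) (k + 1) = K.idx i (k + 1) * (1 - b) + (1 - b + a) / 2 := by
  rw [ang, ht_add_one_add_one, ht_pt, ht_add_one_pt]; ring

/-- The charts are affine and orientation preserving on the quarters of the squares. -/
theorem exists_affine_chart (c : K.N ⊕ K.I) (i : K.I) (k : Fin 4) :
    ∃ (D : Matrix (Fin 2) (Fin 2) ℝ) (d : Fin 2 → ℝ), 0 < D.det ∧ ∀ w ∈ tri,
      K.quarter i k w ∈ (K.chart c).source →
        ∀ r, (K.chart c (K.quarter i k w)).1 r = D.mulVec w r + d r := by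
  rcases c with v | j
  · have hm := K.size_cast_pos v
    by_cases hv : K.vert i k = v
    · have hpos : ∀ w ∈ tri, 0 < K.tau v (K.quarter i k w) → 0 < w 0 := by
        intro w hw h
        obtain ⟨k', hv', hk'⟩ := (tau_map_pos_iff (pt_tri_mem_sq hw)).1 h
        rcases hw.1.lt_or_eq with h0 | h0
        · exact h0
        exfalso
        have hne : w 1 ≠ 0 := by
          intro h1
          rw [h1, ← h0] at hk'
          revert hk'; fin_cases k <;> fin_cases k' <;> simp [ht, pt]
        have h1 : 0 < ht (k + 1) (pt k (w 0) (w 1)) := by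
          rw [ht_add_one_pt]; exact lt_of_le_of_ne hw.2.1 hne.symm
        rcases eq_of_ht_pos_of_ht_pos h1 hk' with rfl | rfl | rfl
        · exact K.vert_add_one_ne i k (hv'.trans hv.symm)
        · rw [ht_add_one_add_one, ht_pt] at hk'; linarith
        · rw [add_sub_cancel_right, ht_pt] at hk'; linarith
      have key : ∀ w ∈ tri, K.quarter i k w ∈ (K.chart (.inl v)).source → 
          (K.chart (.inl v) (K.quarter i k w)).1 0 = min (K.size v * (1 - w 0) -
            (K.idx i k * (1 - w 0) + (1 - w 0 - w 1) / 2))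
            (K.idx i k * (1 - w 0) + (1 - w 0 - w 1) / 2) ∧
          (K.chart (.inl v) (K.quarter i k w)).1 1 =
            2 * (K.idx i k * (1 - w 0) + (1 - w 0 - w 1) / 2) - K.size v * (1 - w 0) := by
        intro w hw h
        have h' : 0 < K.tau v (K.quarter i k w) := h
        have := K.chart_star (pt_tri_mem_sq (k := k) hw) hv (by rw [ht_pt]; exact hpos w hw h')
        rw [ang_quarter, ht_pt] at this
        exact ⟨(K.starChart_zero h').trans this.1, this.2⟩
      -- The minimum in the star chart changes branch at the middle ray of the fan. This ray may
      -- bisect a corner but never enters the interior of a quarter, hence one branch per quarter.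
      -- On either branch, at either corner, the determinant is `size / 2`.
      rcases le_or_gt (2 * K.idx i k + 1) (K.size v) with hle | hlt
      · have hle' : 2 * (K.idx i k : ℝ) + 1 ≤ K.size v := by exact_mod_cast hle
        refine ⟨!![-(K.idx i k + 1 / 2), -1 / 2; -(2 * K.idx i k + 1 - K.size v), -1],
          ![K.idx i k + 1 / 2, 2 * K.idx i k + 1 - K.size v], ?_, fun w hw h => ?_⟩
        · rw [Matrix.det_fin_two_of]; linarith
        · obtain ⟨e0, e1⟩ := key w hw h
          obtain ⟨h0, h1, h2⟩ := hw
          rw [min_eq_right (by nlinarith)] at e0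
          rw [Fin.forall_fin_two, e0, e1]
          simp [Matrix.mulVec, dotProduct, Fin.sum_univ_two]
          constructor <;> ring
      · have hle' : (K.size v : ℝ) ≤ 2 * (K.idx i k : ℝ) := by exact_mod_cast Nat.lt_succ_iff.1 hlt
        refine ⟨!![-(K.size v - K.idx i k - 1 / 2), 1 / 2; -(2 * K.idx i k + 1 - K.size v), -1],
          ![K.size v - K.idx i k - 1 / 2, 2 * K.idx i k + 1 - K.size v], ?_, fun w hw h => ?_⟩
        · rw [Matrix.det_fin_two_of]; linarith
        · obtain ⟨e0, e1⟩ := key w hw h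
          obtain ⟨h0, h1, h2⟩ := hw
          rw [min_eq_left (by nlinarith)] at e0
          rw [Fin.forall_fin_two, e0, e1]
          simp [Matrix.mulVec, dotProduct, Fin.sum_univ_two]
          constructor <;> ring
    by_cases hv1 : K.vert i (k + 1) = v
    · have hpos : ∀ w ∈ tri, 0 < K.tau v (K.quarter i k w) → 0 < w 1 := by
        intro w hw h
        obtain ⟨k', hv', hk'⟩ := (tau_map_pos_iff (pt_tri_mem_sq hw)).1 h
        rcases hw.2.1.lt_or_eq with h0 | h0
        · exact h0
        exfalso
        have hne : w 0 ≠ 0 := by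
          intro h1
          rw [h1, ← h0] at hk'
          revert hk'; fin_cases k <;> fin_cases k' <;> simp [ht, pt]
        have h1 : 0 < ht k (pt k (w 0) (w 1)) := by
          rw [ht_pt]; exact lt_of_le_of_ne hw.1 hne.symm
        rcases eq_of_ht_pos_of_ht_pos h1 hk' with rfl | rfl | rfl
        · exact hv hv'
        · rw [ht_add_one_pt] at hk'; linarith
        · rw [ht_sub_one_pt] at hk'; linarith
      have key : ∀ w ∈ tri, K.quarter i k w ∈ (K.chart (.inl v)).source → 
          (K.chart (.inl v) (K.quarter i k w)).1 0 = min (K.size v * (1 - w 1) -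
            (K.idx i (k + 1) * (1 - w 1) + (1 - w 1 + w 0) / 2))
            (K.idx i (k + 1) * (1 - w 1) + (1 - w 1 + w 0) / 2) ∧
          (K.chart (.inl v) (K.quarter i k w)).1 1 =
            2 * (K.idx i (k + 1) * (1 - w 1) + (1 - w 1 + w 0) / 2) - K.size v * (1 - w 1) := by
        intro w hw h
        have h' : 0 < K.tau v (K.quarter i k w) := h
        have := K.chart_star (pt_tri_mem_sq (k := k) hw) hv1
          (by rw [ht_add_one_pt]; exact hpos w hw h')
        rw [ang_quarter', ht_add_one_pt] at this
        exact ⟨(K.starChart_zero h').trans this.1, this.2⟩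
      rcases lt_or_ge (2 * K.idx i (k + 1) + 1) (K.size v) with hle | hlt
      · have hle' : 2 * (K.idx i (k + 1) : ℝ) + 2 ≤ K.size v := by exact_mod_cast hle
        refine ⟨!![1 / 2, -(K.idx i (k + 1) + 1 / 2); 1, -(2 * K.idx i (k + 1) + 1 - K.size v)],
          ![K.idx i (k + 1) + 1 / 2, 2 * K.idx i (k + 1) + 1 - K.size v], ?_, fun w hw h => ?_⟩
        · rw [Matrix.det_fin_two_of]; linarith
        · obtain ⟨e0, e1⟩ := key w hw h
          obtain ⟨h0, h1, h2⟩ := hw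
          rw [min_eq_right (by nlinarith)] at e0
          rw [Fin.forall_fin_two, e0, e1]
          simp [Matrix.mulVec, dotProduct, Fin.sum_univ_two]
          constructor <;> ring
      · have hle' : (K.size v : ℝ) ≤ 2 * (K.idx i (k + 1) : ℝ) + 1 := by exact_mod_cast hlt
        refine ⟨!![-1 / 2, -(K.size v - K.idx i (k + 1) - 1 / 2);
            1, -(2 * K.idx i (k + 1) + 1 - K.size v)],
          ![K.size v - K.idx i (k + 1) - 1 / 2, 2 * K.idx i (k + 1) + 1 - K.size v], ?_,
          fun w hw h => ?_⟩
        · rw [Matrix.det_fin_two_of]; linarith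
        · obtain ⟨e0, e1⟩ := key w hw h
          obtain ⟨h0, h1, h2⟩ := hw
          rw [min_eq_left (by nlinarith)] at e0
          rw [Fin.forall_fin_two, e0, e1]
          simp [Matrix.mulVec, dotProduct, Fin.sum_univ_two]
          constructor <;> ring
    · refine ⟨1, 0, by simp, fun w hw h => ?_⟩
      exfalso
      obtain ⟨k', hv', hk'⟩ := (tau_map_pos_iff (pt_tri_mem_sq hw)).1 (show 0 < K.tau v _ from h)
      have hk : k' = k ∨ k' = k + 1 := by
        have h0 := hw.1
        have h1 := hw.2.1
        revert hk'; clear hv' h hv hv1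
        fin_cases k <;> fin_cases k' <;> simp [ht, pt] <;> linarith
      rcases hk with rfl | rfl
      · exact hv hv'
      · exact hv1 hv'
  · by_cases hij : i = j
    · subst hij
      have key : ∀ w ∈ tri, K.quarter i k w ∈ (K.chart (.inr i)).source → 
          (K.chart (.inr i) (K.quarter i k w)).1 0 = (pt k (w 0) (w 1)).1 + 2 ∧
          (K.chart (.inr i) (K.quarter i k w)).1 1 = (pt k (w 0) (w 1)).2 := by
        intro w hw h
        have h' : 0 < K.bumpAt i (K.quarter i k w) := h
        rw [quarter, K.bumpAt_map (pt_tri_mem_sq hw)] at h'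
        exact K.cellChart_map h'
      refine ⟨!![(pt k 1 0).1, (pt k 0 1).1; (pt k 1 0).2, (pt k 0 1).2], ![2, 0], ?_,
        fun w hw h => ?_⟩
      · rw [Matrix.det_fin_two_of]; fin_cases k <;> simp [pt]
      · obtain ⟨e0, e1⟩ := key w hw h
        rw [Fin.forall_fin_two, e0, e1]
        simp only [Matrix.mulVec, dotProduct, Fin.sum_univ_two]
        fin_cases k <;> simp [pt]
    · refine ⟨1, 0, by simp, fun w hw h => ?_⟩
      exfalso
      have h' : 0 < K.bumpAt j (K.quarter i k w) := h
      rw [quarter, bumpAt, K.map_val (pt_tri_mem_sq hw)] at h'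
      simp [q, Ne.symm hij] at h'

end SquareComplex

/-! ### Quarters meeting at a point -/

namespace SquareComplex
variable (K : SquareComplex)

variable {K} in
theorem Next.map_eq {i i' : K.I} {k k' : Fin 4} (h : K.Next i k i' k') {s : ℝ} (h0 : 0 ≤ s)
    (h1 : s ≤ 1) : K.map i (pt k (1 - s) (-s)) = K.map i' (pt k' (1 - s) s) := by
  apply Subtype.ext
  rw [K.map_val, K.map_val, K.q_eq_of_next h h0 h1]
  · exact pt_mem_sq (by rw [abs_of_nonneg (by linarith), abs_of_nonneg h0]; linarith)
  · exact pt_mem_sq (by rw [abs_of_nonneg (by linarith), abs_neg, abs_of_nonneg h0]; linarith)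

theorem quarter_add_one (i : K.I) (k : Fin 4) (c : ℝ) :
    K.quarter i (k + 1) ![c, 0] = K.quarter i k ![0, c] := by
  simp [quarter, pt_add_one]

/-- Apart from the corners, points of a quarter are identified with others only across its outer
edge, and the square on the other side is the preceding one in the fan at the corner `k`. -/
theorem glued_quarter {i i' : K.I} {k : Fin 4} {p' : ℝ × ℝ} {a b : ℝ} (h0 : 0 ≤ a) (h1 : 0 ≤ b)
    (ha : a < 1) (hb : b < 1) (h : K.Glued i' p' i (pt k a b)) : (i' = i ∧ p' = pt k a b) ∨
      ∃ k', K.Next i' k' i k ∧ a + b = 1 ∧ p' = pt (k' - 1) b a := by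
  rcases h with ⟨rfl, rfl⟩ | ⟨k', k0, _, _, hp⟩ | ⟨k', k0, s, hn, hs0, hs1, rfl, hp⟩
  · exact .inl ⟨rfl, rfl⟩
  · exfalso
    revert hp; fin_cases k <;> fin_cases k0 <;> simp [pt] <;> intros <;> linarith
  · obtain ⟨rfl, rfl, rfl⟩ : k = k0 ∧ a = 1 - s ∧ b = s :=
      pt_inj_of_pos (by linarith) hs0 h0 h1 hp
    exact .inr ⟨k', hn, by ring, by rw [pt_sub_one]⟩

theorem vec_eq {w : Fin 2 → ℝ} {a b : ℝ} (h0 : w 0 = a) (h1 : w 1 = b) : w = ![a, b] := by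
  ext r; fin_cases r
  · exact h0
  · exact h1

theorem mem_tri {a b : ℝ} : ![a, b] ∈ tri ↔ 0 ≤ a ∧ 0 ≤ b ∧ a + b ≤ 1 := Iff.rfl

theorem vec_add_smul (a b c d e : ℝ) : ![a, b] + e • ![c, d] = ![a + e * c, b + e * d] := by
  ext r; fin_cases r <;> simp

/-- The point `x` is contained in at most two quarters, which share a line segment at `x`. -/
def LocalPieces (x : K.Space) : Prop :=
  ∃ (i₁ : K.I) (k₁ : Fin 4) (w₁ u₁ : Fin 2 → ℝ) (i₂ : K.I) (k₂ : Fin 4) (w₂ u₂ : Fin 2 → ℝ),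
    u₁ ≠ 0 ∧ K.quarter i₁ k₁ w₁ = x ∧
    (∀ e : ℝ, 0 ≤ e → e ≤ 1 → w₁ + e • u₁ ∈ tri ∧ w₂ + e • u₂ ∈ tri ∧
      K.quarter i₁ k₁ (w₁ + e • u₁) = K.quarter i₂ k₂ (w₂ + e • u₂)) ∧
    ∀ i k, ∀ w ∈ tri, K.quarter i k w = x →
      (i = i₁ ∧ k = k₁ ∧ w = w₁) ∨ (i = i₂ ∧ k = k₂ ∧ w = w₂)

theorem vec_ne_zero {a b : ℝ} (h : a ≠ 0) : ![a, b] ≠ 0 := fun e => h (congrFun e 0)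

/-- A spoke from the centre to a corner lies in the two adjacent quarters of the same square; the
common segment runs towards the centre. -/
theorem localPieces_spoke {i : K.I} {k : Fin 4} {a : ℝ} (h0 : 0 < a) (h1 : a < 1) :
    K.LocalPieces (K.quarter i k ![a, 0]) := by
  refine ⟨i, k, ![a, 0], ![-a, 0], i, k - 1, ![0, a], ![0, -a], vec_ne_zero (by linarith), rfl,
    fun e he he' => ?_, fun i' k' w hw h => ?_⟩
  · simp only [vec_add_smul, mem_tri]
    refine ⟨⟨by nlinarith, by simp, by nlinarith⟩, ⟨by simp, by nlinarith, by nlinarith⟩, ?_⟩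
    simp [quarter, pt_sub_one]
  · rw [quarter, quarter, K.map_eq_iff (pt_tri_mem_sq hw) (pt_tri_mem_sq (mem_tri.2
      ⟨h0.le, le_rfl, by linarith⟩))] at h
    rcases K.glued_quarter h0.le le_rfl h1 zero_lt_one h with ⟨rfl, hp⟩ | ⟨_, _, hs, _⟩
    · rcases pt_eq_pt_zero h0 hw.1 hw.2.1 hp with ⟨rfl, e0, e1⟩ | ⟨rfl, e0, e1⟩
      · exact .inl ⟨rfl, rfl, vec_eq e0 e1⟩
      · exact .inr ⟨rfl, rfl, vec_eq e0 e1⟩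
    · exfalso
      change a + 0 = 1 at hs
      linarith

/-- Off the spokes, a point lies in a single quarter, listed twice with a segment towards the
centre, unless it is on a glued outer edge. There the second quarter is across the edge and the
segment runs along it. -/
theorem localPieces {i : K.I} {k : Fin 4} {w : Fin 2 → ℝ} (hw : w ∈ tri) (hw0 : w ≠ 0)
    (h0 : w 0 < 1) (h1 : w 1 < 1) : K.LocalPieces (K.quarter i k w) := by
  obtain ⟨a, b, rfl⟩ : ∃ a b, w = ![a, b] := ⟨w 0, w 1, vec_eq rfl rfl⟩
  rw [mem_tri] at hw
  change a < 1 at h0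
  change b < 1 at h1
  obtain ⟨ha, hb, hab⟩ := hw
  rcases hb.lt_or_eq with hb' | rfl
  swap
  · refine K.localPieces_spoke (lt_of_le_of_ne ha ?_) h0
    rintro rfl
    exact hw0 (by ext r; fin_cases r <;> rfl)
  rcases ha.lt_or_eq with ha' | rfl
  swap
  · rw [← quarter_add_one]
    exact K.localPieces_spoke hb' h1
  have hsq := pt_tri_mem_sq (k := k) (mem_tri.2 ⟨ha, hb, hab⟩)
  have single : (∀ i' k', K.Next i' k' i k → a + b ≠ 1) → K.LocalPieces (K.quarter i k ![a, b]) := by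
    intro hno
    refine ⟨i, k, ![a, b], ![-a, -b], i, k, ![a, b], ![-a, -b], vec_ne_zero (by linarith), rfl,
      fun e he he' => ?_, fun i' k' w hw h => ?_⟩
    · simp only [vec_add_smul, mem_tri]
      refine ⟨?_, ?_, trivial⟩ <;> exact ⟨by nlinarith, by nlinarith, by nlinarith⟩
    · rw [quarter, quarter, K.map_eq_iff (pt_tri_mem_sq hw) hsq] at h
      rcases K.glued_quarter ha hb h0 h1 h with ⟨rfl, hp⟩ | ⟨_, hn, hs, _⟩
      · obtain ⟨rfl, e0, e1⟩ := pt_inj_of_pos ha' hb' hw.1 hw.2.1 hp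
        exact .inl ⟨rfl, rfl, vec_eq e0 e1⟩
      · exact (hno _ _ hn hs).elim
  by_cases hs : a + b = 1
  swap
  · exact single fun _ _ _ => hs
  by_cases hn : ∃ i' k', K.Next i' k' i k
  swap
  · exact single fun i' k' h => (hn ⟨i', k', h⟩).elim
  obtain ⟨i', k', hn⟩ := hn
  refine ⟨i, k, ![a, b], ![-a, a], i', k' - 1, ![b, a], ![a, -a], vec_ne_zero (by linarith), rfl,
    fun e he he' => ?_, fun i'' k'' w hw h => ?_⟩
  · simp only [vec_add_smul, mem_tri]
    refine ⟨⟨by nlinarith, by nlinarith, by linarith⟩, ⟨by nlinarith, by nlinarith, by linarith⟩, ?_⟩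
    simp only [quarter, pt_sub_one, Matrix.cons_val_zero, Matrix.cons_val_one]
    have := hn.map_eq (s := b + e * a) (by nlinarith) (by nlinarith)
    rw [show a + e * -a = 1 - (b + e * a) by linarith]
    exact this.symm
  · rw [quarter, quarter, K.map_eq_iff (pt_tri_mem_sq hw) hsq] at h
    rcases K.glued_quarter ha hb h0 h1 h with ⟨rfl, hp⟩ | ⟨k₂, hn', _, hp⟩
    · obtain ⟨rfl, e0, e1⟩ := pt_inj_of_pos ha' hb' hw.1 hw.2.1 hp
      exact .inl ⟨rfl, rfl, vec_eq e0 e1⟩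
    · obtain ⟨rfl, rfl⟩ := K.corner_inj (hn.1.trans hn'.1.symm)
        (Nat.succ_injective (hn.2.symm.trans hn'.2))
      obtain ⟨rfl, e0, e1⟩ := pt_inj_of_pos hb' ha' hw.1 hw.2.1 hp
      exact .inr ⟨rfl, rfl, vec_eq e0 e1⟩

/-- More than two quarters meet only at centres and vertices, and each of these lies in one chart
only. -/
theorem localPieces_of_ne {c c' : K.N ⊕ K.I} (hc : c ≠ c') {x : K.Space}
    (hx : x ∈ (K.chart c).source) (hx' : x ∈ (K.chart c').source) : K.LocalPieces x := by
  obtain ⟨i, k, w, hw, rfl⟩ := K.exists_quarter_eq x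
  have hcorner : ∀ k', pt k (w 0) (w 1) = pt k' 1 0 → False := by
    intro k' hk'
    have : ∀ c, K.quarter i k w ∈ (K.chart c).source → c = .inl (K.vert i k') := by
      intro c hc
      rw [quarter, hk'] at hc
      have hsq : pt k' 1 0 ∈ sq := pt_mem_sq (by simp)
      rcases c with v | j
      · obtain ⟨k₂, hv, h₂⟩ := (tau_map_pos_iff hsq).1 (show 0 < K.tau v _ from hc)
        rw [← hv]
        congr 2
        revert h₂
        clear * -
        fin_cases k' <;> fin_cases k₂ <;> simp [ht, pt]
      · obtain ⟨p, hp, he⟩ := K.bumpAt_pos_iff.1 (show 0 < K.bumpAt j _ from hc)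
        exfalso
        have h1 := K.bumpAt_map (i := j) (bump_nonneg.1 hp.le)
        rw [he, bumpAt, K.map_val hsq] at h1
        by_cases hij : j = i
        · subst hij
          simp [q] at h1
          have e1 := bump_edge (k := k') le_rfl zero_le_one
          rw [sub_zero] at e1
          linarith
        · simp [q, hij] at h1
          linarith
    exact hc ((this c hx).trans (this c' hx').symm)
  refine K.localPieces hw ?_ ?_ ?_
  · rintro rfl
    have : ∀ c, K.quarter i k 0 ∈ (K.chart c).source → c = .inr i := by
      intro c hc
      have h0 : pt k ((0 : Fin 2 → ℝ) 0) ((0 : Fin 2 → ℝ) 1) = 0 := by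
        fin_cases k <;> simp [pt]
      rw [quarter, h0] at hc
      rcases c with v | j
      · obtain ⟨k₂, hv, h₂⟩ := (tau_map_pos_iff zero_mem_sq).1 (show 0 < K.tau v _ from hc)
        exfalso
        revert h₂
        fin_cases k₂ <;> simp [ht]
      · have h1 : 0 < K.bumpAt j _ := hc
        rw [bumpAt, K.map_val zero_mem_sq] at h1
        by_contra hij
        have : j ≠ i := fun h => hij (h ▸ rfl)
        simp [q, this] at h1
    exact hc ((this c hx).trans (this c' hx').symm)
  · by_contra! hge
    refine hcorner k ?_
    obtain ⟨h0, h1, h2⟩ := hw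
    rw [show w 0 = 1 by linarith, show w 1 = 0 by linarith]
  · by_contra! hge
    refine hcorner (k + 1) ?_
    obtain ⟨h0, h1, h2⟩ := hw
    rw [show w 1 = 1 by linarith, show w 0 = 0 by linarith, pt_add_one, neg_zero]

end SquareComplex

theorem halfPlaneModel_symm (z : Plane) :
    halfPlaneModel.symm z = halfPoint (z 0) (z 1) := by
  refine EuclideanHalfSpace.ext _ _ (Plane.ext' ?_ ?_)
  · rw [modelWithCornersEuclideanHalfSpace_symm_apply, halfPoint_zero]; simp
  · rw [modelWithCornersEuclideanHalfSpace_symm_apply, halfPoint_one]; simp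

theorem halfPlaneModel_symm_apply {z : Plane} (hz : 0 ≤ z 0) : (halfPlaneModel.symm z).1 = z := by
  rw [halfPlaneModel_symm]
  exact Plane.ext' (max_eq_left hz) rfl

theorem Matrix.mulVec_fin_two_apply (A : Matrix (Fin 2) (Fin 2) ℝ) (w : Fin 2 → ℝ) (i : Fin 2) :
    A.mulVec w i = A i 0 * w 0 + A i 1 * w 1 := by
  simp [Matrix.mulVec, dotProduct, Fin.sum_univ_two]

/-! ### Transition maps preserve orientation -/

namespace SquareComplex
variable (K : SquareComplex)

/-- On each of the at most two quarters at the point the transition map is affine with linear part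
`D' * D⁻¹` of positive determinant. The two linear parts agree along the common segment, as both
charts are well defined on it. -/
theorem preservesOrientationAt_transition (c c' : K.N ⊕ K.I) {z : Plane} (hz : 0 < z 0)
    (hs : halfPlaneModel.symm z ∈ (K.chart c).target)
    (hs' : (K.chart c).symm (halfPlaneModel.symm z) ∈ (K.chart c').source) :
    PreservesOrientationAt (fun y => (K.chart c' ((K.chart c).symm (halfPlaneModel.symm y))).1)
      z := by
  set x := (K.chart c).symm (halfPlaneModel.symm z) with hx
  have hxs : x ∈ (K.chart c).source := (K.chart c).map_target hs
  have hcs : ContinuousAt (fun y => (K.chart c).symm (halfPlaneModel.symm y)) z :=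
    ((K.chart c).continuousAt_symm hs).comp (f := halfPlaneModel.symm)
      halfPlaneModel.continuous_symm.continuousAt
  have hev : ∀ᶠ y in 𝓝 z, 0 < y 0 ∧ halfPlaneModel.symm y ∈ (K.chart c).target ∧
      (K.chart c).symm (halfPlaneModel.symm y) ∈ (K.chart c').source := by
    refine ((PiLp.continuous_apply 2 _ 0).continuousAt.eventually (lt_mem_nhds hz)).and
      ((halfPlaneModel.continuous_symm.continuousAt.eventually
        ((K.chart c).open_target.mem_nhds hs)).and
        (hcs.eventually ((K.chart c').open_source.mem_nhds hs')))
  have hcont : ∀ᶠ y in 𝓝 z, ContinuousAt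
      (fun y => (K.chart c' ((K.chart c).symm (halfPlaneModel.symm y))).1) y := by
    filter_upwards [hev] with y hy
    have h1 : ContinuousAt (fun y => (K.chart c).symm (halfPlaneModel.symm y)) y :=
      ((K.chart c).continuousAt_symm hy.2.1).comp (f := halfPlaneModel.symm)
        halfPlaneModel.continuous_symm.continuousAt
    have h2 : ContinuousAt (fun y => K.chart c' ((K.chart c).symm (halfPlaneModel.symm y))) y :=
      ((K.chart c').continuousAt hy.2.2).comp
        (f := fun y => (K.chart c).symm (halfPlaneModel.symm y)) h1
    exact continuous_subtype_val.continuousAt.comp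
      (f := fun y => K.chart c' ((K.chart c).symm (halfPlaneModel.symm y))) h2
  have hinv : ∀ y : Plane, 0 < y 0 → halfPlaneModel.symm y ∈ (K.chart c).target →
      ∀ r, (K.chart c ((K.chart c).symm (halfPlaneModel.symm y))).1 r = y r := by
    intro y h0 h1 r
    rw [(K.chart c).right_inv h1, halfPlaneModel_symm_apply h0.le]
  -- For equal charts the transition is the identity, and the point may be a vertex or a centre,
  -- where many quarters meet.
  by_cases hcc : c = c'
  · subst hcc
    refine preservesOrientationAt_of_linear_pieces 1 1 (by simp) (by simp) ![1, 0]
      (vec_ne_zero one_ne_zero) rfl hcont ?_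
    filter_upwards [hev] with y hy
    left
    intro i
    rw [hinv y hy.1 hy.2.1, hinv z hz hs]
    match i with
    | 0 => simp
    | 1 => simp
  obtain ⟨i₁, k₁, w₁, u₁, i₂, k₂, w₂, u₂, hu, hw₁, hseg, huniq⟩ := K.localPieces_of_ne hcc hxs hs'
  obtain ⟨D₁, d₁, hD₁, hE₁⟩ := K.exists_affine_chart c i₁ k₁
  obtain ⟨D₂, d₂, hD₂, hE₂⟩ := K.exists_affine_chart c i₂ k₂
  obtain ⟨D₁', d₁', hD₁', hE₁'⟩ := K.exists_affine_chart c' i₁ k₁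
  obtain ⟨D₂', d₂', hD₂', hE₂'⟩ := K.exists_affine_chart c' i₂ k₂
  have hw₁t : w₁ ∈ tri := by simpa using (hseg 0 le_rfl zero_le_one).1
  have hw₂t : w₂ ∈ tri := by simpa using (hseg 0 le_rfl zero_le_one).2.1
  have hw₂ : K.quarter i₂ k₂ w₂ = x := by
    rw [← hw₁]; simpa using (hseg 0 le_rfl zero_le_one).2.2.symm
  -- the two affine pieces agree along the common segment
  have hcommon : ∀ (c₀ : K.N ⊕ K.I) (A B : Matrix (Fin 2) (Fin 2) ℝ) (a b : Fin 2 → ℝ),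
      x ∈ (K.chart c₀).source →
      (∀ w ∈ tri, K.quarter i₁ k₁ w ∈ (K.chart c₀).source →
        ∀ r, (K.chart c₀ (K.quarter i₁ k₁ w)).1 r = A.mulVec w r + a r) →
      (∀ w ∈ tri, K.quarter i₂ k₂ w ∈ (K.chart c₀).source →
        ∀ r, (K.chart c₀ (K.quarter i₂ k₂ w)).1 r = B.mulVec w r + b r) →
      A.mulVec u₁ = B.mulVec u₂ := by
    intro c₀ A B a b hx₀ hA hB
    have hc₁ : ContinuousWithinAt (fun e : ℝ => K.quarter i₁ k₁ (w₁ + e • u₁)) (Icc 0 1) 0 := by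
      have hcw := (K.continuousOn_quarter i₁ k₁) w₁ hw₁t
      have hl : ContinuousWithinAt (fun e : ℝ => w₁ + e • u₁) (Icc 0 1) 0 := by
        apply Continuous.continuousWithinAt; fun_prop
      refine ContinuousWithinAt.comp (g := K.quarter i₁ k₁) (t := tri) (f := fun e : ℝ => w₁ + e • u₁) ?_ hl
        fun e he => (hseg e he.1 he.2).1
      simpa using hcw
    have hx0 : K.quarter i₁ k₁ (w₁ + (0 : ℝ) • u₁) ∈ (K.chart c₀).source := by
      simpa [hw₁] using hx₀
    have hne : ∀ᶠ e in 𝓝[Ioc 0 1] (0 : ℝ), e ∈ Ioc (0 : ℝ) 1 ∧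
        K.quarter i₁ k₁ (w₁ + e • u₁) ∈ (K.chart c₀).source :=
      eventually_mem_nhdsWithin.and ((hc₁.eventually ((K.chart c₀).open_source.mem_nhds hx0))
        |>.filter_mono (nhdsWithin_mono _ Ioc_subset_Icc_self))
    have : (𝓝[Ioc 0 1] (0 : ℝ)).NeBot := by
      rw [nhdsWithin_Ioc_eq_nhdsGT zero_lt_one]; infer_instance
    -- A short initial piece of the segment stays in the chart; subtracting the values at its ends
    -- leaves the linear parts.
    obtain ⟨e, ⟨he0, he1⟩, hes⟩ := hne.exists
    obtain ⟨ht₁, ht₂, heq⟩ := hseg e he0.le he1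
    ext r
    have e1 := hA _ ht₁ hes r
    have e2 := hB _ ht₂ (heq ▸ hes) r
    have e3 := hA _ hw₁t (hw₁ ▸ hx₀) r
    have e4 := hB _ hw₂t (hw₂ ▸ hx₀) r
    rw [hw₁] at e3
    rw [hw₂] at e4
    rw [heq] at e1
    simp only [Matrix.mulVec_add, Matrix.mulVec_smul, Pi.add_apply, Pi.smul_apply,
      smul_eq_mul] at e1 e2
    have : e * (A.mulVec u₁ r) = e * (B.mulVec u₂ r) := by linarith
    exact mul_left_cancel₀ he0.ne' this
  have hu₂ := hcommon c D₁ D₂ d₁ d₂ hxs hE₁ hE₂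
  have hu₂' := hcommon c' D₁' D₂' d₁' d₂' hs' hE₁' hE₂'
  have hlin : ∀ (D D' : Matrix (Fin 2) (Fin 2) ℝ), 0 < D.det → ∀ u,
      (D' * D⁻¹).mulVec (D.mulVec u) = D'.mulVec u := by
    intro D D' hD u
    rw [Matrix.mulVec_mulVec, Matrix.mul_assoc, Matrix.nonsing_inv_mul _ (by simpa using hD.ne'),
      Matrix.mul_one]
  have hdet : ∀ (D D' : Matrix (Fin 2) (Fin 2) ℝ), 0 < D.det → 0 < D'.det →
      0 < (D' * D⁻¹).det := by
    intro D D' hD hD'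
    rw [Matrix.det_mul, Matrix.det_nonsing_inv, Ring.inverse_eq_inv']
    positivity
  refine preservesOrientationAt_of_linear_pieces (D₁' * D₁⁻¹) (D₂' * D₂⁻¹) (hdet _ _ hD₁ hD₁')
    (hdet _ _ hD₂ hD₂') (D₁.mulVec u₁) ?_ ?_ hcont ?_
  · intro h0
    apply hu
    have := hlin D₁ 1 hD₁ u₁
    rw [h0, Matrix.mulVec_zero, Matrix.one_mulVec] at this
    exact this.symm
  · rw [hlin _ _ hD₁, hu₂, hlin _ _ hD₂, hu₂']
  have hpiece : ∀ (i : K.I) (k : Fin 4) (w w₀ : Fin 2 → ℝ) (D D' : Matrix (Fin 2) (Fin 2) ℝ)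
      (d d' : Fin 2 → ℝ), 0 < D.det → w ∈ tri → w₀ ∈ tri →
      (∀ w ∈ tri, K.quarter i k w ∈ (K.chart c).source →
        ∀ r, (K.chart c (K.quarter i k w)).1 r = D.mulVec w r + d r) →
      (∀ w ∈ tri, K.quarter i k w ∈ (K.chart c').source →
        ∀ r, (K.chart c' (K.quarter i k w)).1 r = D'.mulVec w r + d' r) →
      K.quarter i k w₀ = x → ∀ y : Plane, 0 < y 0 → halfPlaneModel.symm y ∈ (K.chart c).target →
      (K.chart c).symm (halfPlaneModel.symm y) ∈ (K.chart c').source →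
      K.quarter i k w = (K.chart c).symm (halfPlaneModel.symm y) →
      ∀ r, (K.chart c' ((K.chart c).symm (halfPlaneModel.symm y))).1 r - (K.chart c' x).1 r =
        (D' * D⁻¹) r 0 * (y 0 - z 0) + (D' * D⁻¹) r 1 * (y 1 - z 1) := by
    intro i k w w₀ D D' d d' hD hw hw₀ hE hE' hx₀ y hy0 hyt hys hyw r
    have hyz : ∀ r, y r - z r = D.mulVec (w - w₀) r := by
      intro r
      have e1 := hE w hw (hyw ▸ (K.chart c).map_target hyt) r
      have e2 := hE w₀ hw₀ (hx₀ ▸ hxs) r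
      rw [hyw, hinv y hy0 hyt] at e1
      rw [hx₀, hx, hinv z hz hs] at e2
      rw [e1, e2, Matrix.mulVec_sub, Pi.sub_apply]; ring
    have e1 := hE' w hw (hyw ▸ hys) r
    have e2 := hE' w₀ hw₀ (hx₀ ▸ hs') r
    rw [hyw] at e1
    rw [hx₀] at e2
    rw [e1, e2, hyz, hyz, ← Matrix.mulVec_fin_two_apply, hlin _ _ hD, Matrix.mulVec_sub, Pi.sub_apply]
    ring
  filter_upwards [hev, hcs.eventually (K.eventually_mem_quarter x)] with y hy hq
  obtain ⟨i, k, ⟨w₀, hw₀, hx₀⟩, w, hw, hyw⟩ := hq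
  rcases huniq i k w₀ hw₀ hx₀ with ⟨rfl, rfl, rfl⟩ | ⟨rfl, rfl, rfl⟩
  · exact .inl (hpiece _ _ _ _ _ _ _ _ hD₁ hw hw₀ hE₁ hE₁' hx₀ y hy.1 hy.2.1 hy.2.2 hyw)
  · exact .inr (hpiece _ _ _ _ _ _ _ _ hD₂ hw hw₀ hE₂ hE₂' hx₀ y hy.1 hy.2.1 hy.2.2 hyw)

theorem oriented : ∀ e ∈ atlas (EuclideanHalfSpace 2) K.Space,
    ∀ e' ∈ atlas (EuclideanHalfSpace 2) K.Space,
    ∀ z ∈ ((e.extend halfPlaneModel).symm.trans (e'.extend halfPlaneModel)).source ∩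
        interior (range halfPlaneModel),
      PreservesOrientationAt (e'.extend halfPlaneModel ∘ (e.extend halfPlaneModel).symm) z := by
  rintro _ ⟨c, rfl⟩ _ ⟨c', rfl⟩ z ⟨hz, hz0⟩
  rw [interior_range_modelWithCornersEuclideanHalfSpace] at hz0
  rw [PartialEquiv.trans_source] at hz
  obtain ⟨h1, h2⟩ := hz
  rw [PartialEquiv.symm_source, OpenPartialHomeomorph.extend_target] at h1
  have h2' : ((K.chart c).extend halfPlaneModel).symm z ∈ ((K.chart c').extend halfPlaneModel).source :=
    h2
  rw [OpenPartialHomeomorph.extend_source] at h2'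
  exact K.preservesOrientationAt_transition c c' hz0 h1.1 h2'

end SquareComplex

/-! ### The boundary of the realization -/

namespace SquareComplex
variable (K : SquareComplex)

theorem mem_boundary_iff {x : K.Space} :
    x ∈ halfPlaneModel.boundary K.Space ↔ (K.chart (K.chartIdx x) x).1 0 = 0 := by
  change extChartAt halfPlaneModel x x ∈ frontier (range halfPlaneModel) ↔ _
  rw [frontier_range_modelWithCornersEuclideanHalfSpace]
  exact eq_comm

theorem mem_interior_iff {x : K.Space} :
    x ∈ halfPlaneModel.interior K.Space ↔ 0 < (K.chart (K.chartIdx x) x).1 0 := by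
  change extChartAt halfPlaneModel x x ∈ interior (range halfPlaneModel) ↔ _
  rw [interior_range_modelWithCornersEuclideanHalfSpace]
  exact Iff.rfl

theorem mem_interior_of_bump {i : K.I} {p : ℝ × ℝ} (hp : 0 < bump p) :
    K.map i p ∈ halfPlaneModel.interior K.Space := by
  rw [mem_interior_iff]
  have hpos : 0 < K.bumpAt i (K.map i p) := by rwa [K.bumpAt_map (bump_nonneg.1 hp.le)]
  rcases K.chartIdx_spec (K.map i p) with ⟨j, hj, h⟩ | ⟨hno, _⟩
  · obtain ⟨p', hp', he⟩ := K.bumpAt_pos_iff.1 hj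
    rw [h, ← he]
    change 0 < (K.cellChart j (K.map j p')).1 0
    rw [(K.cellChart_map hp').1]
    rw [bump] at hp'
    linarith [neg_abs_le p'.1, abs_nonneg p'.2]
  · exact (hno i hpos).elim

theorem exists_next {i : K.I} {k : Fin 4} (h : K.idx i k + 1 < K.size (K.vert i k)) :
    ∃ i' k', K.Next i k i' k' :=
  ⟨_, _, (K.vert_corner _ _ h).symm, K.idx_corner _ _ h⟩

theorem exists_prev {i : K.I} {k : Fin 4} (h : K.idx i k ≠ 0) : ∃ i' k', K.Next i' k' i k := by
  have hlt : K.idx i k - 1 < K.size (K.vert i k) := by have := K.idx_lt i k; omega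
  exact ⟨_, _, K.vert_corner _ _ hlt, by rw [K.idx_corner _ _ hlt]; omega⟩

/-- Both conditions say that the edge `k` is not glued: it begins the fan at the corner `k` and ends
the fan at the corner `k + 1`. -/
theorem idx_eq_zero_iff {i : K.I} {k : Fin 4} :
    K.idx i k = 0 ↔ K.idx i (k + 1) + 1 = K.size (K.vert i (k + 1)) := by
  constructor
  · intro h
    by_contra hne
    obtain ⟨i', k', hn⟩ := K.exists_next (lt_of_le_of_ne (K.idx_lt i (k + 1)) hne)
    have := hn.glue.2
    rw [add_sub_cancel_right, h] at this
    omega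
  · intro h
    by_contra hne
    obtain ⟨i', k', hn⟩ := K.exists_prev hne
    have h1 := hn.glue.1
    have h2 := hn.glue.2
    have h3 := K.idx_lt i' (k' - 1)
    rw [← h1] at h3
    omega

/-- The parametrization of the edge from the corner `k` to the corner `k + 1` of a square. -/
noncomputable def edge (i : K.I) (k : Fin 4) (s : ℝ) : K.Space := K.map i (pt k (1 - s) s)

theorem edge_mem_sq {k : Fin 4} {s : ℝ} (hs : s ∈ Icc (0 : ℝ) 1) : pt k (1 - s) s ∈ sq :=
  pt_mem_sq (by rw [abs_of_nonneg hs.1, abs_of_nonneg (by linarith [hs.2])]; linarith)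

theorem continuousOn_edge (i : K.I) (k : Fin 4) : ContinuousOn (K.edge i k) (Icc 0 1) := by
  refine (K.continuousOn_map i).comp (Continuous.continuousOn ?_) fun s hs => edge_mem_sq hs
  exact (continuous_pt k).comp (f := fun s : ℝ => (1 - s, s)) (by fun_prop)

/-- The point of the realization corresponding to a vertex. -/
noncomputable def node (v : K.N) : K.Space := K.map (K.corner v 0).1 (pt (K.corner v 0).2 1 0)

theorem corner_mem_sq {k : Fin 4} : pt k 1 0 ∈ sq := pt_mem_sq (by simp)

theorem map_corner (i : K.I) (k : Fin 4) : K.map i (pt k 1 0) = K.node (K.vert i k) := by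
  rw [node, K.map_eq_iff corner_mem_sq corner_mem_sq]
  exact .inr (.inl ⟨_, _, (K.vert_corner _ _ (K.size_pos _)).symm, rfl, rfl⟩)

theorem edge_zero (i : K.I) (k : Fin 4) : K.edge i k 0 = K.node (K.vert i k) := by
  rw [edge, sub_zero, map_corner]

theorem edge_one (i : K.I) (k : Fin 4) : K.edge i k 1 = K.node (K.vert i (k + 1)) := by
  rw [edge, sub_self, ← map_corner, pt_add_one, neg_zero]

theorem exists_vert_eq (v : K.N) : ∃ i k, K.vert i k = v ∧ K.idx i k = 0 :=
  ⟨_, _, K.vert_corner v 0 (K.size_pos v), K.idx_corner v 0 (K.size_pos v)⟩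

theorem tau_node_pos {v w : K.N} (h : 0 < K.tau w (K.node v)) : w = v := by
  obtain ⟨i, k, rfl, _⟩ := K.exists_vert_eq v
  rw [← map_corner] at h
  obtain ⟨k', hv, hk⟩ := (tau_map_pos_iff corner_mem_sq).1 h
  rw [← hv]
  congr 1
  revert hk
  clear * -
  fin_cases k <;> fin_cases k' <;> simp [ht, pt]

theorem tau_node (v : K.N) : K.tau v (K.node v) = 1 := by
  obtain ⟨i, k, rfl, _⟩ := K.exists_vert_eq v
  rw [← map_corner, tau_map corner_mem_sq rfl (by rw [ht_pt]; exact one_pos), ht_pt]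

theorem node_injective : Function.Injective K.node := fun v w h =>
  K.tau_node_pos (w := v) (by rw [← h, tau_node]; exact one_pos)

theorem bumpAt_eq_zero {i j : K.I} {p : ℝ × ℝ} (hp : p ∈ sq) (h : bump p = 0) :
    K.bumpAt j (K.map i p) = 0 := by
  by_cases hij : j = i
  · subst hij; rw [K.bumpAt_map hp, h]
  · rw [bumpAt, K.map_val hp]; simp [q, hij]

theorem node_mem_boundary (v : K.N) : K.node v ∈ halfPlaneModel.boundary K.Space := by
  rw [mem_boundary_iff]
  rcases K.chartIdx_spec (K.node v) with ⟨j, hj, h⟩ | ⟨_, w, hw, h⟩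
  · rw [node, K.bumpAt_eq_zero corner_mem_sq] at hj
    · exact (lt_irrefl _ hj).elim
    · simpa using bump_edge (k := (K.corner v 0).2) le_rfl zero_le_one
  · rw [h]
    obtain rfl := K.tau_node_pos hw
    obtain ⟨i, k, rfl, _⟩ := K.exists_vert_eq w
    refine (K.starChart_zero hw).trans ?_
    rw [← map_corner, (K.chart_star corner_mem_sq rfl (by rw [ht_pt]; exact one_pos)).1,
      ang_quarter, ht_pt]
    simp

theorem starFst_edge {i : K.I} {k : Fin 4} {s : ℝ} (hs : s ∈ Ioo (0 : ℝ) 1) :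
    K.starFst (K.vert i k) (K.edge i k s) =
      min ((K.size (K.vert i k) - K.idx i k) * s) (K.idx i k * s) := by
  rw [edge, (K.chart_star (edge_mem_sq ⟨hs.1.le, hs.2.le⟩) rfl (by rw [ht_pt]; linarith [hs.2])).1,
    ang_quarter, ht_pt]
  congr 1 <;> ring

theorem starFst_edge' {i : K.I} {k : Fin 4} {s : ℝ} (hs : s ∈ Ioo (0 : ℝ) 1) :
    K.starFst (K.vert i (k + 1)) (K.edge i k s) =
      min ((K.size (K.vert i (k + 1)) - (K.idx i (k + 1) + 1)) * (1 - s))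
        ((K.idx i (k + 1) + 1) * (1 - s)) := by
  rw [edge, (K.chart_star (edge_mem_sq ⟨hs.1.le, hs.2.le⟩) rfl
    (by rw [ht_add_one_pt]; linarith [hs.1])).1, ang_quarter', ht_add_one_pt]
  congr 1 <;> ring

/-- An inner point of an edge lies only in the stars of the two ends of the edge. In either chart
the first coordinate vanishes exactly on the outer rays of the fan, so it vanishes exactly when the
edge is not glued. -/
theorem chart_edge {i : K.I} {k : Fin 4} {s : ℝ} (hs : s ∈ Ioo (0 : ℝ) 1) :
    ((K.chart (K.chartIdx (K.edge i k s)) (K.edge i k s)).1 0 = 0 ↔ K.idx i k = 0) ∧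
      0 ≤ (K.chart (K.chartIdx (K.edge i k s)) (K.edge i k s)).1 0 := by
  refine ⟨?_, (K.chart (K.chartIdx (K.edge i k s)) (K.edge i k s)).2⟩
  have hsq := edge_mem_sq (k := k) ⟨hs.1.le, hs.2.le⟩
  have hmin : ∀ {a b c : ℝ}, 0 ≤ a → 0 ≤ b → 0 < c → (min (a * c) (b * c) = 0 ↔ a = 0 ∨ b = 0) := by
    intro a b c ha hb hc
    rw [← min_mul_of_nonneg _ _ hc.le, mul_eq_zero, or_iff_left hc.ne']
    rcases le_total a b with h | h
    · rw [min_eq_left h]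
      exact ⟨.inl, fun h' => h'.elim id fun h' => le_antisymm (h' ▸ h) ha⟩
    · rw [min_eq_right h]
      exact ⟨.inr, fun h' => h'.elim (fun h' => le_antisymm (h' ▸ h) hb) id⟩
  rcases K.chartIdx_spec (K.edge i k s) with ⟨j, hj, h⟩ | ⟨_, w, hw, h⟩
  · rw [edge, K.bumpAt_eq_zero hsq (bump_edge hs.1.le hs.2.le)] at hj
    exact (lt_irrefl _ hj).elim
  · rw [h]
    have hc : (K.chart (.inl w) (K.edge i k s)).1 0 = K.starFst w (K.edge i k s) :=
      K.starChart_zero hw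
    rw [hc]
    obtain ⟨k', hv, hk⟩ := (tau_map_pos_iff hsq).1 hw
    have hk' : k' = k ∨ k' = k + 1 := by
      obtain ⟨h0, h1⟩ := hs
      revert hk; clear hw h hc hv hsq
      fin_cases k <;> fin_cases k' <;> simp [ht, pt] <;> linarith
    rcases hk' with rfl | rfl
    · have hlt := K.idx_lt i k'
      have hlt' : (K.idx i k' : ℝ) < K.size (K.vert i k') := by exact_mod_cast hlt
      rw [← hv, K.starFst_edge hs, hmin (by linarith) (by positivity) hs.1, Nat.cast_eq_zero]
      constructor
      · rintro (h | h)
        · linarith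
        · exact h
      · exact .inr
    · have hlt := K.idx_lt i (k + 1)
      have hlt' : (K.idx i (k + 1) : ℝ) + 1 ≤ K.size (K.vert i (k + 1)) := by exact_mod_cast hlt
      rw [← hv, K.starFst_edge' hs, hmin (by linarith) (by positivity) (by linarith [hs.2]),
        idx_eq_zero_iff]
      constructor
      · rintro (h | h)
        · have : (K.idx i (k + 1) : ℝ) + 1 = K.size (K.vert i (k + 1)) := by linarith
          exact_mod_cast this
        · have : (0 : ℝ) ≤ K.idx i (k + 1) := by positivity
          linarith
      · intro h
        left
        rw [← h]; push_cast; ring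

theorem edge_mem_boundary {i : K.I} {k : Fin 4} (h : K.idx i k = 0) {s : ℝ}
    (hs : s ∈ Icc (0 : ℝ) 1) : K.edge i k s ∈ halfPlaneModel.boundary K.Space := by
  rcases hs.1.eq_or_lt with rfl | h0
  · rw [edge_zero]; exact K.node_mem_boundary _
  rcases hs.2.eq_or_lt with rfl | h1
  · rw [edge_one]; exact K.node_mem_boundary _
  rw [mem_boundary_iff, (K.chart_edge ⟨h0, h1⟩).1]; exact h

theorem edge_mem_interior {i : K.I} {k : Fin 4} (h : K.idx i k ≠ 0) {s : ℝ}
    (hs : s ∈ Ioo (0 : ℝ) 1) : K.edge i k s ∈ halfPlaneModel.interior K.Space := by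
  rw [mem_interior_iff]
  exact lt_of_le_of_ne (K.chart_edge hs).2 (Ne.symm (mt (K.chart_edge hs).1.1 h))

theorem exists_edge_of_bump_eq_zero {p : ℝ × ℝ} (h : bump p = 0) :
    ∃ k, ∃ s ∈ Ico (0 : ℝ) 1, p = pt k (1 - s) s := by
  obtain ⟨k, h0, h1⟩ := exists_quadrant p
  have hb := h
  rw [bump_eq k, abs_of_nonneg h0, abs_of_nonneg h1] at hb
  rcases h0.lt_or_eq with h0' | h0'
  · refine ⟨k, ht (k + 1) p, ⟨h1, by linarith⟩, ?_⟩
    rw [show 1 - ht (k + 1) p = ht k p by linarith, pt_ht]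
  · refine ⟨k + 1, 0, ⟨le_rfl, zero_lt_one⟩, ?_⟩
    apply ext_ht (k := k + 1)
    · rw [ht_pt]; linarith
    · rw [ht_add_one_pt, ht_add_one_add_one]; linarith

theorem exists_edge_of_mem_boundary {x : K.Space} (hx : x ∈ halfPlaneModel.boundary K.Space) :
    ∃ i k, K.idx i k = 0 ∧ ∃ s ∈ Ico (0 : ℝ) 1, K.edge i k s = x := by
  obtain ⟨i, p, hp, rfl⟩ := K.exists_map_eq x
  have hb : bump p = 0 := by
    by_contra hne
    have h1 := K.mem_interior_iff.1
      (K.mem_interior_of_bump (i := i) (lt_of_le_of_ne (bump_nonneg.2 hp) (Ne.symm hne)))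
    rw [K.mem_boundary_iff.1 hx] at h1
    exact lt_irrefl _ h1
  obtain ⟨k, s, hs, rfl⟩ := exists_edge_of_bump_eq_zero hb
  rcases hs.1.eq_or_lt with rfl | h0
  -- A vertex found on an arbitrary edge is moved to the start of the first edge of its fan, which
  -- is a boundary edge.
  · obtain ⟨i', k', hv, h0⟩ := K.exists_vert_eq (K.vert i k)
    refine ⟨i', k', h0, 0, ⟨le_rfl, one_pos⟩, ?_⟩
    rw [edge_zero, hv, ← edge_zero]; rfl
  · refine ⟨i, k, ?_, s, hs, rfl⟩
    rw [← (K.chart_edge ⟨h0, hs.2⟩).1]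
    exact K.mem_boundary_iff.1 hx

theorem edge_ne_node {i : K.I} {k : Fin 4} {s : ℝ} (hs : s ∈ Ioo (0 : ℝ) 1) (v : K.N) :
    K.edge i k s ≠ K.node v := by
  intro h
  obtain ⟨i', k', rfl, _⟩ := K.exists_vert_eq v
  rw [← map_corner, edge, eq_comm,
    K.map_eq_iff corner_mem_sq (edge_mem_sq ⟨hs.1.le, hs.2.le⟩)] at h
  obtain ⟨h0, h1⟩ := hs
  rcases K.glued_quarter (by linarith) h0.le (by linarith) h1 h with ⟨_, hp⟩ | ⟨k₂, _, _, hp⟩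
  · have := (pt_inj_of_pos (by linarith) h0 zero_le_one le_rfl hp).2.1
    linarith
  · have := (pt_inj_of_pos h0 (by linarith) zero_le_one le_rfl hp).2.1
    linarith

end SquareComplex

/-! ### Signed vertices and the occupied surface -/

namespace SquareComplex
variable (K : SquareComplex)

theorem isPreconnected_sq : IsPreconnected sq := by
  have hstar : StarConvex ℝ (0 : ℝ × ℝ) sq := by
    rw [starConvex_zero_iff]
    intro y hy a ha ha'
    rw [← bump_nonneg, bump] at hy ⊢
    simp only [Prod.smul_fst, Prod.smul_snd, smul_eq_mul, abs_mul, abs_of_nonneg ha]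
    nlinarith [abs_nonneg y.1, abs_nonneg y.2]
  exact (hstar.isPathConnected zero_mem_sq).isConnected.isPreconnected

/-- A choice of signed vertices: the corners of each square are alternately positive and negative,
except for some unglued squares, of which only the corners `0` and `1` are vertices. -/
structure Marking where
  pos : Set K.N
  neg : Set K.N
  vac : Set K.I
  disjoint : Disjoint pos neg
  vert_mem : ∀ i ∉ vac, K.vert i 0 ∈ pos ∧ K.vert i 1 ∈ neg ∧ K.vert i 2 ∈ pos ∧ K.vert i 3 ∈ neg
  vac_vert : ∀ i ∈ vac, K.vert i 0 ∈ pos ∧ K.vert i 1 ∈ neg ∧ K.vert i 2 ∉ pos ∪ neg ∧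
    K.vert i 3 ∉ pos ∪ neg
  vac_size : ∀ i ∈ vac, ∀ k, K.size (K.vert i k) = 1

namespace Marking
variable {K} (M : K.Marking)

theorem vac_idx {i : K.I} (hi : i ∈ M.vac) (k : Fin 4) : K.idx i k = 0 := by
  have := K.idx_lt i k
  rw [M.vac_size i hi k] at this
  omega

/-- The positive vertices. -/
def posSet : Set K.Space := K.node '' M.pos

/-- The negative vertices. -/
def negSet : Set K.Space := K.node '' M.neg

theorem node_mem_posSet {v : K.N} : K.node v ∈ M.posSet ↔ v ∈ M.pos :=
  K.node_injective.mem_set_image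

theorem node_mem_negSet {v : K.N} : K.node v ∈ M.negSet ↔ v ∈ M.neg :=
  K.node_injective.mem_set_image

theorem edge_notMem {i : K.I} {k : Fin 4} {s : ℝ} (hs : s ∈ Ioo (0 : ℝ) 1) :
    K.edge i k s ∉ M.posSet ∪ M.negSet := by
  rintro (⟨v, _, h⟩ | ⟨v, _, h⟩) <;> exact K.edge_ne_node hs v h.symm

theorem edge_mem_diff {i : K.I} {k : Fin 4} (h : K.idx i k = 0) {s : ℝ} (hs : s ∈ Ioo (0 : ℝ) 1) :
    K.edge i k s ∈ halfPlaneModel.boundary K.Space \ (M.posSet ∪ M.negSet) :=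
  ⟨K.edge_mem_boundary h ⟨hs.1.le, hs.2.le⟩, M.edge_notMem hs⟩

theorem edge_zero_mem_closure (i : K.I) (k : Fin 4) :
    K.node (K.vert i k) ∈ closure (K.edge i k '' Ioo 0 1) := by
  rw [← K.edge_zero]
  refine ((K.continuousOn_edge i k 0 (by simp)).mono Ioo_subset_Icc_self).mem_closure_image ?_
  rw [closure_Ioo zero_ne_one]; simp

theorem edge_one_mem_closure (i : K.I) (k : Fin 4) :
    K.node (K.vert i (k + 1)) ∈ closure (K.edge i k '' Ioo 0 1) := by
  rw [← K.edge_one]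
  refine ((K.continuousOn_edge i k 1 (by simp)).mono Ioo_subset_Icc_self).mem_closure_image ?_
  rw [closure_Ioo zero_ne_one]; simp

theorem isPreconnected_edge (i : K.I) (k : Fin 4) {s : Set ℝ} (hs : OrdConnected s)
    (hs' : s ⊆ Icc 0 1) : IsPreconnected (K.edge i k '' s) :=
  hs.isPreconnected.image _ ((K.continuousOn_edge i k).mono hs')

theorem boundary_nonempty (x : K.Space) :
    (connectedComponent x ∩ halfPlaneModel.boundary K.Space).Nonempty := by
  obtain ⟨i, p, hp, rfl⟩ := K.exists_map_eq x
  have hc : IsPreconnected (K.map i '' sq) :=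
    isPreconnected_sq.image _ (K.continuousOn_map i)
  refine ⟨K.node (K.vert i 0), hc.subset_connectedComponent ⟨p, hp, rfl⟩ ?_, K.node_mem_boundary _⟩
  exact ⟨pt 0 1 0, corner_mem_sq, K.map_corner i 0⟩

theorem vertices_nonempty {x : K.Space} (hx : x ∈ halfPlaneModel.boundary K.Space) :
    (connectedComponentIn (halfPlaneModel.boundary K.Space) x ∩
      (M.posSet ∪ M.negSet)).Nonempty := by
  obtain ⟨i, k, h0, s, hs, rfl⟩ := K.exists_edge_of_mem_boundary hx
  have hsub : ∀ k, K.idx i k = 0 → K.edge i k '' Icc 0 1 ⊆ halfPlaneModel.boundary K.Space := by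
    rintro k hk _ ⟨s, hs, rfl⟩
    exact K.edge_mem_boundary hk hs
  have hmem : K.edge i k s ∈ K.edge i k '' Icc 0 1 := ⟨s, ⟨hs.1, hs.2.le⟩, rfl⟩
  have hcc := (isPreconnected_edge i k ordConnected_Icc subset_rfl).subset_connectedComponentIn
    hmem (hsub k h0)
  have hz : K.node (K.vert i k) ∈ K.edge i k '' Icc 0 1 := ⟨0, by simp, K.edge_zero i k⟩
  have ho : K.node (K.vert i (k + 1)) ∈ K.edge i k '' Icc 0 1 := ⟨1, by simp, K.edge_one i k⟩
  have hP : ∀ v, v ∈ M.pos → K.node v ∈ M.posSet ∪ M.negSet := fun v hv =>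
    .inl (M.node_mem_posSet.2 hv)
  have hN : ∀ v, v ∈ M.neg → K.node v ∈ M.posSet ∪ M.negSet := fun v hv =>
    .inr (M.node_mem_negSet.2 hv)
  by_cases hi : i ∈ M.vac
  · obtain ⟨v0, v1, _, _⟩ := M.vac_vert i hi
    match k with
    | 0 => exact ⟨_, hcc hz, hP _ v0⟩
    | 1 => exact ⟨_, hcc hz, hN _ v1⟩
    | 3 => exact ⟨_, hcc ho, hP _ v0⟩
    -- Edge 2 of an unglued square has no marked end; continuing along edge 3 one reaches the
    -- positive corner 0.
    | 2 =>
      have hu : IsPreconnected (K.edge i 2 '' Icc 0 1 ∪ K.edge i 3 '' Icc 0 1) :=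
        (isPreconnected_edge i 2 ordConnected_Icc subset_rfl).union (K.node (K.vert i 3)) ho
          ⟨0, by simp, K.edge_zero i 3⟩ (isPreconnected_edge i 3 ordConnected_Icc subset_rfl)
      refine ⟨K.node (K.vert i 0), hu.subset_connectedComponentIn (.inl hmem)
        (union_subset (hsub 2 h0) (hsub 3 (M.vac_idx hi 3))) (.inr ⟨1, by simp, K.edge_one i 3⟩),
        hP _ v0⟩
  · obtain ⟨v0, v1, v2, v3⟩ := M.vert_mem i hi
    refine ⟨_, hcc hz, ?_⟩
    match k with
    | 0 => exact hP _ v0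
    | 1 => exact hN _ v1
    | 2 => exact hP _ v2
    | 3 => exact hN _ v3

theorem alternating {x : K.Space}
    (hx : x ∈ halfPlaneModel.boundary K.Space \ (M.posSet ∪ M.negSet)) :
    (closure (connectedComponentIn (halfPlaneModel.boundary K.Space \ (M.posSet ∪ M.negSet)) x) ∩
      M.posSet).Nonempty ∧
    (closure (connectedComponentIn (halfPlaneModel.boundary K.Space \ (M.posSet ∪ M.negSet)) x) ∩
      M.negSet).Nonempty := by
  obtain ⟨i, k, h0, s, hs, rfl⟩ := K.exists_edge_of_mem_boundary hx.1
  have hsub : ∀ k, K.idx i k = 0 → K.edge i k '' Ioo 0 1 ⊆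
      halfPlaneModel.boundary K.Space \ (M.posSet ∪ M.negSet) := by
    rintro k hk _ ⟨s, hs, rfl⟩
    exact M.edge_mem_diff hk hs
  have hopen : s ∈ Ioo (0 : ℝ) 1 → ∀ v, (v = K.vert i k ∨ v = K.vert i (k + 1)) →
      K.node v ∈ closure (connectedComponentIn
        (halfPlaneModel.boundary K.Space \ (M.posSet ∪ M.negSet)) (K.edge i k s)) := by
    intro hs v hv
    have hcc := (isPreconnected_edge i k ordConnected_Ioo
      Ioo_subset_Icc_self).subset_connectedComponentIn ⟨s, hs, rfl⟩ (hsub k h0)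
    rcases hv with rfl | rfl
    · exact closure_mono hcc (edge_zero_mem_closure i k)
    · exact closure_mono hcc (edge_one_mem_closure i k)
  have hP : ∀ v, v ∈ M.pos → K.node v ∈ M.posSet := fun v hv => M.node_mem_posSet.2 hv
  have hN : ∀ v, v ∈ M.neg → K.node v ∈ M.negSet := fun v hv => M.node_mem_negSet.2 hv
  have hs' : (K.vert i k ∈ M.pos ∪ M.neg) → s ∈ Ioo (0 : ℝ) 1 := by
    intro hv
    refine ⟨lt_of_le_of_ne hs.1 ?_, hs.2⟩
    rintro rfl
    apply hx.2
    rw [K.edge_zero]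
    exact hv.imp (hP _) (hN _)
  by_cases hi : i ∈ M.vac
  · obtain ⟨v0, v1, v2, v3⟩ := M.vac_vert i hi
    by_cases hk0 : k = 0
    · subst hk0
      have := hs' (.inl v0)
      exact ⟨⟨_, hopen this _ (.inl rfl), hP _ v0⟩, ⟨_, hopen this _ (.inr rfl), hN _ v1⟩⟩
    · have i1 : Ioc (0 : ℝ) 1 ⊆ Icc 0 1 := Ioc_subset_Icc_self
      have i3 : Ico (0 : ℝ) 1 ⊆ Icc 0 1 := Ico_subset_Icc_self
      have e1 : K.node (K.vert i 2) ∈ K.edge i 1 '' Ioc 0 1 := ⟨1, by simp, K.edge_one i 1⟩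
      have e2 : K.node (K.vert i 2) ∈ K.edge i 2 '' Icc 0 1 := ⟨0, by simp, K.edge_zero i 2⟩
      have e3 : K.node (K.vert i 3) ∈ K.edge i 2 '' Icc 0 1 := ⟨1, by simp, K.edge_one i 2⟩
      have e4 : K.node (K.vert i 3) ∈ K.edge i 3 '' Ico 0 1 := ⟨0, by simp, K.edge_zero i 3⟩
      -- Two corners are unmarked, so the edges 1, 2 and 3 form a single boundary arc from the
      -- negative corner 1 to the positive corner 0, taken without its ends.
      have hu : IsPreconnected
          (K.edge i 1 '' Ioc 0 1 ∪ K.edge i 2 '' Icc 0 1 ∪ K.edge i 3 '' Ico 0 1) :=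
        ((isPreconnected_edge i 1 ordConnected_Ioc i1).union _ e1 e2
          (isPreconnected_edge i 2 ordConnected_Icc subset_rfl)).union _ (.inr e3) e4
          (isPreconnected_edge i 3 ordConnected_Ico i3)
      have hnode : ∀ v, v ∉ M.pos ∪ M.neg → K.node v ∈
          halfPlaneModel.boundary K.Space \ (M.posSet ∪ M.negSet) := fun v hv =>
        ⟨K.node_mem_boundary v, fun h => hv (h.imp M.node_mem_posSet.1 M.node_mem_negSet.1)⟩
      have husub : K.edge i 1 '' Ioc 0 1 ∪ K.edge i 2 '' Icc 0 1 ∪ K.edge i 3 '' Ico 0 1 ⊆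
          halfPlaneModel.boundary K.Space \ (M.posSet ∪ M.negSet) := by
        rintro _ ((⟨t, ht, rfl⟩ | ⟨t, ht, rfl⟩) | ⟨t, ht, rfl⟩)
        · rcases ht.2.eq_or_lt with rfl | h
          · rw [K.edge_one]; exact hnode _ v2
          · exact M.edge_mem_diff (M.vac_idx hi 1) ⟨ht.1, h⟩
        · rcases ht.1.eq_or_lt with rfl | h'
          · rw [K.edge_zero]; exact hnode _ v2
          rcases ht.2.eq_or_lt with rfl | h
          · rw [K.edge_one]; exact hnode _ v3
          · exact M.edge_mem_diff (M.vac_idx hi 2) ⟨h', h⟩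
        · rcases ht.1.eq_or_lt with rfl | h'
          · rw [K.edge_zero]; exact hnode _ v3
          · exact M.edge_mem_diff (M.vac_idx hi 3) ⟨h', ht.2⟩
      have hmem : K.edge i k s ∈
          K.edge i 1 '' Ioc 0 1 ∪ K.edge i 2 '' Icc 0 1 ∪ K.edge i 3 '' Ico 0 1 := by
        match k with
        | 0 => exact (hk0 rfl).elim
        | 1 => exact .inl (.inl ⟨s, ⟨(hs' (.inr v1)).1, hs.2.le⟩, rfl⟩)
        | 2 => exact .inl (.inr ⟨s, ⟨hs.1, hs.2.le⟩, rfl⟩)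
        | 3 => exact .inr ⟨s, hs, rfl⟩
      have hcc := hu.subset_connectedComponentIn hmem husub
      refine ⟨⟨_, closure_mono hcc ?_, hP _ v0⟩, ⟨_, closure_mono hcc ?_, hN _ v1⟩⟩
      · exact closure_mono ((image_mono Ioo_subset_Ico_self).trans subset_union_right)
          (edge_one_mem_closure i 3)
      · exact closure_mono (((image_mono Ioo_subset_Ioc_self).trans subset_union_left).trans
          subset_union_left) (edge_zero_mem_closure i 1)
  · obtain ⟨v0, v1, v2, v3⟩ := M.vert_mem i hi
    match k with
    | 0 =>
      have := hs' (.inl v0)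
      exact ⟨⟨_, hopen this _ (.inl rfl), hP _ v0⟩, ⟨_, hopen this _ (.inr rfl), hN _ v1⟩⟩
    | 1 =>
      have := hs' (.inr v1)
      exact ⟨⟨_, hopen this _ (.inr rfl), hP _ v2⟩, ⟨_, hopen this _ (.inl rfl), hN _ v1⟩⟩
    | 2 =>
      have := hs' (.inl v2)
      exact ⟨⟨_, hopen this _ (.inl rfl), hP _ v2⟩, ⟨_, hopen this _ (.inr rfl), hN _ v3⟩⟩
    | 3 =>
      have := hs' (.inr v3)
      exact ⟨⟨_, hopen this _ (.inr rfl), hP _ v0⟩, ⟨_, hopen this _ (.inl rfl), hN _ v3⟩⟩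

/-- The occupied surface obtained by realizing a marked square complex. -/
def surface : OccupiedSurface K.Space where
  t2 := inferInstance
  compact := inferInstance
  oriented := K.oriented
  pos := M.posSet
  neg := M.negSet
  pos_finite := by
    have := K.finite_N
    exact (Set.toFinite _).image _
  neg_finite := by
    have := K.finite_N
    exact (Set.toFinite _).image _
  disjoint := (disjoint_image_iff K.node_injective).2 M.disjoint
  vertices_subset := by
    rintro _ (⟨v, _, rfl⟩ | ⟨v, _, rfl⟩) <;> exact K.node_mem_boundary v
  boundary_nonempty := boundary_nonempty
  vertices_nonempty _ hx := M.vertices_nonempty hx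
  alternating _ hx := M.alternating hx

end Marking

end SquareComplex

/-! ### Components with glued squares are not vacuums -/

namespace SquareComplex
variable (K : SquareComplex)

/-- Continuous functions on the squares that respect the gluing descend to the realization. -/
theorem exists_descend {Y : Type*} [TopologicalSpace Y] (φ : K.I → ℝ × ℝ → Y)
    (hφ : ∀ i, ContinuousOn (φ i) sq)
    (hg : ∀ i i' p p', K.Glued i p i' p' → φ i p = φ i' p') :
    ∃ Φ : K.Space → Y, Continuous Φ ∧ ∀ i, ∀ p ∈ sq, Φ (K.map i p) = φ i p := by
  have := K.finite_I
  have := isCompact_iff_compactSpace.1 isCompact_sq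
  let π : (Σ _ : K.I, sq) → K.Space := fun e => K.map e.1 e.2.1
  have hπ : Continuous π := continuous_sigma fun i => (K.continuousOn_map i).domRestrict
  have hs : Function.Surjective π := fun x => by
    obtain ⟨i, p, hp, h⟩ := K.exists_map_eq x
    exact ⟨⟨i, p, hp⟩, h⟩
  have hq : IsQuotientMap π := hπ.isClosedMap.isQuotientMap hπ hs
  choose σ hσ using hs
  have key : ∀ i, ∀ p ∈ sq, φ (σ (K.map i p)).1 (σ (K.map i p)).2.1 = φ i p := fun i p hp =>
    hg _ _ _ _ ((K.map_eq_iff (σ (K.map i p)).2.2 hp).1 (hσ (K.map i p)))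
  refine ⟨fun x => φ (σ x).1 (σ x).2.1, ?_, key⟩
  rw [hq.continuous_iff]
  exact continuous_sigma fun i => ((hφ i).domRestrict).congr fun p => (key i p p.2).symm

/-- The piecewise linear function on the model square with given values at the corners. -/
noncomputable def lin (f : Fin 4 → ℝ) (p : ℝ × ℝ) : ℝ := ∑ k, max (ht k p) 0 * f k

theorem continuous_lin (f : Fin 4 → ℝ) : Continuous (lin f) :=
  continuous_finsetSum _ fun k _ => ((continuous_ht k).max continuous_const).mul continuous_const

theorem lin_pt (f : Fin 4 → ℝ) {k : Fin 4} {t l : ℝ} (ht : 0 ≤ t) (hl : 0 ≤ l) :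
    lin f (pt k t l) = t * f k + l * f (k + 1) := by
  rw [lin, Fin.sum_univ_four]
  match k with
  | 0 => simp [pt, SquareComplex.ht, ht, hl]
  | 1 => simp [pt, SquareComplex.ht, ht, hl]
  | 2 => simp [pt, SquareComplex.ht, ht, hl]
  | 3 => simp [pt, SquareComplex.ht, ht, hl, add_comm]

/-- If the component of a square is a disc, then its corners with different values of an integral
cocycle are different vertices. -/
theorem vert_ne_of_disc {val : K.I → Fin 4 → ℤ} (hval : ∀ i k i' k', K.Next i k i' k' →
    val i' k' - val i k = val i' (k' + 1) - val i (k - 1)) {x : K.Space}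
    (h : connectedComponent x ≃ₜ Metric.closedBall (0 : Plane) 1) {i : K.I} {p : ℝ × ℝ}
    (hp : p ∈ sq) (hx : K.map i p = x) {k k' : Fin 4} (hk : val i k ≠ val i k') :
    K.vert i k ≠ K.vert i k' := by
  -- Modulo integers the piecewise linear interpolation of `val` is well defined on the realization:
  -- it is integral at the corners, and across a glued edge the cocycle condition makes the two
  -- interpolations differ by one integer.
  obtain ⟨Φ, hΦ, hΦm⟩ := K.exists_descend
    (fun i p => Circle.exp (2 * Real.pi * lin (fun k => (val i k : ℝ)) p))
    (fun i => (Circle.exp.continuous.comp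
      (continuous_const.mul (continuous_lin _))).continuousOn) (by
      rintro i i' p p' (⟨rfl, rfl⟩ | ⟨k, k', hv, rfl, rfl⟩ | ⟨k, k', s, hn, h0, h1, rfl, rfl⟩)
      · rfl
      · rw [lin_pt _ zero_le_one le_rfl, lin_pt _ zero_le_one le_rfl]
        simp only [one_mul, zero_mul, add_zero, Circle.exp_two_pi_mul_int]
      · rw [show pt k (1 - s) (-s) = pt (k - 1) s (1 - s) by rw [pt_sub_one],
          lin_pt _ h0.le (by linarith), lin_pt _ (by linarith) h0.le, sub_add_cancel]
        have e := hval _ _ _ _ hn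
        have e' : (val i' k' : ℝ) - val i k = val i' (k' + 1) - val i (k - 1) := by exact_mod_cast e
        have : 2 * Real.pi * ((1 - s) * (val i' k' : ℝ) + s * val i' (k' + 1)) =
            2 * Real.pi * (s * (val i (k - 1) : ℝ) + (1 - s) * val i k) +
              2 * Real.pi * ((val i' k' - val i k : ℤ) : ℝ) := by
          push_cast
          rw [show (val i' (k' + 1) : ℝ) = val i' k' - val i k + val i (k - 1) by linarith]
          ring
        rw [this, Circle.exp_add, Circle.exp_two_pi_mul_int, mul_one])
  obtain ⟨g, hg, hgΦ⟩ := exists_circle_lift (f := fun y => Φ (h.symm y))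
    (hΦ.comp (continuous_subtype_val.comp h.symm.continuous))
  have hsub : ∀ p' ∈ sq, K.map i p' ∈ connectedComponent x := fun p' hp' =>
    (isPreconnected_sq.image _ (K.continuousOn_map i)).subset_connectedComponent ⟨p, hp, hx⟩ ⟨p', hp', rfl⟩
  have hmem : ∀ p' : sq, K.map i p' ∈ connectedComponent x := fun p' => hsub p' p'.2
  have hcont : Continuous fun p' : sq =>
      g (h ⟨K.map i p', hmem p'⟩) - 2 * Real.pi * lin (fun k => (val i k : ℝ)) p' := by
    refine (hg.comp (h.continuous.comp ?_)).sub
      (continuous_const.mul ((continuous_lin _).comp continuous_subtype_val))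
    exact (K.continuousOn_map i).domRestrict.subtype_mk _
  have hdisc : IsDiscrete (AddSubgroup.zmultiples (2 * Real.pi) : Set ℝ) :=
    isDiscrete_iff_discreteTopology.2 (inferInstanceAs
      (DiscreteTopology (AddSubgroup.zmultiples (2 * Real.pi))))
  have hmaps : ∀ p' : sq, g (h ⟨K.map i p', hmem p'⟩) -
      2 * Real.pi * lin (fun k => (val i k : ℝ)) p' ∈
        (AddSubgroup.zmultiples (2 * Real.pi) : Set ℝ) := by
    intro p'
    have e : Circle.exp (g (h ⟨K.map i p', hmem p'⟩) -
        2 * Real.pi * lin (fun k => (val i k : ℝ)) p') = 1 := by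
      rw [Circle.exp_sub, hgΦ, h.symm_apply_apply, hΦm i p' p'.2, div_self']
    obtain ⟨n, hn⟩ := Circle.exp_eq_one.1 e
    rw [hn]
    exact ⟨n, by simp⟩
  have : PreconnectedSpace sq := Subtype.preconnectedSpace isPreconnected_sq
  -- On the connected square, the lift and `2π` times the interpolation differ by an element of the
  -- discrete group `2πℤ`, hence by a constant. At corners with the same image the lift agrees, so
  -- the values of `val` do as well.
  have hconst := isPreconnected_univ.constant_of_mapsTo hdisc hcont.continuousOn
    (fun p' _ => hmaps p') (mem_univ (⟨pt k 1 0, corner_mem_sq⟩ : sq))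
    (mem_univ (⟨pt k' 1 0, corner_mem_sq⟩ : sq))
  intro heq
  have hpt : K.map i (pt k 1 0) = K.map i (pt k' 1 0) := by rw [map_corner, map_corner, heq]
  simp only [hpt, lin_pt _ zero_le_one le_rfl, one_mul, zero_mul, add_zero] at hconst
  apply hk
  have : 2 * Real.pi * ((val i k : ℝ) - val i k') = 0 := by linarith
  have h2 := (mul_eq_zero.1 this).resolve_left (by positivity)
  exact_mod_cast sub_eq_zero.1 h2

namespace Marking
variable {K}

theorem notMem_vac_of_next (M : K.Marking) {i i' : K.I} {k k' : Fin 4} (h : K.Next i k i' k') :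
    i ∉ M.vac ∧ i' ∉ M.vac := by
  have h1 := K.idx_lt i' k'
  have h2 := h.2
  constructor
  · intro hi
    have := M.vac_size i hi k
    rw [h.1] at this
    omega
  · intro hi
    have := M.vac_size i' hi k'
    omega

/-- Even corners are positive and odd corners negative, and a vertex has only one sign. -/
theorem even_of_next (M : K.Marking) {i i' : K.I} {k k' : Fin 4} (h : K.Next i k i' k') :
    (k = 0 ∨ k = 2) ↔ (k' = 0 ∨ k' = 2) := by
  obtain ⟨hi, hi'⟩ := M.notMem_vac_of_next h
  obtain ⟨h0, h1, h2, h3⟩ := M.vert_mem i hi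
  obtain ⟨h0', h1', h2', h3'⟩ := M.vert_mem i' hi'
  have hd : ∀ v, v ∈ M.pos → v ∉ M.neg := fun v hv => Set.disjoint_left.1 M.disjoint hv
  have hv := h.1
  fin_cases k <;> fin_cases k' <;> simp at hv ⊢
  · exact hd _ h0 (hv ▸ h1')
  · exact hd _ h0 (hv ▸ h3')
  · exact hd _ h0' (hv ▸ h1)
  · exact hd _ h2' (hv ▸ h1)
  · exact hd _ h2 (hv ▸ h1')
  · exact hd _ h2 (hv ▸ h3')
  · exact hd _ h0' (hv ▸ h3)
  · exact hd _ h2' (hv ▸ h3)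

/-- The sign of a negative corner: whether one turns from corner `2` to corner `0` or back. -/
def turn (k : Fin 4) : ℤ := ![0, 1, 0, -1] k

/-- The sum of the signs of the corners at a vertex that precede a given corner. -/
noncomputable def turnSum (v : K.N) (j : ℕ) : ℤ := ∑ m ∈ Finset.range j, turn (K.corner v m).2

/-- An integral cocycle that separates the positive corners of each square. -/
noncomputable def height (i : K.I) : Fin 4 → ℤ :=
  ![0, turnSum (K.vert i 1) (K.idx i 1) + 1, 1, turnSum (K.vert i 3) (K.idx i 3)]

theorem turnSum_next {i i' : K.I} {k k' : Fin 4} (h : K.Next i k i' k') :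
    turnSum (K.vert i' k') (K.idx i' k') = turnSum (K.vert i k) (K.idx i k) + turn k := by
  rw [h.2, ← h.1, turnSum, Finset.sum_range_succ, K.corner_vert_idx]; rfl

/-- At an odd corner, `height` minus its value at the following corner is the sum of the turns
before this corner, and minus its value at the preceding corner it is the sum including this corner.
These match for successive corners. Since the fan is linear, no condition of closing up arises. -/
theorem height_next_odd {i i' : K.I} {k k' : Fin 4} (h : K.Next i k i' k') (hk : k = 1 ∨ k = 3)
    (hk' : k' = 1 ∨ k' = 3) :
    height i' k' - height i k = height i' (k' + 1) - height i (k - 1) := by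
  have e := turnSum_next h
  rcases hk with rfl | rfl <;> rcases hk' with rfl | rfl <;>
    simp [height, turn] at e ⊢ <;> linarith

/-- A glued edge has an odd corner at one of its ends, so the case of even corners is the odd case
read from the other end. -/
theorem height_next (M : K.Marking) {i i' : K.I} {k k' : Fin 4} (h : K.Next i k i' k') :
    height i' k' - height i k = height i' (k' + 1) - height i (k - 1) := by
  have he := M.even_of_next h
  by_cases hk : k = 1 ∨ k = 3
  · refine height_next_odd h hk ?_
    revert he hk; clear h; revert k k'; decide
  · have h' := height_next_odd h.glue (by revert he hk; clear h; revert k k'; decide)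
      (by revert he hk; clear h; revert k k'; decide)
    rw [add_sub_cancel_right, sub_add_cancel] at h'
    linarith

/-- If the component were a disc, the two positive corners of the square would be different
vertices, but a vacuum has only one positive vertex. -/
theorem not_isVacuumAt (M : K.Marking) {i : K.I} (hi : i ∉ M.vac) {p : ℝ × ℝ} (hp : p ∈ sq) :
    ¬ M.surface.IsVacuumAt (K.map i p) := by
  rintro ⟨⟨h⟩, a, ha, b, hb, hab⟩
  have hne := K.vert_ne_of_disc (fun _ _ _ _ hn => M.height_next hn) h hp rfl
    (k := 0) (k' := 2) (by simp [height])
  have hsub : ∀ k, K.node (K.vert i k) ∈ connectedComponent (K.map i p) := fun k => by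
    rw [← K.map_corner]
    exact (isPreconnected_sq.image _ (K.continuousOn_map i)).subset_connectedComponent ⟨p, hp, rfl⟩
      ⟨_, corner_mem_sq, rfl⟩
  have hpos : ∀ v ∈ M.pos, K.node v ∈ connectedComponent (K.map i p) → K.node v = a := by
    intro v hv hvc
    have : K.node v ∈ ({a, b} : Set K.Space) := by
      rw [← hab]; exact ⟨hvc, .inl (M.node_mem_posSet.2 hv)⟩
    rcases this with h | h
    · exact h
    · rw [h] at hvc
      exact (Set.disjoint_left.1 M.surface.disjoint (M.node_mem_posSet.2 hv) (h ▸ hb)).elim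
  obtain ⟨h0, _, h2, _⟩ := M.vert_mem i hi
  exact hne (K.node_injective ((hpos _ h0 (hsub 0)).trans (hpos _ h2 (hsub 2)).symm))

end Marking
end SquareComplex

/-! ### The quadrangulation of the realization -/

theorem convex_modelSquare : Convex ℝ modelSquare := by
  intro x hx y hy a b ha hb hab
  simp only [modelSquare, mem_ofPred_eq] at *
  simp only [PiLp.add_apply, PiLp.smul_apply, smul_eq_mul]
  have h0 := abs_add_le (a * x 0) (b * y 0)
  have h1 := abs_add_le (a * x 1) (b * y 1)
  rw [abs_mul, abs_mul, abs_of_nonneg ha, abs_of_nonneg hb] at h0 h1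
  nlinarith

theorem isOpen_openModelSquare : IsOpen openModelSquare :=
  isOpen_lt ((PiLp.continuous_apply 2 _ 0).abs.add (PiLp.continuous_apply 2 _ 1).abs)
    continuous_const

theorem isClosed_modelSquare : IsClosed modelSquare :=
  isClosed_le ((PiLp.continuous_apply 2 _ 0).abs.add (PiLp.continuous_apply 2 _ 1).abs)
    continuous_const

theorem isBounded_modelSquare : Bornology.IsBounded modelSquare := by
  refine (Metric.isBounded_closedBall (x := (0 : Plane)) (r := 1)).subset fun z hz => ?_
  rw [mem_closedBall_zero_iff, EuclideanSpace.norm_eq, Fin.sum_univ_two, Real.sqrt_le_iff]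
  simp only [modelSquare, mem_ofPred_eq] at hz
  simp only [Real.norm_eq_abs]
  refine ⟨zero_le_one, ?_⟩
  nlinarith [abs_nonneg (z 0), abs_nonneg (z 1)]

theorem nonempty_modelSquare_homeomorph :
    Nonempty (modelSquare ≃ₜ Metric.closedBall (0 : Plane) 1) := by
  have hne : (interior modelSquare).Nonempty :=
    ⟨0, interior_maximal openModelSquare_subset isOpen_openModelSquare (by simp [openModelSquare])⟩
  obtain ⟨h, _, h1, _⟩ := exists_homeomorph_image_interior_closure_frontier_eq_unitBall
    convex_modelSquare hne isBounded_modelSquare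
  rw [isClosed_modelSquare.closure_eq] at h1
  exact ⟨(h.image modelSquare).trans (Homeomorph.setCongr h1)⟩

namespace SquareComplex

/-- The coordinates of a point of the plane. -/
def coords (z : Plane) : ℝ × ℝ := (z 0, z 1)

theorem continuous_coords : Continuous coords :=
  (PiLp.continuous_apply 2 _ 0).prodMk (PiLp.continuous_apply 2 _ 1)

theorem coords_injective : Function.Injective coords := fun _ _ h =>
  Plane.ext' (congrArg Prod.fst h) (congrArg Prod.snd h)

theorem coords_mem_sq {z : Plane} : coords z ∈ sq ↔ z ∈ modelSquare := Iff.rfl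

theorem bump_coords_pos {z : Plane} : 0 < bump (coords z) ↔ z ∈ openModelSquare := by
  simp only [bump, coords, openModelSquare, mem_ofPred_eq]
  constructor <;> intro h <;> linarith

theorem exists_coords_eq (p : ℝ × ℝ) : ∃ z, coords z = p := ⟨!₂[p.1, p.2], rfl⟩

theorem coords_squareCorner (k : Fin 4) : coords (squareCorner k) = pt k 1 0 := by
  fin_cases k <;> simp [coords, squareCorner, pt]

theorem coords_image_squareEdge (k : Fin 4) :
    coords '' squareEdge k = (fun s => pt k (1 - s) s) '' Ioo 0 1 := by
  rw [squareEdge_eq, image_image]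
  refine image_congr fun s _ => ?_
  rw [sectorPoint_apply]
  fin_cases k <;> simp [coords, pt]

variable {K : SquareComplex}

theorem edge_eq_edge_iff {i j : K.I} {k l : Fin 4} {s t : ℝ} (hs : s ∈ Ioo (0 : ℝ) 1)
    (ht : t ∈ Ioo (0 : ℝ) 1) (h : K.edge j l t = K.edge i k s) :
    (j = i ∧ l = k ∧ t = s) ∨ K.Next j (l + 1) i k := by
  rw [edge, edge, K.map_eq_iff (edge_mem_sq ⟨ht.1.le, ht.2.le⟩)
    (edge_mem_sq ⟨hs.1.le, hs.2.le⟩)] at h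
  obtain ⟨h0, h1⟩ := hs
  obtain ⟨h0', h1'⟩ := ht
  rcases K.glued_quarter (by linarith) h0.le (by linarith) h1 h with ⟨rfl, hp⟩ | ⟨k', hn, _, hp⟩
  · obtain ⟨rfl, _, rfl⟩ := pt_inj_of_pos (by linarith) h0 (by linarith) h0'.le hp
    exact .inl ⟨rfl, rfl, rfl⟩
  · obtain ⟨rfl, _, _⟩ := pt_inj_of_pos h0 (by linarith) (by linarith) h0'.le hp
    right
    rwa [sub_add_cancel]

/-- Anticlockwise parametrizations run through a glued edge in opposite directions, so the
parameters are related by `s ↦ 1 - s`. -/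
theorem Next.edge_image_eq {i j : K.I} {k l : Fin 4} (h : K.Next j (l + 1) i k) :
    K.edge j l '' Ioo 0 1 = K.edge i k '' Ioo 0 1 := by
  have key : ∀ s ∈ Ioo (0 : ℝ) 1, K.edge i k s = K.edge j l (1 - s) := by
    intro s hs
    rw [edge, ← h.map_eq hs.1.le hs.2.le, pt_add_one, neg_neg, edge, sub_sub_cancel]
  ext x
  constructor
  · rintro ⟨s, hs, rfl⟩
    have hs' : 1 - s ∈ Ioo (0 : ℝ) 1 := ⟨by linarith [hs.2], by linarith [hs.1]⟩
    exact ⟨1 - s, hs', by rw [key _ hs', sub_sub_cancel]⟩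
  · rintro ⟨s, hs, rfl⟩
    exact ⟨1 - s, ⟨by linarith [hs.2], by linarith [hs.1]⟩, (key s hs).symm⟩

theorem edge_image_eq_iff {i j : K.I} {k l : Fin 4} :
    K.edge j l '' Ioo 0 1 = K.edge i k '' Ioo 0 1 ↔ (j = i ∧ l = k) ∨ K.Next j (l + 1) i k := by
  constructor
  · intro h
    have hh : (1 / 2 : ℝ) ∈ Ioo (0 : ℝ) 1 := by norm_num
    obtain ⟨s, hs, he⟩ := h ▸ mem_image_of_mem (K.edge j l) hh
    exact (edge_eq_edge_iff hs hh he.symm).imp (fun h => ⟨h.1, h.2.1⟩) id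
  · rintro (⟨rfl, rfl⟩ | h)
    · rfl
    · exact h.edge_image_eq

theorem not_next_self (i : K.I) (k : Fin 4) : ¬ K.Next i (k + 1) i k := fun h =>
  K.vert_add_one_ne i k h.1

theorem edge_injOn (i : K.I) (k : Fin 4) : InjOn (K.edge i k) (Ioo 0 1) := by
  intro s hs t ht h
  rcases edge_eq_edge_iff ht hs h with h | h
  · exact h.2.2
  · exact (not_next_self i k h).elim

theorem map_eq_map_of_bump {i j : K.I} {p p' : ℝ × ℝ} (hp : 0 < bump p) (hp' : p' ∈ sq)
    (h : K.map i p = K.map j p') : i = j ∧ p = p' := by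
  have h1 : 0 < K.bumpAt i (K.map j p') := by
    rw [← h, K.bumpAt_map (bump_nonneg.1 hp.le)]; exact hp
  rw [K.map_eq_iff (bump_nonneg.1 hp.le) hp'] at h
  rcases h with h | ⟨k, k', _, rfl, _⟩ | ⟨k, k', s, _, h0, h1, rfl, _⟩
  · exact h
  · have := bump_edge (k := k) le_rfl zero_le_one
    rw [sub_zero] at this
    exact (hp.ne' this).elim
  · exact (hp.ne' (bump_edge' h0.le h1.le)).elim

namespace Marking
variable (M : K.Marking)

/-- All fans at the corners of such a square have a single element, so nothing is glued to it. -/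
theorem eq_of_map_eq_of_mem_vac {i j : K.I} (hi : i ∈ M.vac) {p p' : ℝ × ℝ} (hp : p ∈ sq)
    (hp' : p' ∈ sq) (h : K.map i p = K.map j p') : i = j ∧ p = p' := by
  rw [K.map_eq_iff hp hp'] at h
  rcases h with h | ⟨k, k', hv, rfl, rfl⟩ | ⟨k, k', s, hn, _⟩
  · exact h
  · have h1 := K.idx_lt j k'
    rw [← hv, M.vac_size i hi k] at h1
    obtain ⟨rfl, rfl⟩ := K.corner_inj hv (by rw [M.vac_idx hi]; omega)
    exact ⟨rfl, rfl⟩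
  · exact ((M.notMem_vac_of_next hn).1 hi).elim

/-- The square is closed and disjoint from the finite union of the other closed squares, so it is
open and closed. -/
theorem connectedComponent_of_mem_vac {i : K.I} (hi : i ∈ M.vac) {p : ℝ × ℝ} (hp : p ∈ sq) :
    connectedComponent (K.map i p) = K.map i '' sq := by
  have := K.finite_I
  have hcl : ∀ j, IsClosed (K.map j '' sq) := fun j =>
    (isCompact_sq.image_of_continuousOn (K.continuousOn_map j)).isClosed
  have hcompl : (K.map i '' sq)ᶜ = ⋃ j : {j // j ≠ i}, K.map j '' sq := by
    ext x
    simp only [mem_compl_iff, mem_iUnion]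
    constructor
    · intro hx
      obtain ⟨j, p, hp, rfl⟩ := K.exists_map_eq x
      refine ⟨⟨j, ?_⟩, p, hp, rfl⟩
      rintro rfl
      exact hx ⟨p, hp, rfl⟩
    · rintro ⟨⟨j, hj⟩, p, hp, rfl⟩ ⟨p', hp', h⟩
      exact hj (M.eq_of_map_eq_of_mem_vac hi hp' hp h).1.symm
  refine Subset.antisymm (IsClopen.connectedComponent_subset ⟨hcl i, ?_⟩ ⟨p, hp, rfl⟩)
    ((isPreconnected_sq.image _ (K.continuousOn_map i)).subset_connectedComponent ⟨p, hp, rfl⟩)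
  rw [← isClosed_compl_iff, hcompl]
  exact isClosed_iUnion_of_finite fun j => hcl _

theorem isVacuumAt {i : K.I} (hi : i ∈ M.vac) {p : ℝ × ℝ} (hp : p ∈ sq) :
    M.surface.IsVacuumAt (K.map i p) := by
  have hcomp := M.connectedComponent_of_mem_vac hi hp
  obtain ⟨v0, v1, v2, v3⟩ := M.vac_vert i hi
  refine ⟨?_, K.node (K.vert i 0), M.node_mem_posSet.2 v0, K.node (K.vert i 1),
    M.node_mem_negSet.2 v1, ?_⟩
  · rw [hcomp]
    obtain ⟨h⟩ := nonempty_modelSquare_homeomorph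
    have : CompactSpace modelSquare := isCompact_iff_compactSpace.1
      (Metric.isCompact_of_isClosed_isBounded isClosed_modelSquare isBounded_modelSquare)
    let f : modelSquare → K.map i '' sq := fun z => ⟨K.map i (coords z), coords z, z.2, rfl⟩
    have hf : Continuous f :=
      ((K.continuousOn_map i).comp_continuous (continuous_coords.comp continuous_subtype_val)
        fun z => z.2).subtype_mk _
    have hb : Function.Bijective f := by
      constructor
      · intro z w hzw
        exact Subtype.ext (coords_injective
          (M.eq_of_map_eq_of_mem_vac hi z.2 w.2 (congrArg Subtype.val hzw)).2)
      · rintro ⟨_, p', hp', rfl⟩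
        obtain ⟨z, rfl⟩ := exists_coords_eq p'
        exact ⟨⟨z, hp'⟩, rfl⟩
    have hf' : Continuous (Equiv.ofBijective f hb) := hf
    exact ⟨hf'.homeoOfEquivCompactToT2.symm.trans h⟩
  · rw [hcomp]
    have hno : ∀ v ∈ M.pos ∪ M.neg, K.node v ∈ K.map i '' sq →
        K.node v ∈ ({K.node (K.vert i 0), K.node (K.vert i 1)} : Set K.Space) := by
      rintro v hv ⟨p', hp', he⟩
      have ht : 0 < K.tau v (K.map i p') := by rw [he, K.tau_node]; exact one_pos
      obtain ⟨k, rfl, _⟩ := (tau_map_pos_iff hp').1 ht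
      match k with
      | 0 => exact .inl rfl
      | 1 => exact .inr rfl
      | 2 => exact (v2 hv).elim
      | 3 => exact (v3 hv).elim
    ext x
    constructor
    · rintro ⟨hx, ⟨v, hv, rfl⟩ | ⟨v, hv, rfl⟩⟩
      · exact hno v (.inl hv) hx
      · exact hno v (.inr hv) hx
    · have hm : ∀ k, K.node (K.vert i k) ∈ K.map i '' sq := fun k =>
        ⟨_, corner_mem_sq, K.map_corner i k⟩
      rintro (rfl | rfl)
      · exact ⟨hm 0, .inl (M.node_mem_posSet.2 v0)⟩
      · exact ⟨hm 1, .inr (M.node_mem_negSet.2 v1)⟩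

theorem image_squareEdge (i : K.I) (k : Fin 4) :
    (fun z => K.map i (coords z)) '' squareEdge k = K.edge i k '' Ioo 0 1 := by
  rw [← image_image (K.map i) coords, coords_image_squareEdge, image_image]
  rfl

theorem orientation_map {i : K.I} {z : Plane} (hz : z ∈ openModelSquare) :
    PreservesOrientationAt
      (extChartAt halfPlaneModel (K.map i (coords z)) ∘ fun z => K.map i (coords z)) z := by
  -- At a point of an open square the preferred chart is the cell chart, in which the characteristic
  -- map is a translation.
  have hidx : K.chartIdx (K.map i (coords z)) = .inr i := by
    have hz' := bump_coords_pos.2 hz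
    have hpos : 0 < K.bumpAt i (K.map i (coords z)) := by
      rwa [K.bumpAt_map (bump_nonneg.1 hz'.le)]
    rcases K.chartIdx_spec (K.map i (coords z)) with ⟨j, hj, h⟩ | ⟨hno, _⟩
    · obtain ⟨p, hp, he⟩ := K.bumpAt_pos_iff.1 hj
      rw [h, (map_eq_map_of_bump hp (bump_nonneg.1 hz'.le) he).1]
    · exact (hno i hpos).elim
  have heq : ∀ y ∈ openModelSquare,
      (extChartAt halfPlaneModel (K.map i (coords z)) ∘ fun z => K.map i (coords z)) y =
        y + !₂[2, 0] := by
    intro y hy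
    have hc : (extChartAt halfPlaneModel (K.map i (coords z)) ∘ fun z => K.map i (coords z)) y =
        (K.chart (K.chartIdx (K.map i (coords z))) (K.map i (coords y))).1 := rfl
    rw [hc, hidx]
    obtain ⟨h0, h1⟩ := K.cellChart_map (i := i) (bump_coords_pos.2 hy)
    refine Plane.ext' (h0.trans ?_) (h1.trans ?_) <;> simp [coords]
  have hnear := isOpen_openModelSquare.mem_nhds hz
  refine preservesOrientationAt_of_linear_pieces 1 1 (by simp) (by simp) ![1, 0]
    (vec_ne_zero one_ne_zero) rfl ?_ ?_
  · filter_upwards [isOpen_openModelSquare.eventually_mem hz] with y hy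
    refine ContinuousAt.congr (f := fun y => y + !₂[2, 0]) (by fun_prop) ?_
    filter_upwards [isOpen_openModelSquare.mem_nhds hy] with y' hy' using (heq y' hy').symm
  · filter_upwards [hnear] with y hy
    left
    intro r
    rw [heq y hy, heq z hz]
    match r with
    | 0 => simp
    | 1 => simp

/-- The quadrangulation of the realization of a marked square complex. -/
noncomputable def quadrangulation {n : ℕ} (c : Fin n → K.I) (hc : Function.Injective c)
    (hr : range c = M.vacᶜ) : M.surface.Quadrangulation where
  n := n
  map j z := K.map (c j) (coords z)
  continuousOn_map j := (K.continuousOn_map _).comp continuous_coords.continuousOn fun _ hz => hz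
  orientation_map j z hz := orientation_map hz
  map_corner_zero j := by
    rw [coords_squareCorner, K.map_corner]
    exact M.node_mem_posSet.2 (M.vert_mem _ (hr ▸ mem_range_self j : c j ∈ M.vacᶜ)).1
  map_corner_one j := by
    rw [coords_squareCorner, K.map_corner]
    exact M.node_mem_negSet.2 (M.vert_mem _ (hr ▸ mem_range_self j : c j ∈ M.vacᶜ)).2.1
  map_corner_two j := by
    rw [coords_squareCorner, K.map_corner]
    exact M.node_mem_posSet.2 (M.vert_mem _ (hr ▸ mem_range_self j : c j ∈ M.vacᶜ)).2.2.1
  map_corner_three j := by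
    rw [coords_squareCorner, K.map_corner]
    exact M.node_mem_negSet.2 (M.vert_mem _ (hr ▸ mem_range_self j : c j ∈ M.vacᶜ)).2.2.2
  covers x := by
    constructor
    · rintro ⟨j, z, hz, rfl⟩
      exact M.not_isVacuumAt (hr ▸ mem_range_self j : c j ∈ M.vacᶜ) (coords_mem_sq.2 hz)
    · intro hx
      obtain ⟨i, p, hp, rfl⟩ := K.exists_map_eq x
      have hi : i ∈ M.vacᶜ := fun hi => hx (M.isVacuumAt hi hp)
      rw [← hr] at hi
      obtain ⟨j, rfl⟩ := hi
      obtain ⟨z, rfl⟩ := exists_coords_eq p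
      exact ⟨j, z, hp, rfl⟩
  inj_open i z hz j w hw h := by
    obtain ⟨h1, h2⟩ := map_eq_map_of_bump (bump_coords_pos.2 hz) (coords_mem_sq.2 hw) h
    exact ⟨hc h1, coords_injective h2⟩
  inj_edge i k := by
    intro z hz w hw h
    obtain ⟨s, hs, hs'⟩ := coords_image_squareEdge k ▸ mem_image_of_mem coords hz
    obtain ⟨t, ht, ht'⟩ := coords_image_squareEdge k ▸ mem_image_of_mem coords hw
    have h' : K.map (c i) (coords z) = K.map (c i) (coords w) := h
    rw [← hs', ← ht'] at h'
    have := edge_injOn (c i) k hs ht h'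
    subst this
    exact coords_injective (hs'.symm.trans ht')
  edge_eq_or_disjoint i k j l := by
    rw [image_squareEdge, image_squareEdge]
    by_cases hd : Disjoint (K.edge (c i) k '' Ioo 0 1) (K.edge (c j) l '' Ioo 0 1)
    · exact .inr hd
    left
    obtain ⟨_, ⟨s, hs, rfl⟩, t, ht, h⟩ := not_disjoint_iff.1 hd
    rw [edge_image_eq_iff]
    exact (edge_eq_edge_iff ht hs h.symm).imp (fun h => ⟨h.1, h.2.1⟩) id
  edge_boundary_or_internal i k := by
    simp only [image_squareEdge]
    by_cases h0 : K.idx (c i) k = 0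
    · left
      constructor
      · rintro _ ⟨s, hs, rfl⟩
        exact M.edge_mem_diff h0 hs
      · intro j l h
        rcases edge_image_eq_iff.1 h with ⟨h1, rfl⟩ | h
        · rw [hc h1]
        · have := h.2
          omega
    · right
      constructor
      · rintro _ ⟨s, hs, rfl⟩
        exact K.edge_mem_interior h0 hs
      -- The partner of edge `k` belongs to the preceding corner in the fan; it is the edge through
      -- which one leaves that corner.
      · obtain ⟨i', k', hn⟩ := K.exists_prev h0
        have hi' : i' ∈ M.vacᶜ := (M.notMem_vac_of_next hn).1
        rw [← hr] at hi'
        obtain ⟨j, rfl⟩ := hi'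
        have hn' : K.Next (c j) (k' - 1 + 1) (c i) k := by rwa [sub_add_cancel]
        refine ⟨(j, k' - 1), ⟨?_, hn'.edge_image_eq⟩, ?_⟩
        · intro he
          obtain ⟨rfl, rfl⟩ := Prod.mk.inj he
          exact not_next_self _ _ hn'
        · rintro ⟨j', l⟩ ⟨hne, he⟩
          rcases edge_image_eq_iff.1 he with ⟨h1, rfl⟩ | h
          · exact (hne (Prod.ext (hc h1) rfl)).elim
          · obtain ⟨h1, h2⟩ := K.corner_inj (h.1.trans hn'.1.symm)
              (Nat.succ_injective (h.2.symm.trans hn'.2))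
            exact Prod.ext (hc h1) (add_right_cancel h2)

theorem quadrangulation_map_corner {n : ℕ} {c : Fin n → K.I} (hc : Function.Injective c)
    (hr : range c = M.vacᶜ) (j : Fin n) (k : Fin 4) :
    (M.quadrangulation c hc hr).map j (squareCorner k) = K.node (K.vert (c j) k) := by
  change K.map (c j) (coords (squareCorner k)) = _
  rw [coords_squareCorner, K.map_corner]

theorem quadrangulation_image_eq_iff {n : ℕ} {c : Fin n → K.I} (hc : Function.Injective c)
    (hr : range c = M.vacᶜ) {i j : Fin n} {k l : Fin 4} :
    (M.quadrangulation c hc hr).map j '' squareEdge l =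
      (M.quadrangulation c hc hr).map i '' squareEdge k ↔
        (c j = c i ∧ l = k) ∨ K.Next (c j) (l + 1) (c i) k := by
  rw [← edge_image_eq_iff, ← image_squareEdge, ← image_squareEdge]
  rfl

end Marking
end SquareComplex

/-! ### Chains -/

section Chain
open Relation
variable {C : Type*} {σ : C → C → Prop}

/-- The number of predecessors of an element. -/
noncomputable def chainIdx (σ : C → C → Prop) (c : C) : ℕ := {x | TransGen σ x c}.ncard

theorem chainIdx_succ [Finite C] (hi : ∀ a b c, σ a c → σ b c → a = b) (hac : ∀ c, ¬ TransGen σ c c) {c c' : C}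
    (h : σ c c') : chainIdx σ c' = chainIdx σ c + 1 := by
  have e : {x | TransGen σ x c'} = insert c {x | TransGen σ x c} := by
    ext x
    constructor
    · intro hx
      obtain ⟨y, hxy, hy⟩ := TransGen.tail'_iff.1 hx
      -- By uniqueness of predecessors the last step into `c'` comes from `c`.
      obtain rfl := hi _ _ _ hy h
      rcases reflTransGen_iff_eq_or_transGen.1 hxy with rfl | hxy
      · exact .inl rfl
      · exact .inr hxy
    · rintro (rfl | hx)
      · exact .single h
      · exact TransGen.tail hx h
  rw [chainIdx, e, ncard_insert_of_notMem (show c ∉ {x | TransGen σ x c} from hac c) (Set.toFinite _)]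
  rfl

theorem chainIdx_lt [Finite C] (hac : ∀ c, ¬ TransGen σ c c) {c c' : C}
    (h : TransGen σ c c') : chainIdx σ c < chainIdx σ c' :=
  ncard_lt_ncard ⟨fun _ hx => TransGen.trans hx h, fun hs => hac c (hs h)⟩ (Set.toFinite _)

theorem reflTransGen_total (hf : ∀ a b c, σ a b → σ a c → b = c) {a b c : C}
    (h : ReflTransGen σ a b) (h' : ReflTransGen σ a c) :
    ReflTransGen σ b c ∨ ReflTransGen σ c b :=
  ReflTransGen.total_of_right_unique (fun a b c h h' => hf a b c h h') h h'

theorem reflTransGen_total' (hi : ∀ a b c, σ a c → σ b c → a = b) {a b c : C}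
    (h : ReflTransGen σ b a) (h' : ReflTransGen σ c a) :
    ReflTransGen σ b c ∨ ReflTransGen σ c b := by
  have := ReflTransGen.total_of_right_unique (r := Function.swap σ)
    (fun a b c h h' => hi b c a h h') (reflTransGen_swap.2 h) (reflTransGen_swap.2 h')
  exact this.symm.imp reflTransGen_swap.1 reflTransGen_swap.1

/-- For a partial injection neither paths with a common start nor paths with a common end branch, so
an equivalence class is a single chain. -/
theorem comparable_of_mk_eq (hf : ∀ a b c, σ a b → σ a c → b = c)
    (hi : ∀ a b c, σ a c → σ b c → a = b) {c c' : C} (h : Quot.mk σ c = Quot.mk σ c') :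
    ReflTransGen σ c c' ∨ ReflTransGen σ c' c := by
  rw [Quot.eq] at h
  induction h with
  | rel a b h => exact .inl (.single h)
  | refl a => exact .inl .refl
  | symm a b _ ih => exact ih.symm
  | trans a b c _ _ ih ih' =>
    rcases ih with h | h <;> rcases ih' with h' | h'
    · exact .inl (h.trans h')
    · exact reflTransGen_total' hi h h'
    · exact reflTransGen_total hf h h'
    · exact .inr (h'.trans h)

theorem mk_eq_of_reflTransGen {c c' : C} (h : ReflTransGen σ c c') :
    Quot.mk σ c = Quot.mk σ c' := by
  induction h with
  | refl => rfl
  | tail _ h ih => exact ih.trans (Quot.sound h)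

theorem eq_of_mk_eq_of_chainIdx_eq [Finite C] (hf : ∀ a b c, σ a b → σ a c → b = c)
    (hi : ∀ a b c, σ a c → σ b c → a = b) (hac : ∀ c, ¬ TransGen σ c c) {c c' : C}
    (h : Quot.mk σ c = Quot.mk σ c') (he : chainIdx σ c = chainIdx σ c') : c = c' := by
  rcases comparable_of_mk_eq hf hi h with h | h <;>
    rcases reflTransGen_iff_eq_or_transGen.1 h with h | h
  · exact h.symm
  · exact absurd he (chainIdx_lt hac h).ne
  · exact h
  · exact absurd he.symm (chainIdx_lt hac h).ne

/-- The number of elements of a chain. -/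
noncomputable def chainSize (v : Quot σ) : ℕ := {x | Quot.mk σ x = v}.ncard

theorem chainIdx_lt_chainSize [Finite C] (hac : ∀ c, ¬ TransGen σ c c) (c : C) :
    chainIdx σ c < chainSize (Quot.mk σ c) := by
  refine ncard_lt_ncard ⟨fun x hx => mk_eq_of_reflTransGen (TransGen.to_reflTransGen hx), fun hs => ?_⟩
    (Set.toFinite _)
  exact hac c (hs rfl)

/-- On a class the index is injective with values below the number of elements, so by counting it
takes all these values. -/
theorem exists_chainIdx_eq [Finite C] (hf : ∀ a b c, σ a b → σ a c → b = c)
    (hi : ∀ a b c, σ a c → σ b c → a = b) (hac : ∀ c, ¬ TransGen σ c c) {v : Quot σ} {j : ℕ}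
    (hj : j < chainSize v) : ∃ c, Quot.mk σ c = v ∧ chainIdx σ c = j := by
  have hsub : chainIdx σ '' {x | Quot.mk σ x = v} ⊆ (Finset.range (chainSize v) : Set ℕ) := by
    rintro _ ⟨c, rfl, rfl⟩
    exact Finset.mem_coe.2 (Finset.mem_range.2 (chainIdx_lt_chainSize hac c))
  have hinj : InjOn (chainIdx σ) {x | Quot.mk σ x = v} := fun c hc c' hc' h =>
    eq_of_mk_eq_of_chainIdx_eq hf hi hac (Eq.trans hc (Eq.symm hc')) h
  have heq := eq_of_subset_of_ncard_le hsub (by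
    rw [ncard_coe_finset, Finset.card_range, hinj.ncard_image]; exact le_rfl)
  have hj' : j ∈ chainIdx σ '' {x | Quot.mk σ x = v} := by
    rw [heq]; exact Finset.mem_coe.2 (Finset.mem_range.2 hj)
  exact hj'

open Classical in
/-- The `j`-th element of a chain. -/
noncomputable def chainElem (v : Quot σ) (j : ℕ) : C :=
  if h : ∃ c, Quot.mk σ c = v ∧ chainIdx σ c = j then h.choose else v.out

theorem chainElem_spec {v : Quot σ} {j : ℕ} (h : ∃ c, Quot.mk σ c = v ∧ chainIdx σ c = j) :
    Quot.mk σ (chainElem v j) = v ∧ chainIdx σ (chainElem v j) = j := by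
  rw [chainElem, dif_pos h]; exact h.choose_spec

theorem rel_of_chainIdx_eq [Finite C] (hf : ∀ a b c, σ a b → σ a c → b = c)
    (hi : ∀ a b c, σ a c → σ b c → a = b) (hac : ∀ c, ¬ TransGen σ c c) {c c' : C}
    (h : Quot.mk σ c = Quot.mk σ c') (he : chainIdx σ c' = chainIdx σ c + 1) : σ c c' := by
  have hlt : ¬ ReflTransGen σ c' c := by
    intro h'
    rcases reflTransGen_iff_eq_or_transGen.1 h' with rfl | h'
    · omega
    · have := chainIdx_lt hac h'
      omega
  have h1 := (comparable_of_mk_eq hf hi h).resolve_right hlt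
  rcases ReflTransGen.cases_head h1 with rfl | ⟨d, hd, hdc⟩
  · omega
  · have e := chainIdx_succ hi hac hd
    obtain rfl := eq_of_mk_eq_of_chainIdx_eq hf hi hac (mk_eq_of_reflTransGen hdc) (by omega)
    exact hd

/-- The square complex in which the corners are glued according to a given relation. -/
noncomputable def SquareComplex.ofRel (I : Type) [hI : Finite I] (σ : I × Fin 4 → I × Fin 4 → Prop)
    (hf : ∀ a b c, σ a b → σ a c → b = c) (hi : ∀ a b c, σ a c → σ b c → a = b)
    (hac : ∀ c, ¬ TransGen σ c c)
    (hglue : ∀ i k i' k', σ (i, k) (i', k') → σ (i', k' + 1) (i, k - 1))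
    (hpar : ∀ i k i' k', σ (i, k) (i', k') → ((k = 0 ∨ k = 2) ↔ (k' = 0 ∨ k' = 2))) :
    SquareComplex where
  I := I
  N := Quot σ
  finite_I := hI
  finite_N := Finite.of_surjective (Quot.mk σ) Quot.mk_surjective
  vert i k := Quot.mk σ (i, k)
  idx i k := chainIdx σ (i, k)
  size := chainSize
  corner := chainElem
  size_pos v := by
    obtain ⟨c, rfl⟩ := Quot.mk_surjective v
    exact (Nat.zero_le _).trans_lt (chainIdx_lt_chainSize hac c)
  idx_lt i k := chainIdx_lt_chainSize hac _
  corner_vert_idx i k := by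
    obtain ⟨h1, h2⟩ := chainElem_spec (σ := σ) ⟨(i, k), rfl, rfl⟩
    exact eq_of_mk_eq_of_chainIdx_eq hf hi hac h1 h2
  vert_corner v j hj := (chainElem_spec (exists_chainIdx_eq hf hi hac hj)).1
  idx_corner v j hj := (chainElem_spec (exists_chainIdx_eq hf hi hac hj)).2
  vert_add_one_ne i k h := by
    -- The relation preserves the parity of corners, and adjacent corners have different parities.
    have := congrArg (Quot.lift (fun c : I × Fin 4 => (c.2 = 0 ∨ c.2 = 2))
      fun a b h => propext (hpar _ _ _ _ h)) h
    change (k + 1 = 0 ∨ k + 1 = 2) = (k = 0 ∨ k = 2) at this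
    revert this; clear h; revert k; decide
  glue i k i' k' h h' := by
    have hσ := hglue _ _ _ _ (rel_of_chainIdx_eq hf hi hac h h')
    exact ⟨Quot.sound hσ, chainIdx_succ hi hac hσ⟩

theorem SquareComplex.ofRel_next_iff {I : Type} [Finite I] {σ : I × Fin 4 → I × Fin 4 → Prop}
    {hf : ∀ a b c, σ a b → σ a c → b = c} {hi : ∀ a b c, σ a c → σ b c → a = b}
    {hac : ∀ c, ¬ TransGen σ c c}
    {hglue : ∀ i k i' k', σ (i, k) (i', k') → σ (i', k' + 1) (i, k - 1)}
    {hpar : ∀ i k i' k', σ (i, k) (i', k') → ((k = 0 ∨ k = 2) ↔ (k' = 0 ∨ k' = 2))}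
    {i i' : I} {k k' : Fin 4} :
    (SquareComplex.ofRel I σ hf hi hac hglue hpar).Next i k i' k' ↔ σ (i, k) (i', k') :=
  ⟨fun h => rel_of_chainIdx_eq hf hi hac h.1 h.2, fun h => ⟨Quot.sound h, chainIdx_succ hi hac h⟩⟩

end Chain

/-! ### Gluing the squares around the edges of a tape graph -/

namespace TapeGraph
open Relation OccupiedSurface.Quadrangulation
variable {V H : Type*} (G : TapeGraph V H)

theorem exists_edge_enumeration [Finite H] :
    ∃ (n : ℕ) (β : H ≃ Fin n × Bool), ∀ h, β (G.flip h) = ((β h).1, !(β h).2) := by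
  let e := Finite.equivFin H
  -- Each edge is represented by its half-edge with the smaller number, which becomes the half at
  -- corner 0.
  let t := Finite.equivFin {h : H // e h < e (G.flip h)}
  let γ : Fin _ × Bool → H := fun x => if x.2 then G.flip (t.symm x.1) else t.symm x.1
  have h0 : ∀ x : Fin _ × Bool, x.2 = false → e (γ x) < e (G.flip (γ x)) := by
    rintro ⟨j, b⟩ rfl
    exact (t.symm j).2
  have h1 : ∀ x : Fin _ × Bool, x.2 = true → e (G.flip (γ x)) < e (γ x) := by
    rintro ⟨j, b⟩ rfl
    simpa [γ, G.flip_flip] using (t.symm j).2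
  have hb : Function.Bijective γ := by
    constructor
    · intro x y hxy
      have h2 : x.2 = y.2 := by
        rcases Bool.eq_false_or_eq_true x.2 with hx | hx <;>
          rcases Bool.eq_false_or_eq_true y.2 with hy | hy
        · rw [hx, hy]
        · have := h1 x hx
          rw [hxy] at this
          exact absurd this (h0 y hy).asymm
        · have := h0 x hx
          rw [hxy] at this
          exact absurd this (h1 y hy).asymm
        · rw [hx, hy]
      refine Prod.ext ?_ h2
      obtain ⟨j, b⟩ := x
      obtain ⟨j', b'⟩ := y
      change b = b' at h2
      subst h2
      cases b
      · exact t.symm.injective (Subtype.ext hxy)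
      · refine t.symm.injective (Subtype.ext ?_)
        have hxy' : G.flip (t.symm j) = G.flip (t.symm j') := hxy
        rw [← G.flip_flip (t.symm j), hxy', G.flip_flip]
    · intro h
      rcases lt_trichotomy (e h) (e (G.flip h)) with hlt | heq | hgt
      · exact ⟨(t ⟨h, hlt⟩, false), by simp [γ]⟩
      · exact (G.flip_ne h (e.injective heq).symm).elim
      · exact ⟨(t ⟨G.flip h, by rwa [G.flip_flip]⟩, true), by simp [γ, G.flip_flip]⟩
  refine ⟨_, (Equiv.ofBijective γ hb).symm, fun h => ?_⟩
  obtain ⟨x, rfl⟩ := (Equiv.ofBijective γ hb).surjective h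
  rw [Equiv.symm_apply_apply, Equiv.symm_apply_eq]
  obtain ⟨j, b⟩ := x
  cases b <;> simp [γ, G.flip_flip]

/-- The successor relation of corners at the negative vertices of the thickening. -/
def OddNext (h h' : H) : Prop := ∃ g, G.Consecutive g h ∧ h' = G.flip g

variable {G}

theorem OddNext.right_unique {a b c : H} (hb : G.OddNext a b) (hc : G.OddNext a c) : b = c := by
  obtain ⟨g, hg, rfl⟩ := hb
  obtain ⟨g', hg', rfl⟩ := hc
  rw [Consecutive.left_unique hg hg']

theorem OddNext.left_unique {a b c : H} (ha : G.OddNext a c) (hb : G.OddNext b c) : a = b := by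
  obtain ⟨g, hg, rfl⟩ := ha
  obtain ⟨g', hg', h⟩ := hb
  have : g = g' := by rw [← G.flip_flip g, h, G.flip_flip]
  subst this
  exact Consecutive.right_unique hg hg'

/-- If every boundary component of the thickening contains an outer arc, then the corners at each
negative vertex do not form a cycle. -/
theorem not_transGen_oddNext (hG : G.Oriented)
    (hb : ∀ C : G.BoundaryComponent, ∃ v, C.Contains (.outerArc v)) (a : H) :
    ¬ TransGen G.OddNext a a := by
  intro hcyc
  -- The cycle through `a`. As predecessors and successors are unique, `Z` is closed under both.
  let Z : Set H := {x | ReflTransGen G.OddNext a x ∧ ReflTransGen G.OddNext x a}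
  have hsucc : ∀ x ∈ Z, ∃ y ∈ Z, G.OddNext x y := by
    rintro x ⟨h1, h2⟩
    have h3 : TransGen G.OddNext x a := by
      rcases reflTransGen_iff_eq_or_transGen.1 h2 with rfl | h
      · exact hcyc
      · exact h
    obtain ⟨y, hxy, hy⟩ := TransGen.head'_iff.1 h3
    exact ⟨y, ⟨h1.tail hxy, hy⟩, hxy⟩
  have hpred : ∀ x ∈ Z, ∃ y ∈ Z, G.OddNext y x := by
    rintro x ⟨h1, h2⟩
    have h3 : TransGen G.OddNext a x := by
      rcases reflTransGen_iff_eq_or_transGen.1 h1 with rfl | h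
      · exact hcyc
      · exact h
    obtain ⟨y, hy, hyx⟩ := TransGen.tail'_iff.1 h3
    exact ⟨y, ⟨hy, .head hyx h2⟩, hyx⟩
  -- `P` holds for the half-sides in the triangles of the cycle: `h₋` belongs to the triangle of `h`
  -- and `h₊` to that of `flip h`. It is constant along the boundary and fails on outer arcs, so the
  -- component of `a₋` contains no outer arc.
  let P : BoundaryPiece V H → Prop := fun p =>
    BoundaryPiece.rec (fun x => if x.2 then G.flip x.1 ∈ Z else x.1 ∈ Z) (fun _ => False) p
  have hP : ∀ p p', G.BoundaryAdj p p' → P p = P p' := by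
    rintro p p' (⟨h, s⟩ | ⟨h, h', hh⟩ | ⟨h, hh⟩ | ⟨h, hh⟩)
    · rw [hG h s]
      cases s <;> simp [P, G.flip_flip]
    · have hn : G.OddNext h' (G.flip h) := ⟨h, hh, rfl⟩
      simp only [P, if_true, Bool.false_eq_true, if_false]
      apply propext
      constructor
      · intro hz
        obtain ⟨y, hy, hyx⟩ := hpred _ hz
        exact hyx.left_unique hn ▸ hy
      · intro hz
        obtain ⟨y, hy, hyx⟩ := hsucc _ hz
        exact hyx.right_unique hn ▸ hy
    · simp only [P, Bool.false_eq_true, if_false]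
      refine propext ⟨False.elim, fun hz => ?_⟩
      obtain ⟨y, _, g, hg, _⟩ := hsucc _ hz
      exact hh g hg.root_eq hg.1
    · simp only [P, if_true]
      refine propext ⟨fun hz => ?_, False.elim⟩
      obtain ⟨y, _, g, hg, he⟩ := hpred _ hz
      have : h = g := by rw [← G.flip_flip h, he, G.flip_flip]
      subst this
      exact hh y hg.root_eq.symm hg.1
  obtain ⟨v, hv⟩ := hb (Quot.mk _ (.halfSide (a, false)))
  have := congrArg (Quot.lift P hP) hv
  change False = (if false = true then G.flip a ∈ Z else a ∈ Z) at this
  rw [if_neg (by simp)] at this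
  exact this ▸ (⟨.refl, .refl⟩ : a ∈ Z)

/-- The positive corner of a half-edge. -/
def posCorner {n : ℕ} (r : ℕ) (a : Fin n × Bool) : (Fin n ⊕ Fin r) × Fin 4 :=
  (.inl a.1, cornerOf a.2)

/-- The negative corner after the positive corner of a half-edge. -/
def negCorner {n : ℕ} (r : ℕ) (a : Fin n × Bool) : (Fin n ⊕ Fin r) × Fin 4 :=
  (.inl a.1, cornerOf a.2 + 1)

theorem posCorner_injective {n r : ℕ} : Function.Injective (posCorner (n := n) r) := by
  rintro ⟨j, b⟩ ⟨j', b'⟩ h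
  obtain ⟨h1, h2⟩ := Prod.mk.inj h
  obtain rfl := Sum.inl_injective h1
  revert h2
  cases b <;> cases b' <;> simp [cornerOf]

theorem negCorner_injective {n r : ℕ} : Function.Injective (negCorner (n := n) r) := by
  rintro ⟨j, b⟩ ⟨j', b'⟩ h
  obtain ⟨h1, h2⟩ := Prod.mk.inj h
  exact posCorner_injective (r := r) (Prod.ext h1 (add_right_cancel h2))

theorem posCorner_ne_negCorner {n r : ℕ} (x y : Fin n × Bool) : posCorner r x ≠ negCorner r y := by
  obtain ⟨j, b⟩ := x
  obtain ⟨j', b'⟩ := y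
  intro h
  have := (Prod.mk.inj h).2
  revert this
  cases b <;> cases b' <;> simp [cornerOf]

variable (G) in
/-- The relation between corners along which the squares around the edges of a tape graph are
glued; there are also `r` unglued squares. -/
def Gluing {n : ℕ} (β : H ≃ Fin n × Bool) (r : ℕ) (c c' : (Fin n ⊕ Fin r) × Fin 4) : Prop :=
  (∃ h h', G.Consecutive h h' ∧ c = posCorner r (β h) ∧ c' = posCorner r (β h')) ∨
    ∃ h h', G.OddNext h h' ∧ c = negCorner r (β h) ∧ c' = negCorner r (β h')

section
variable {n r : ℕ} {β : H ≃ Fin n × Bool} {a b c : (Fin n ⊕ Fin r) × Fin 4}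

theorem Gluing.right_unique (hb : G.Gluing β r a b) (hc : G.Gluing β r a c) : b = c := by
  rcases hb with ⟨h, h', hn, rfl, rfl⟩ | ⟨h, h', hn, rfl, rfl⟩ <;>
    rcases hc with ⟨g, g', hn', e, rfl⟩ | ⟨g, g', hn', e, rfl⟩
  · obtain rfl := β.injective (posCorner_injective e)
    rw [hn.right_unique hn']
  · exact (posCorner_ne_negCorner _ _ e).elim
  · exact (posCorner_ne_negCorner _ _ e.symm).elim
  · obtain rfl := β.injective (negCorner_injective e)
    rw [hn.right_unique hn']

theorem Gluing.left_unique (ha : G.Gluing β r a c) (hb : G.Gluing β r b c) : a = b := by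
  rcases ha with ⟨h, h', hn, rfl, rfl⟩ | ⟨h, h', hn, rfl, rfl⟩ <;>
    rcases hb with ⟨g, g', hn', rfl, e⟩ | ⟨g, g', hn', rfl, e⟩
  · obtain rfl := β.injective (posCorner_injective e)
    rw [hn.left_unique hn']
  · exact (posCorner_ne_negCorner _ _ e).elim
  · exact (posCorner_ne_negCorner _ _ e.symm).elim
  · obtain rfl := β.injective (negCorner_injective e)
    rw [hn.left_unique hn']

/-- The relation never mixes positive and negative corners. A cycle of positive corners contradicts
the strict order at a vertex, and a cycle of negative ones contradicts the presence of outer arcs.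
-/
theorem not_transGen_gluing (hG : G.Oriented)
    (hb : ∀ C : G.BoundaryComponent, ∃ v, C.Contains (.outerArc v)) :
    ¬ TransGen (G.Gluing β r) c c := by
  have hpos : ∀ h c', TransGen (G.Gluing β r) (posCorner r (β h)) c' →
      ∃ h', TransGen G.Consecutive h h' ∧ c' = posCorner r (β h') := by
    intro h c' hc
    induction hc with
    | single hs =>
      rcases hs with ⟨g, g', hn, e, rfl⟩ | ⟨g, g', hn, e, rfl⟩
      · obtain rfl := β.injective (posCorner_injective e)
        exact ⟨g', .single hn, rfl⟩
      · exact (posCorner_ne_negCorner _ _ e).elim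
    | tail _ hs ih =>
      obtain ⟨h', ht, rfl⟩ := ih
      rcases hs with ⟨g, g', hn, e, rfl⟩ | ⟨g, g', hn, e, rfl⟩
      · obtain rfl := β.injective (posCorner_injective e)
        exact ⟨g', ht.tail hn, rfl⟩
      · exact (posCorner_ne_negCorner _ _ e).elim
  have hneg : ∀ h c', TransGen (G.Gluing β r) (negCorner r (β h)) c' →
      ∃ h', TransGen G.OddNext h h' ∧ c' = negCorner r (β h') := by
    intro h c' hc
    induction hc with
    | single hs =>
      rcases hs with ⟨g, g', hn, e, rfl⟩ | ⟨g, g', hn, e, rfl⟩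
      · exact (posCorner_ne_negCorner _ _ e.symm).elim
      · obtain rfl := β.injective (negCorner_injective e)
        exact ⟨g', .single hn, rfl⟩
    | tail _ hs ih =>
      obtain ⟨h', ht, rfl⟩ := ih
      rcases hs with ⟨g, g', hn, e, rfl⟩ | ⟨g, g', hn, e, rfl⟩
      · exact (posCorner_ne_negCorner _ _ e.symm).elim
      · obtain rfl := β.injective (negCorner_injective e)
        exact ⟨g', ht.tail hn, rfl⟩
  intro hc
  obtain ⟨d, hd, _⟩ := TransGen.head'_iff.1 hc
  rcases hd with ⟨h, h', hn, rfl, rfl⟩ | ⟨h, h', hn, rfl, rfl⟩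
  · obtain ⟨g, hg, e⟩ := hpos h _ hc
    obtain rfl := β.injective (posCorner_injective e)
    refine G.lt_irrefl h ?_
    have htr : ∀ x y, TransGen G.Consecutive x y → G.lt x y := by
      intro x y hxy
      induction hxy with
      | single hs => exact hs.1
      | tail _ hs ih => exact G.lt_trans _ _ _ ih hs.1
    exact htr _ _ hg
  · obtain ⟨g, hg, e⟩ := hneg h _ hc
    obtain rfl := β.injective (negCorner_injective e)
    exact not_transGen_oddNext hG hb h hg

/-- Let `h'` follow `h` at a positive vertex. From the negative end of the common edge, the negative
corner of `h'` precedes that of `flip h`. This is how `OddNext` is defined. -/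
theorem gluing_glue (hβ : ∀ h, β (G.flip h) = ((β h).1, !(β h).2)) {i i' : Fin n ⊕ Fin r}
    {k k' : Fin 4} (h : G.Gluing β r (i, k) (i', k')) : G.Gluing β r (i', k' + 1) (i, k - 1) := by
  have hc : ∀ b : Bool, cornerOf b - 1 = cornerOf (!b) + 1 := by
    intro b; cases b <;> rfl
  have hc' : ∀ b : Bool, cornerOf (!b) + 1 + 1 = cornerOf b := by
    intro b; cases b <;> rfl
  rcases h with ⟨h, h', hn, e, e'⟩ | ⟨h, h', hn, e, e'⟩
  · obtain ⟨rfl, rfl⟩ := Prod.mk.inj e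
    obtain ⟨rfl, rfl⟩ := Prod.mk.inj e'
    refine .inr ⟨h', G.flip h, ⟨h, hn, rfl⟩, rfl, ?_⟩
    rw [negCorner, hβ, hc]
  · obtain ⟨rfl, rfl⟩ := Prod.mk.inj e
    obtain ⟨rfl, rfl⟩ := Prod.mk.inj e'
    obtain ⟨g, hg, rfl⟩ := hn
    refine .inl ⟨g, h, hg, ?_, ?_⟩
    · rw [posCorner, hβ, hc']
    · rw [posCorner, add_sub_cancel_right]

theorem Gluing.even_iff {i i' : Fin n ⊕ Fin r} {k k' : Fin 4}
    (h : G.Gluing β r (i, k) (i', k')) : (k = 0 ∨ k = 2) ↔ (k' = 0 ∨ k' = 2) := by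
  have h0 : ∀ b : Bool, cornerOf b = 0 ∨ cornerOf b = 2 := by
    intro b; cases b <;> simp [cornerOf]
  have h1 : ∀ b : Bool, ¬ (cornerOf b + 1 = 0 ∨ cornerOf b + 1 = 2) := by
    intro b; cases b <;> simp [cornerOf]
  rcases h with ⟨h, h', hn, e, e'⟩ | ⟨h, h', hn, e, e'⟩
  · rw [(Prod.mk.inj e).2, (Prod.mk.inj e').2]
    exact iff_of_true (h0 _) (h0 _)
  · rw [(Prod.mk.inj e).2, (Prod.mk.inj e').2]
    exact iff_of_false (h1 _) (h1 _)

theorem Gluing.isLeft (h : G.Gluing β r a b) : a.1.isLeft ∧ b.1.isLeft := by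
  rcases h with ⟨h, h', hn, rfl, rfl⟩ | ⟨h, h', hn, rfl, rfl⟩ <;> exact ⟨rfl, rfl⟩

end

end TapeGraph

/-! ### Sufficiency of the breakpoints -/

namespace TapeGraph
open Relation OccupiedSurface.Quadrangulation
variable {V H : Type*} {G : TapeGraph V H}

section
variable (hG : G.Oriented)
  (hb : ∀ C : G.BoundaryComponent, ∃ v, C.Contains (.outerArc v))
  {n r : ℕ} (β : H ≃ Fin n × Bool) (hβ : ∀ h, β (G.flip h) = ((β h).1, !(β h).2))

/-- The square complex with one square for each edge of a tape graph, and `r` further squares. -/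
noncomputable def complex (r : ℕ) : SquareComplex :=
  SquareComplex.ofRel (Fin n ⊕ Fin r) (G.Gluing β r) (fun _ _ _ => Gluing.right_unique)
    (fun _ _ _ => Gluing.left_unique) (fun _ => not_transGen_gluing hG hb)
    (fun _ _ _ _ => gluing_glue hβ) (fun _ _ _ _ => Gluing.even_iff)

theorem complex_next_iff {i i' : Fin n ⊕ Fin r} {k k' : Fin 4} :
    (complex hG hb β hβ r).Next i k i' k' ↔ G.Gluing β r (i, k) (i', k') :=
  SquareComplex.ofRel_next_iff

/-- The vertices of the square complex that are at positive corners. -/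
def IsEven : Quot (G.Gluing β r) → Prop :=
  Quot.lift (fun c => c.2 = 0 ∨ c.2 = 2) fun _ _ h => propext (Gluing.even_iff h)

/-- The vertices of the square complex that are vertices of the occupied surface. -/
def IsMarked : Quot (G.Gluing β r) → Prop :=
  Quot.lift (fun c => c.1.isLeft ∨ c.2 = 0 ∨ c.2 = 1) fun _ _ h =>
    propext (iff_of_true (.inl h.isLeft.1) (.inl h.isLeft.2))

theorem complex_size (w : Fin r) (k : Fin 4) :
    (complex hG hb β hβ r).size ((complex hG hb β hβ r).vert (.inr w) k) = 1 := by
  have h1 : (complex hG hb β hβ r).idx (.inr w) k = 0 := by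
    by_contra h
    obtain ⟨i, k', hn⟩ := (complex hG hb β hβ r).exists_prev h
    have := ((complex_next_iff hG hb β hβ).1 hn).isLeft.2
    simp at this
  have h2 := (complex hG hb β hβ r).idx_lt (.inr w) k
  by_contra h
  obtain ⟨i, k', hn⟩ := (complex hG hb β hβ r).exists_next (i := .inr w) (k := k) (by omega)
  have := ((complex_next_iff hG hb β hβ).1 hn).isLeft.1
  simp at this

/-- The signs of the vertices of the square complex. -/
noncomputable def marking (r : ℕ) : (complex hG hb β hβ r).Marking where
  pos := {u | IsMarked β u ∧ IsEven β u}
  neg := {u | IsMarked β u ∧ ¬ IsEven β u}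
  vac := range Sum.inr
  disjoint := Set.disjoint_left.2 fun _ h h' => h'.2 h.2
  vert_mem i hi := by
    obtain ⟨j, rfl⟩ : ∃ j, i = Sum.inl j := by
      rcases i with j | w
      · exact ⟨j, rfl⟩
      · exact (hi ⟨w, rfl⟩).elim
    exact ⟨⟨.inl rfl, .inl rfl⟩, ⟨.inl rfl, by rintro (h | h) <;> simp at h⟩,
      ⟨.inl rfl, .inr rfl⟩, ⟨.inl rfl, by rintro (h | h) <;> simp at h⟩⟩
  vac_vert i hi := by
    obtain ⟨w, rfl⟩ := hi
    refine ⟨⟨.inr (.inl rfl), .inl rfl⟩, ⟨.inr (.inr rfl), by rintro (h | h) <;> simp at h⟩, ?_, ?_⟩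
    · rintro (⟨h | h | h, _⟩ | ⟨h | h | h, _⟩) <;> simp at h
    · rintro (⟨h | h | h, _⟩ | ⟨h | h | h, _⟩) <;> simp at h
  vac_size i hi k := by
    obtain ⟨w, rfl⟩ := hi
    exact complex_size hG hb β hβ w k

/-- The vertex of the tape graph at a corner, if the corner is a positive vertex. -/
def label (e : Fin r ≃ {v // ∀ h, G.root h ≠ v}) (c : (Fin n ⊕ Fin r) × Fin 4) : Option V :=
  Sum.elim (fun j => ![some (G.root (β.symm (j, false))), none,
      some (G.root (β.symm (j, true))), none] c.2)
    (fun w => ![some (e w : V), none, none, none] c.2) c.1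

theorem label_posCorner (e : Fin r ≃ {v // ∀ h, G.root h ≠ v}) (h : H) :
    label β e (posCorner r (β h)) = some (G.root h) := by
  obtain ⟨⟨j, b⟩, rfl⟩ := β.symm.surjective h
  cases b <;> simp [label, posCorner, cornerOf]

theorem label_negCorner (e : Fin r ≃ {v // ∀ h, G.root h ≠ v}) (x : Fin n × Bool) :
    label β e (negCorner r x) = none := by
  obtain ⟨j, b⟩ := x
  cases b <;> simp [label, negCorner, cornerOf]

theorem Gluing.label_eq {β : H ≃ Fin n × Bool} (e : Fin r ≃ {v // ∀ h, G.root h ≠ v})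
    {c c' : (Fin n ⊕ Fin r) × Fin 4} (h : G.Gluing β r c c') : label β e c = label β e c' := by
  rcases h with ⟨h, h', hn, rfl, rfl⟩ | ⟨h, h', hn, rfl, rfl⟩
  · rw [label_posCorner, label_posCorner, hn.root_eq]
  · rw [label_negCorner, label_negCorner]

theorem label_eq_some {e : Fin r ≃ {v // ∀ h, G.root h ≠ v}} {c : (Fin n ⊕ Fin r) × Fin 4} {v : V}
    (h : label β e c = some v) :
    (∃ h, G.root h = v ∧ c = posCorner r (β h)) ∨ ∃ w, (e w : V) = v ∧ c = (.inr w, 0) := by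
  obtain ⟨j | w, k⟩ := c
  · left
    match k with
    | 0 => exact ⟨β.symm (j, false), by simpa [label] using h, by simp [posCorner, cornerOf]⟩
    | 1 => simp [label] at h
    | 2 => exact ⟨β.symm (j, true), by simpa [label] using h, by simp [posCorner, cornerOf]⟩
    | 3 => simp [label] at h
  · right
    match k with
    | 0 => exact ⟨w, by simpa [label] using h, rfl⟩
    | 1 => simp [label] at h
    | 2 => simp [label] at h
    | 3 => simp [label] at h

theorem exists_label (e : Fin r ≃ {v // ∀ h, G.root h ≠ v}) (v : V) :
    ∃ c, label β e c = some v := by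
  by_cases hv : ∃ h, G.root h = v
  · obtain ⟨h, rfl⟩ := hv
    exact ⟨_, label_posCorner β e h⟩
  · push Not at hv
    exact ⟨(.inr (e.symm ⟨v, hv⟩), 0), by simp [label]⟩

/-- Half-edges at one vertex are linked by consecutive ones, hence so are their corners; an isolated
vertex has a single labelled corner. Together with the invariance of labels this identifies the
positive vertices with those of the graph. -/
theorem mk_eq_of_label_eq [Finite H] {e : Fin r ≃ {v // ∀ h, G.root h ≠ v}}
    {c c' : (Fin n ⊕ Fin r) × Fin 4} {v : V} (h : label β e c = some v)
    (h' : label β e c' = some v) : Quot.mk (G.Gluing β r) c = Quot.mk (G.Gluing β r) c' := by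
  have key : ∀ g g', TransGen G.Consecutive g g' → Quot.mk (G.Gluing β r) (posCorner r (β g)) =
      Quot.mk (G.Gluing β r) (posCorner r (β g')) := by
    intro g g' hg
    induction hg with
    | single hs => exact Quot.sound (.inl ⟨_, _, hs, rfl, rfl⟩)
    | tail _ hs ih => exact ih.trans (Quot.sound (.inl ⟨_, _, hs, rfl, rfl⟩))
  rcases label_eq_some β h with ⟨g, rfl, rfl⟩ | ⟨w, rfl, rfl⟩ <;>
    rcases label_eq_some β h' with ⟨g', hg', rfl⟩ | ⟨w', hw', rfl⟩
  · rcases G.lt_total g g' hg'.symm with hlt | rfl | hlt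
    · exact key _ _ (lt_iff_transGen_consecutive.1 hlt)
    · rfl
    · exact (key _ _ (lt_iff_transGen_consecutive.1 hlt)).symm
  · exact ((e w').2 g hw'.symm).elim
  · exact ((e w).2 g' hg').elim
  · rw [e.injective (Subtype.ext hw')]

theorem marked_of_label {e : Fin r ≃ {v // ∀ h, G.root h ≠ v}} {c : (Fin n ⊕ Fin r) × Fin 4} {v : V}
    (h : label β e c = some v) :
    IsMarked β (Quot.mk (G.Gluing β r) c) ∧ IsEven β (Quot.mk (G.Gluing β r) c) := by
  rcases label_eq_some β h with ⟨g, rfl, rfl⟩ | ⟨w, rfl, rfl⟩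
  · refine ⟨.inl rfl, ?_⟩
    change cornerOf (β g).2 = 0 ∨ cornerOf (β g).2 = 2
    cases (β g).2 <;> simp [cornerOf]
  · exact ⟨.inr (.inl rfl), .inl rfl⟩

theorem exists_label_of_marked (e : Fin r ≃ {v // ∀ h, G.root h ≠ v})
    {c : (Fin n ⊕ Fin r) × Fin 4} (h1 : IsMarked β (Quot.mk (G.Gluing β r) c))
    (h2 : IsEven β (Quot.mk (G.Gluing β r) c)) : ∃ v, label β e c = some v := by
  obtain ⟨j | w, k⟩ := c
  · rcases h2 with h | h <;> obtain rfl : k = _ := h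
    · exact ⟨_, rfl⟩
    · exact ⟨_, rfl⟩
  · rcases h2 with h | h <;> obtain rfl : k = _ := h
    · exact ⟨_, rfl⟩
    · rcases h1 with h | h | h <;> simp at h

end

theorem isSpine_of_hasBreakpoint (G : TapeGraph V H) [Finite V] [Finite H] (hG : G.Oriented)
    (h : ∀ C : G.BoundaryComponent, C.HasBreakpoint) : G.IsSpine := by
  have hb : ∀ C : G.BoundaryComponent, ∃ v, C.Contains (.outerArc v) := fun C =>
    (BoundaryComponent.hasBreakpoint_iff C).1 (h C)
  obtain ⟨n, β, hβ⟩ := G.exists_edge_enumeration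
  -- The isolated vertices of the graph number the unglued squares, which become vacuums.
  let e := (Finite.equivFin {v // ∀ h, G.root h ≠ v}).symm
  let r := Nat.card {v // ∀ h, G.root h ≠ v}
  let K := complex hG hb β hβ r
  let M := marking hG hb β hβ r
  have hr : range Sum.inl = M.vacᶜ := by
    ext i
    rcases i with j | w
    · exact iff_of_true ⟨j, rfl⟩ (by rintro ⟨w, hw⟩; simp at hw)
    · exact iff_of_false (by rintro ⟨w, hw⟩; simp at hw) (fun hw => hw ⟨w, rfl⟩)
  let Q := M.quadrangulation (n := n) Sum.inl Sum.inl_injective hr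
  refine ⟨K.Space, inferInstance, inferInstance, M.surface, Q, ?_⟩
  choose c hc using exists_label β e
  let α₀ : V → M.surface.pos := fun v =>
    ⟨K.node (Quot.mk _ (c v)), M.node_mem_posSet.2 (marked_of_label β (hc v))⟩
  have hα : Function.Bijective α₀ := by
    constructor
    · intro v w hvw
      have h1 : Quot.mk (G.Gluing β r) (c v) = Quot.mk (G.Gluing β r) (c w) :=
        K.node_injective (congrArg Subtype.val hvw)
      have h2 := congrArg (Quot.lift (label β e) fun _ _ h => h.label_eq e) h1
      have h3 : label β e (c v) = label β e (c w) := h2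
      rw [hc, hc] at h3
      exact Option.some_injective _ h3
    · rintro ⟨_, u, hu, rfl⟩
      obtain ⟨d, rfl⟩ := Quot.mk_surjective u
      obtain ⟨v, hv⟩ := exists_label_of_marked β e hu.1 hu.2
      exact ⟨v, Subtype.ext (congrArg K.node (mk_eq_of_label_eq β (hc v) hv))⟩
  refine ⟨Equiv.ofBijective α₀ hα, β, fun h => ?_, hβ, fun h h' => ?_, fun ⟨h, s⟩ => ?_⟩
  · exact (congrArg K.node (mk_eq_of_label_eq β (hc _) (label_posCorner β e h))).trans
      (M.quadrangulation_map_corner _ _ _ _).symm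
  -- Two edges have the same image if they are equal or glued. Equality is impossible here, because
  -- one leaves a positive corner through an odd edge and enters one through an even edge.
  · have hnext : ∀ h h', Q.SpineNext (β h) (β h') ↔ G.Consecutive h h' := by
      intro h h'
      refine (M.quadrangulation_image_eq_iff Sum.inl_injective hr).trans ?_
      rw [sub_add_cancel]
      constructor
      · rintro (⟨_, h2⟩ | h2)
        · exfalso
          revert h2
          cases (β h).2 <;> cases (β h').2 <;> decide
        · rcases (complex_next_iff hG hb β hβ).1 h2 with ⟨g, g', hn, e1, e2⟩ | ⟨g, g', hn, e1, e2⟩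
          · obtain rfl := β.injective (posCorner_injective (r := r) (a₁ := β h) e1)
            obtain rfl := β.injective (posCorner_injective (r := r) (a₁ := β h') e2)
            exact hn
          · exact (posCorner_ne_negCorner (r := r) (β h) _ e1).elim
      · intro hn
        exact .inr ((complex_next_iff hG hb β hβ).2 (.inl ⟨h, h', hn, rfl, rfl⟩))
    rw [lt_iff_transGen_consecutive]
    constructor
    · exact fun ht => TransGen.lift β (fun a b hab => (hnext a b).2 hab) _ _ ht
    · intro ht
      have hnext' : ∀ a b : Fin n × Bool, Q.SpineNext a b →
          G.Consecutive (β.symm a) (β.symm b) := by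
        intro a b hab
        refine (hnext _ _).1 ?_
        have ha := β.apply_symm_apply a
        have hb := β.apply_symm_apply b
        exact (congrArg₂ Q.SpineNext ha hb).mpr hab
      have := TransGen.lift β.symm hnext' _ _ ht
      have h1 := β.symm_apply_apply h
      have h2 := β.symm_apply_apply h'
      exact (congrArg₂ (TransGen G.Consecutive) h1 h2).mp this
  -- Orientedness is used here: changing both the half-edge and the sign leaves the triangle
  -- unchanged.
  · have hflip : (β (G.flip h)).2 = !(β h).2 := congrArg Prod.snd (hβ h)
    have htri : ∀ b s : Bool, triangleOf (!b) (!s) = triangleOf b s := by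
      intro b s; cases b <;> cases s <;> rfl
    rw [hG h s]
    exact (congrArg (fun b => triangleOf b (!s)) hflip).trans (htri _ _)

end TapeGraph

theorem mainTheorem10 {V H : Type*} [Finite V] [Finite H] (G : TapeGraph V H) (hG : G.Oriented) :
    G.IsSpine ↔ ∀ C : G.BoundaryComponent, C.HasBreakpoint :=
  ⟨fun h C => h.hasBreakpoint hG C, G.isSpine_of_hasBreakpoint hG⟩
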